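/- **Setting.** A graph $A$ (in the sense of Serre) has vertices $VA$, oriented edges $EA$, a fixed-point-free inversion $e\mapsto e^{-1}$ and endpoint maps $o,t$ with $o(e^{-1})=t(e)$. A graph of groups $\mathbb A$ on $A$ has vertex groups $A_v$, edge groups $A_e=A_{e^{-1}}$ and monomorphisms $\alpha_e:A_e\to A_{o(e)}$, $\omega_e:A_e\to A_{t(e)}$ with $\alpha_{e^{-1}}=\omega_e$. An $\mathbb A$-path is a sequence $a_0,e_1,a_1,\dots,e_k,a_k$ with $e_1\cdots e_k$ an edge path of $A$ and the $a_i$ in the corresponding vertex groups; $\sim$ is the equivalence relation generated, modulo concatenation, by $a,e,\omega_e(c),e^{-1},b\sim a\alpha_e(c)b$ ($c\in A_e$), and $\overline p$ is the class of $p$. A path is reduced if it has no subsequence $a,e,\omega_e(c),e^{-1},b$. $\pi_1(\mathbb A,v_0)$ is the group of classes of paths from $v_0$ to $v_0$. The Bass–Serre tree $\widetilde{(\mathbb A,v_0)}$ has as vertices the cosets $\overline pA_v$ ($p$ an $\mathbb A$-path from $v_0$ to $v$), with $\overline pA_v$ adjacent to $\overline{pae}A_{t(e)}$ for $a\in A_v$,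 $o(e)=v$; its base-vertex is $x_0=\overline 1A_{v_0}$, and $\pi_1(\mathbb A,v_0)$ acts on it by left multiplication. An $\mathbb A$-graph $\mathcal B$ is a graph $B$ with a graph morphism $[\cdot]:B\to A$, subgroups $B_u\le A_{[u]}$ ($u\in VB$) and elements $f_\alpha\in A_{[o(f)]}$, $f_\omega\in A_{[t(f)]}$ ($f\in EB$) with $(f^{-1})_\alpha=(f_\omega)^{-1}$. It defines a graph of groups $\mathbb B$ on $B$ with vertex groups $B_u$, edge groups $B_f=\alpha_{[f]}^{-1}(f_\alpha^{-1}B_{o(f)}f_\alpha)\cap\omega_{[f]}^{-1}(f_\omega B_{t(f)}f_\omega^{-1})$ and monomorphisms $c\mapsto f_\alpha\alpha_{[f]}(c)f_\alpha^{-1}$, $c\mapsto f_\omega^{-1}\omega_{[f]}(c)f_\omega$. $\mathcal B$ is folded if (1) there are no distinct edges $f_1\ne f_2$ with $o(f_1)=o(f_2)=z$, $[f_1]=[f_2]=e$ and $(f_2)_\alpha=a'(f_1)_\alpha\alpha_e(c)$ for some $a'\in B_z$, $c\in A_e$, and (2) $\alpha_{[f]}^{-1}(f_\alpha^{-1}B_{o(f)}f_\alpha)=\omega_{[f]}^{-1}(f_\omega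 B_{t(f)}f_\omega^{-1})$ for every edge $f$. A $\mathbb B$-path $p=b_0,f_1,b_1,\dots,f_s,b_s$ determines the $\mathbb A$-path $\mu(p)=b_0(f_1)_\alpha,[f_1],(f_1)_\omega b_1(f_2)_\alpha,\dots,[f_s],(f_s)_\omega b_s$. For $u_0\in VB$ with $[u_0]=v_0$, $\mu$ induces a homomorphism $\nu:\pi_1(\mathbb B,u_0)\to\pi_1(\mathbb A,v_0)$ and a simplicial map $\phi:\widetilde{(\mathbb B,u_0)}\to\widetilde{(\mathbb A,v_0)}$, $\overline pB_u\mapsto\overline{\mu(p)}A_{[u]}$; the language $L(\mathcal B,u_0)$ is the set of all $\mu(p)$, $p$ a reduced $\mathbb B$-path from $u_0$ to $u_0$. For algorithms, the vertex and edge groups of $\mathbb A$ are given by recursive presentations on finite generating sets, and their elements are given as words in these generators; elements of $\pi_1(\mathbb A,v_0)$ are given as $\mathbb A$-paths. A finite connected graph $\mathbb A$ of finitely generated groups is benign if 1. for all $e\in EA$ with $o(e)=v$ there is an algorithm that, given a finite $X\subseteq A_v$ and $a\in A_v$, decides whether $\langle X\rangle\cap a\alpha_e(A_e)$ is empty and,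 if it is not, produces an element of it; 2. no edge group has an infinite strictly ascending sequence of subgroups; 3. every edge group $A_e$ has solvable uniform membership problem: there is an algorithm that, given a finite $X\subseteq A_e$ and $a\in A_e$, decides whether $a\in\langle X\rangle$; 4. for all $e\in EA$ with $o(e)=v$ there is an algorithm that, given a finite $X\subseteq A_v$, computes a finite generating set of $\alpha_e(A_e)\cap\langle X\rangle$. A finite presentation of a subgroup consists of finitely many explicitly given elements that generate it and finitely many defining relators in these generators. **Theorem.** Let $\mathbb A$ be a benign graph of groups with base-vertex $v_0$, and let $G=\pi_1(\mathbb A,v_0)$. (a) There is an algorithm which, given a finite set in $G$ generating a subgroup $U\le G$, constructs a finite folded $\mathbb A$-graph $\mathcal B$ with a base-vertex $u_0$ of type $[u_0]=v_0$ such that $\overline{L(\mathcal B,u_0)}=U$, where each vertex group $B_u$ is given by a finite generating set of words in the generators of $A_{[u]}$. Moreover, for this $\mathcal B$, the map $\nu$ is an isomorphism from $\pi_1(\mathbb B,u_0)$ onto $U$, the map $\phi:\widetilde{(\mathcal B,u_0)}\to\widetilde{(\mathbb A,v_0)}$, where $\widetilde{(\mathcal B,u_0)}=\widetilde{(\mathbb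 B,u_0)}$, is injective, and its image is the tree $X_U=\bigcup_{u\in U}[x_0,ux_0]$. (b) Suppose in addition that for each $v\in VA$ there is an algorithm which, given a finite subset $Y$ of $A_v$, produces a finite presentation of the subgroup of $A_v$ generated by $Y$. Then there is an algorithm which, given a finite set $S\subseteq G$, constructs a finite presentation of the subgroup $U=\langle S\rangle\le G$. -/

import Mathlib

universe u₁ u₂ u₃ u₄ u₅ u₆

/-! ### Graphs of groups -/

/-- A graph in the sense of Serre.  `E u v` is the set of edges with initial vertex `u` and
terminal vertex `v`; the set of all edges is `Σ u v, E u v`.  The inverse-edge function is a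
fixed-point free involution exchanging endpoints (an edge with distinct endpoints is different
from its inverse anyway, so `inv_ne` only speaks of loops). -/
structure SerreGraph where
  V : Type u₁
  E : V → V → Type u₂
  inv : ∀ {u v : V}, E u v → E v u
  inv_inv : ∀ {u v : V} (e : E u v), inv (inv e) = e
  inv_ne : ∀ {v : V} (e : E v v), inv e ≠ e

/-- A graph of groups, with vertex groups `A v`, edge groups `Ae e` and boundary monomorphisms
`α e`, `ω e`.  The field `rev` says that `Ae e` and `Ae (inv e)` are identified in such a way that
`α (inv e) = ω e` and `ω (inv e) = α e`. -/
structure GraphOfGroups extends SerreGraph.{u₁, u₂} where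
  A : V → Type u₃
  [vertexGroup : ∀ v, Group (A v)]
  Ae : ∀ {u v : V}, E u v → Type u₄
  [edgeGroup : ∀ {u v : V} (e : E u v), Group (Ae e)]
  α : ∀ {u v : V} (e : E u v), Ae e →* A u
  ω : ∀ {u v : V} (e : E u v), Ae e →* A v
  α_injective : ∀ {u v : V} (e : E u v), Function.Injective (α e)
  ω_injective : ∀ {u v : V} (e : E u v), Function.Injective (ω e)
  rev : ∀ {u v : V} (e : E u v), ∃ φ : Ae e ≃* Ae (inv e),
    ∀ c : Ae e, α (inv e) (φ c) = ω e c ∧ ω (inv e) (φ c) = α e c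

attribute [instance] GraphOfGroups.vertexGroup GraphOfGroups.edgeGroup

namespace GraphOfGroups

variable (𝔸 : GraphOfGroups.{u₁, u₂, u₃, u₄})

/-- `𝔸`-paths `a₀, e₁, a₁, …, e_k, a_k` from `u` to `v`. -/
inductive Path : 𝔸.V → 𝔸.V → Type (max u₁ u₂ u₃)
  | nil {v : 𝔸.V} (a : 𝔸.A v) : Path v v
  | cons {u v w : 𝔸.V} (a : 𝔸.A u) (e : 𝔸.E u v) (p : Path v w) : Path u w

variable {𝔸}

namespace Path

/-- The number of edges of a path. -/
def length : ∀ {u v : 𝔸.V}, 𝔸.Path u v → ℕ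
  | _, _, nil _ => 0
  | _, _, cons _ _ p => p.length + 1

/-- Multiply the first group element of a path from the left. -/
def lmul : ∀ {u v : 𝔸.V}, 𝔸.A u → 𝔸.Path u v → 𝔸.Path u v
  | _, _, b, nil a => nil (b * a)
  | _, _, b, cons a e p => cons (b * a) e p

/-- Concatenation of `𝔸`-paths. -/
def comp : ∀ {u v w : 𝔸.V}, 𝔸.Path u v → 𝔸.Path v w → 𝔸.Path u w
  | _, _, _, nil a, q => q.lmul a
  | _, _, _, cons a e p, q => cons a e (p.comp q)

/-- The inverse `𝔸`-path. -/
def reverse : ∀ {u v : 𝔸.V}, 𝔸.Path u v → 𝔸.Path v u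
  | _, _, nil a => nil a⁻¹
  | _, _, cons a e p => p.reverse.comp (cons 1 (𝔸.inv e) (nil a⁻¹))

/-- A path regarded as a path between equal vertices. -/
def cast {u v u' v' : 𝔸.V} (hu : u = u') (hv : v = v') (p : 𝔸.Path u v) : 𝔸.Path u' v' :=
  hu ▸ hv ▸ p

/-- The equivalence relation `∼` on `𝔸`-paths: the equivalence relation generated, modulo
concatenation, by `a, e, ω_e(c), e⁻¹, b ∼ a α_e(c) b`. -/
inductive Sim : ∀ {u v : 𝔸.V}, 𝔸.Path u v → 𝔸.Path u v → Prop
  | basic {u v : 𝔸.V} (a : 𝔸.A u) (e : 𝔸.E u v) (c : 𝔸.Ae e) (b : 𝔸.A u) :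
      Sim (cons a e (cons (𝔸.ω e c) (𝔸.inv e) (nil b))) (nil (a * 𝔸.α e c * b))
  | comp {u v w : 𝔸.V} {p p' : 𝔸.Path u v} {q q' : 𝔸.Path v w} :
      Sim p p' → Sim q q' → Sim (p.comp q) (p'.comp q')
  | refl {u v : 𝔸.V} (p : 𝔸.Path u v) : Sim p p
  | symm {u v : 𝔸.V} {p q : 𝔸.Path u v} : Sim p q → Sim q p
  | trans {u v : 𝔸.V} {p q r : 𝔸.Path u v} : Sim p q → Sim q r → Sim p r

/-- A path is reduced if it has no subsequence of the form `a, e, ω_e(c), e⁻¹, b` (here `b` is the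
first group element of `r`). -/
def Reduced {u v : 𝔸.V} (p : 𝔸.Path u v) : Prop :=
  ∀ (x y : 𝔸.V) (q : 𝔸.Path u x) (a : 𝔸.A x) (e : 𝔸.E x y) (c : 𝔸.Ae e) (r : 𝔸.Path x v),
    p ≠ q.comp (cons a e (cons (𝔸.ω e c) (𝔸.inv e) r))

@[simp] theorem lmul_nil {v : 𝔸.V} (a b : 𝔸.A v) : (nil a : 𝔸.Path v v).lmul b = nil (b * a) := rfl

@[simp] theorem lmul_cons {u v w : 𝔸.V} (b a : 𝔸.A u) (e : 𝔸.E u v) (p : 𝔸.Path v w) :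
    (cons a e p).lmul b = cons (b * a) e p := rfl

@[simp] theorem nil_comp {u v : 𝔸.V} (a : 𝔸.A u) (p : 𝔸.Path u v) : (nil a).comp p = p.lmul a := rfl

@[simp] theorem cons_comp {u v w x : 𝔸.V} (a : 𝔸.A u) (e : 𝔸.E u v) (p : 𝔸.Path v w)
    (q : 𝔸.Path w x) : (cons a e p).comp q = cons a e (p.comp q) := rfl

theorem lmul_lmul {u v : 𝔸.V} (a b : 𝔸.A u) (p : 𝔸.Path u v) :
    (p.lmul b).lmul a = p.lmul (a * b) := by
  cases p <;> simp [mul_assoc]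

@[simp] theorem one_lmul {u v : 𝔸.V} (p : 𝔸.Path u v) : p.lmul 1 = p := by
  cases p <;> simp

theorem lmul_comp {u v w : 𝔸.V} (a : 𝔸.A u) (p : 𝔸.Path u v) (q : 𝔸.Path v w) :
    (p.lmul a).comp q = (p.comp q).lmul a := by
  cases p <;> simp [lmul_lmul]

theorem comp_assoc {u v w x : 𝔸.V} (p : 𝔸.Path u v) (q : 𝔸.Path v w) (r : 𝔸.Path w x) :
    (p.comp q).comp r = p.comp (q.comp r) := by
  induction p with
  | nil a => simp [lmul_comp]
  | cons a e p ih => simp [ih]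

@[simp] theorem one_comp {u v : 𝔸.V} (p : 𝔸.Path u v) : (nil 1).comp p = p := by
  simp

@[simp] theorem comp_one {u v : 𝔸.V} (p : 𝔸.Path u v) : p.comp (nil 1) = p := by
  induction p with
  | nil a => simp
  | cons a e p ih => simp [ih]

theorem sim_edge_inv {u v : 𝔸.V} (e : 𝔸.E u v) :
    Sim (cons 1 e (cons 1 (𝔸.inv e) (nil 1))) (nil (1 : 𝔸.A u)) := by
  simpa using Sim.basic (𝔸 := 𝔸) 1 e 1 1

theorem sim_inv_edge {u v : 𝔸.V} (e : 𝔸.E u v) :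
    Sim (cons 1 (𝔸.inv e) (cons 1 e (nil 1))) (nil (1 : 𝔸.A v)) := by
  simpa [𝔸.inv_inv] using sim_edge_inv (𝔸.inv e)

theorem comp_reverse {u v : 𝔸.V} (p : 𝔸.Path u v) : Sim (p.comp p.reverse) (nil 1) := by
  induction p with
  | nil a => simpa [reverse] using Sim.refl _
  | @cons u v w a e p ih =>
    have h1 : Sim ((cons a e (nil 1)).comp ((p.comp p.reverse).comp
        (cons 1 (𝔸.inv e) (nil a⁻¹))))
        ((cons a e (nil 1)).comp ((nil 1).comp (cons 1 (𝔸.inv e) (nil a⁻¹)))) :=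
      Sim.comp (Sim.refl _) (Sim.comp ih (Sim.refl _))
    have h2 : Sim (((nil a).comp (cons 1 e (cons 1 (𝔸.inv e) (nil 1)))).comp (nil a⁻¹))
        (((nil a).comp (nil 1)).comp (nil a⁻¹)) :=
      Sim.comp (Sim.comp (Sim.refl _) (sim_edge_inv e)) (Sim.refl _)
    simp only [nil_comp, cons_comp, lmul_nil, lmul_cons, mul_one, one_mul, one_lmul, mul_inv_cancel, comp_assoc] at h1 h2
    simpa [reverse] using h1.trans h2

theorem reverse_comp {u v : 𝔸.V} (p : 𝔸.Path u v) : Sim (p.reverse.comp p) (nil 1) := by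
  induction p with
  | nil a => simpa [reverse] using Sim.refl _
  | @cons u v w a e p ih =>
    have h1 : Sim (p.reverse.comp ((cons 1 (𝔸.inv e) (cons 1 e (nil 1))).comp p))
        (p.reverse.comp ((nil 1).comp p)) :=
      Sim.comp (Sim.refl _) (Sim.comp (sim_inv_edge e) (Sim.refl _))
    have h2 := h1.trans (by simpa using ih)
    simpa [reverse, comp_assoc] using h2

theorem Sim.reverse {u v : 𝔸.V} {p q : 𝔸.Path u v} (h : Sim p q) : Sim p.reverse q.reverse := by
  have h1 : Sim (p.reverse.comp (q.comp q.reverse)) p.reverse := by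
    simpa using Sim.comp (Sim.refl p.reverse) (comp_reverse q)
  have h2 : Sim ((p.reverse.comp p).comp q.reverse) q.reverse := by
    simpa using Sim.comp (reverse_comp p) (Sim.refl q.reverse)
  have h3 : Sim (p.reverse.comp (p.comp q.reverse)) (p.reverse.comp (q.comp q.reverse)) :=
    Sim.comp (Sim.refl _) (Sim.comp h (Sim.refl _))
  rw [comp_assoc] at h2
  exact (h1.symm.trans h3.symm).trans h2

@[simp] theorem length_lmul {u v : 𝔸.V} (a : 𝔸.A u) (p : 𝔸.Path u v) :
    (p.lmul a).length = p.length := by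
  cases p <;> simp [length]

@[simp] theorem length_comp {u v w : 𝔸.V} (p : 𝔸.Path u v) (q : 𝔸.Path v w) :
    (p.comp q).length = p.length + q.length := by
  induction p with
  | nil a => simp [length]
  | cons a e p ih => simp [length, ih]; omega

theorem Sim.length_mod_two {u v : 𝔸.V} {p q : 𝔸.Path u v} (h : Sim p q) :
    p.length % 2 = q.length % 2 := by
  induction h with
  | basic a e c b => simp [length]
  | comp _ _ h1 h2 => simp only [length_comp]; omega
  | refl p => rfl
  | symm _ h => exact h.symm
  | trans _ _ h1 h2 => exact h1.trans h2

end Path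

open _root_.GraphOfGroups.Path

/-- `∼` as a setoid. -/
def simSetoid (𝔸 : GraphOfGroups.{u₁, u₂, u₃, u₄}) (u v : 𝔸.V) : Setoid (𝔸.Path u v) :=
  ⟨Sim, ⟨Sim.refl, Sim.symm, Sim.trans⟩⟩

/-- The fundamental group `π₁(𝔸, v₀)`: the `∼`-classes of `𝔸`-paths from `v₀` to `v₀`, multiplied
by concatenation. -/
def Pi1 (𝔸 : GraphOfGroups.{u₁, u₂, u₃, u₄}) (v₀ : 𝔸.V) : Type (max u₁ u₂ u₃) :=
  Quotient (𝔸.simSetoid v₀ v₀)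

/-- The class of a closed path in the fundamental group. -/
def Pi1.mk {v₀ : 𝔸.V} (p : 𝔸.Path v₀ v₀) : 𝔸.Pi1 v₀ := Quotient.mk (𝔸.simSetoid v₀ v₀) p

instance (v₀ : 𝔸.V) : Group (𝔸.Pi1 v₀) where
  mul := Quotient.map₂ comp fun _ _ h _ _ h' => Sim.comp h h'
  one := Pi1.mk (nil 1)
  inv := Quotient.map reverse fun _ _ h => Sim.reverse h
  mul_assoc a b c := by
    induction a using Quotient.inductionOn
    induction b using Quotient.inductionOn
    induction c using Quotient.inductionOn
    exact congrArg Pi1.mk (comp_assoc _ _ _)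
  one_mul a := by
    induction a using Quotient.inductionOn
    exact congrArg Pi1.mk (one_comp _)
  mul_one a := by
    induction a using Quotient.inductionOn
    exact congrArg Pi1.mk (comp_one _)
  inv_mul_cancel a := by
    induction a using Quotient.inductionOn
    exact Quotient.sound (reverse_comp _)

/-! ### The Bass-Serre covering tree -/

/-- The relation `≈` on `𝔸`-paths from `v₀` to `v`: `p ≈ p'` iff `p ∼ p' a` for some `a ∈ A_v`. -/
def cosetSetoid (𝔸 : GraphOfGroups.{u₁, u₂, u₃, u₄}) (v₀ v : 𝔸.V) : Setoid (𝔸.Path v₀ v) where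
  r p p' := ∃ a : 𝔸.A v, Sim p (p'.comp (nil a))
  iseqv := by
    refine ⟨fun p => ⟨1, by simpa using Sim.refl p⟩, ?_, ?_⟩
    · rintro p q ⟨a, h⟩
      refine ⟨a⁻¹, ?_⟩
      have := Sim.comp h (Sim.refl (nil a⁻¹))
      rw [comp_assoc] at this
      simpa using this.symm
    · rintro p q r ⟨a, h⟩ ⟨b, h'⟩
      refine ⟨b * a, ?_⟩
      have := h.trans (Sim.comp h' (Sim.refl (nil a)))
      rw [comp_assoc] at this
      simpa using this

/-- The vertices `p̄ A_v` of the Bass-Serre tree: `≈`-classes of `𝔸`-paths originating at `v₀`. -/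
def TreeVertex (𝔸 : GraphOfGroups.{u₁, u₂, u₃, u₄}) (v₀ : 𝔸.V) : Type (max u₁ u₂ u₃) :=
  Σ v : 𝔸.V, Quotient (𝔸.cosetSetoid v₀ v)

/-- The vertex `p̄ A_v` of the Bass-Serre tree. -/
def TreeVertex.mk {v₀ v : 𝔸.V} (p : 𝔸.Path v₀ v) : 𝔸.TreeVertex v₀ :=
  ⟨v, Quotient.mk (𝔸.cosetSetoid v₀ v) p⟩

theorem TreeVertex.mk_eq {v₀ v : 𝔸.V} {p q : 𝔸.Path v₀ v} (a : 𝔸.A v)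
    (h : Sim p (q.comp (nil a))) : TreeVertex.mk p = TreeVertex.mk q :=
  congrArg (Sigma.mk v) (Quotient.sound ⟨a, h⟩)

/-- The parity of the distance from the base vertex. -/
def TreeVertex.parity {v₀ : 𝔸.V} (x : 𝔸.TreeVertex v₀) : ℕ :=
  Quotient.lift (s := 𝔸.cosetSetoid v₀ x.1) (fun p => p.length % 2)
    (by rintro p q ⟨a, h⟩; simpa [length] using h.length_mod_two) x.2

/-- The Bass-Serre covering tree of `(𝔸, v₀)`: the vertices `p̄ A_v` and `\overline{pae} A_{v'}` are
joined by an edge. -/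
def tree (𝔸 : GraphOfGroups.{u₁, u₂, u₃, u₄}) (v₀ : 𝔸.V) : SimpleGraph (𝔸.TreeVertex v₀) where
  Adj x x' := ∃ (v v' : 𝔸.V) (p : 𝔸.Path v₀ v) (a : 𝔸.A v) (e : 𝔸.E v v'),
    x = TreeVertex.mk p ∧ x' = TreeVertex.mk (p.comp (cons a e (nil 1)))
  symm := by
    constructor
    rintro x x' ⟨v, v', p, a, e, rfl, rfl⟩
    refine ⟨v', v, _, 1, 𝔸.inv e, rfl, ?_⟩
    refine (TreeVertex.mk_eq a ?_).symm
    have h : Sim (p.comp ((nil a).comp (cons 1 e (cons 1 (𝔸.inv e) (nil 1)))))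
        (p.comp ((nil a).comp (nil 1))) :=
      Sim.comp (Sim.refl _) (Sim.comp (Sim.refl _) (sim_edge_inv e))
    simpa [comp_assoc] using h
  loopless := by
    constructor
    rintro x ⟨v, v', p, a, e, h, h'⟩
    have h1 : x.parity = p.length % 2 := by rw [h]; rfl
    have h2 : x.parity = (p.comp (cons a e (nil 1))).length % 2 := by rw [h']; rfl
    simp only [length_comp, length] at h2
    omega

/-- The base vertex `1 A_{v₀}` of the Bass-Serre tree. -/
def treeBase (𝔸 : GraphOfGroups.{u₁, u₂, u₃, u₄}) (v₀ : 𝔸.V) : 𝔸.TreeVertex v₀ :=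
  TreeVertex.mk (nil 1)

/-- The action of `π₁(𝔸, v₀)` on the vertices of the Bass-Serre tree, `q̄ · p̄ A_v = \overline{qp} A_v`. -/
instance (v₀ : 𝔸.V) : MulAction (𝔸.Pi1 v₀) (𝔸.TreeVertex v₀) where
  smul g x := ⟨x.1, Quotient.map₂ (sa := 𝔸.simSetoid v₀ v₀) (sb := 𝔸.cosetSetoid v₀ x.1)
    (sc := 𝔸.cosetSetoid v₀ x.1) comp
    (by
      rintro q q' h p p' ⟨a, h'⟩
      exact ⟨a, by rw [comp_assoc]; exact Sim.comp h h'⟩) g x.2⟩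
  one_smul := by
    rintro ⟨v, x⟩
    induction x using Quotient.inductionOn
    exact congrArg TreeVertex.mk (one_comp _)
  mul_smul := by
    rintro g h ⟨v, x⟩
    induction x using Quotient.inductionOn
    induction g using Quotient.inductionOn
    induction h using Quotient.inductionOn
    exact congrArg TreeVertex.mk (comp_assoc _ _ _)

/-- The subtree `X_U = ⋃_{u ∈ U} [x₀, u x₀]` of the Bass-Serre tree; `[x₀, u x₀]` is the unique path
without repeated vertices from `x₀` to `u x₀`. -/
def hull {v₀ : 𝔸.V} (U : Subgroup (𝔸.Pi1 v₀)) : (𝔸.tree v₀).Subgraph :=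
  ⨆ (g : 𝔸.Pi1 v₀) (_ : g ∈ U)
    (p : (𝔸.tree v₀).Walk (𝔸.treeBase v₀) (g • 𝔸.treeBase v₀)) (_ : p.IsPath), p.toSubgraph

end GraphOfGroups

/-! ### `𝔸`-graphs -/

/-- An `𝔸`-graph: an underlying graph with a graph morphism to the graph of `𝔸` (`vtype`, `etype`),
a subgroup `B u` of the vertex group of the type of each vertex `u`, and two group elements
`f_α = labα f` and `f_ω = labω f` for each edge `f`. -/
structure AGraph (𝔸 : GraphOfGroups.{u₁, u₂, u₃, u₄}) extends SerreGraph.{u₅, u₆} where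
  vtype : V → 𝔸.V
  etype : ∀ {u v : V}, E u v → 𝔸.E (vtype u) (vtype v)
  etype_inv : ∀ {u v : V} (f : E u v), etype (inv f) = 𝔸.inv (etype f)
  B : ∀ u : V, Subgroup (𝔸.A (vtype u))
  labα : ∀ {u v : V}, E u v → 𝔸.A (vtype u)
  labω : ∀ {u v : V}, E u v → 𝔸.A (vtype v)
  labα_inv : ∀ {u v : V} (f : E u v), labα (inv f) = (labω f)⁻¹

namespace AGraph

open GraphOfGroups GraphOfGroups.Path

variable {𝔸 : GraphOfGroups.{u₁, u₂, u₃, u₄}} (𝓑 : AGraph.{u₁, u₂, u₃, u₄, u₅, u₆} 𝔸)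

theorem labω_inv {u v : 𝓑.V} (f : 𝓑.E u v) : 𝓑.labω (𝓑.inv f) = (𝓑.labα f)⁻¹ := by
  have h := 𝓑.labα_inv (𝓑.inv f)
  rw [𝓑.inv_inv] at h
  simp [h]

/-- `c ↦ f_α α_{[f]}(c) f_α⁻¹`. -/
def conjα {u v : 𝓑.V} (f : 𝓑.E u v) : 𝔸.Ae (𝓑.etype f) →* 𝔸.A (𝓑.vtype u) :=
  (MulAut.conj (𝓑.labα f)).toMonoidHom.comp (𝔸.α (𝓑.etype f))

/-- `c ↦ f_ω⁻¹ ω_{[f]}(c) f_ω`. -/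
def conjω {u v : 𝓑.V} (f : 𝓑.E u v) : 𝔸.Ae (𝓑.etype f) →* 𝔸.A (𝓑.vtype v) :=
  (MulAut.conj (𝓑.labω f)⁻¹).toMonoidHom.comp (𝔸.ω (𝓑.etype f))

/-- `α_{[f]}⁻¹(f_α⁻¹ B_{o(f)} f_α)`. -/
def edgeα {u v : 𝓑.V} (f : 𝓑.E u v) : Subgroup (𝔸.Ae (𝓑.etype f)) := (𝓑.B u).comap (𝓑.conjα f)

/-- `ω_{[f]}⁻¹(f_ω B_{t(f)} f_ω⁻¹)`. -/
def edgeω {u v : 𝓑.V} (f : 𝓑.E u v) : Subgroup (𝔸.Ae (𝓑.etype f)) := (𝓑.B v).comap (𝓑.conjω f)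

theorem exists_rev {u v : 𝓑.V} (f : 𝓑.E u v) :
    ∃ φ : 𝔸.Ae (𝓑.etype f) ≃* 𝔸.Ae (𝓑.etype (𝓑.inv f)),
      ∀ c, 𝓑.conjα (𝓑.inv f) (φ c) = 𝓑.conjω f c ∧ 𝓑.conjω (𝓑.inv f) (φ c) = 𝓑.conjα f c := by
  have h : ∃ φ : 𝔸.Ae (𝓑.etype f) ≃* 𝔸.Ae (𝓑.etype (𝓑.inv f)),
      ∀ c, 𝔸.α (𝓑.etype (𝓑.inv f)) (φ c) = 𝔸.ω (𝓑.etype f) c ∧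
        𝔸.ω (𝓑.etype (𝓑.inv f)) (φ c) = 𝔸.α (𝓑.etype f) c := by
    rw [𝓑.etype_inv]
    exact 𝔸.rev _
  obtain ⟨φ, hφ⟩ := h
  exact ⟨φ, fun c => by simp [conjα, conjω, hφ, 𝓑.labα_inv, 𝓑.labω_inv]⟩

/-- The graph of groups `𝔹` defined by the `𝔸`-graph `𝓑`: the vertex groups are the `B_u`, the edge
group of `f` is `B_f = α_{[f]}⁻¹(f_α⁻¹ B_{o(f)} f_α) ∩ ω_{[f]}⁻¹(f_ω B_{t(f)} f_ω⁻¹)`, and the boundary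
monomorphisms are `c ↦ f_α α_{[f]}(c) f_α⁻¹` and `c ↦ f_ω⁻¹ ω_{[f]}(c) f_ω`. -/
abbrev gog : GraphOfGroups.{u₅, u₆, u₃, u₄} where
  toSerreGraph := 𝓑.toSerreGraph
  A u := 𝓑.B u
  Ae f := ↥(𝓑.edgeα f ⊓ 𝓑.edgeω f)
  α f := ((𝓑.conjα f).comp (Subgroup.subtype _)).codRestrict (𝓑.B _) fun c => c.2.1
  ω f := ((𝓑.conjω f).comp (Subgroup.subtype _)).codRestrict (𝓑.B _) fun c => c.2.2
  α_injective f := by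
    intro c d h
    have h' : 𝓑.conjα f c = 𝓑.conjα f d := congrArg Subtype.val h
    exact Subtype.ext (𝔸.α_injective _ ((MulAut.conj (𝓑.labα f)).injective h'))
  ω_injective f := by
    intro c d h
    have h' : 𝓑.conjω f c = 𝓑.conjω f d := congrArg Subtype.val h
    exact Subtype.ext (𝔸.ω_injective _ ((MulAut.conj (𝓑.labω f)⁻¹).injective h'))
  rev f := by
    obtain ⟨φ, hφ⟩ := 𝓑.exists_rev f
    have hmap : (𝓑.edgeα f ⊓ 𝓑.edgeω f).map φ.toMonoidHom =
        𝓑.edgeα (𝓑.inv f) ⊓ 𝓑.edgeω (𝓑.inv f) := by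
      ext d
      obtain ⟨c, rfl⟩ := φ.surjective d
      simp [edgeα, edgeω, hφ, and_comm]
    refine ⟨(φ.subgroupMap _).trans (MulEquiv.subgroupCongr hmap), fun c => ⟨?_, ?_⟩⟩
    · exact Subtype.ext (hφ c).1
    · exact Subtype.ext (hφ c).2

/-- The `𝔸`-path `μ(p) = (b₀g₁), e₁, (k₁b₁g₂), e₂, …, e_s, (k_s b_s)` determined by a `𝔹`-path
`p = b₀, f₁, b₁, …, f_s, b_s`, where `f_i` has label `(g_i, e_i, k_i)`. -/
def mu : ∀ {u v : 𝓑.gog.V}, 𝓑.gog.Path u v → 𝔸.Path (𝓑.vtype u) (𝓑.vtype v)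
  | _, _, .nil b => .nil (Subtype.val b)
  | _, _, .cons b f p => .cons (Subtype.val b * 𝓑.labα f) (𝓑.etype f) ((mu p).lmul (𝓑.labω f))

theorem mu_lmul {u v : 𝓑.gog.V} (b : 𝓑.gog.A u) (p : 𝓑.gog.Path u v) :
    𝓑.mu (p.lmul b) = (𝓑.mu p).lmul (Subtype.val b) := by
  cases p with
  | nil a => rfl
  | cons a f p => exact congrArg (fun x => Path.cons x _ _) (mul_assoc _ _ _)

theorem mu_comp {u v w : 𝓑.gog.V} (p : 𝓑.gog.Path u v) (q : 𝓑.gog.Path v w) :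
    𝓑.mu (p.comp q) = (𝓑.mu p).comp (𝓑.mu q) := by
  induction p with
  | nil a => exact 𝓑.mu_lmul a q
  | cons a f p ih => simp only [cons_comp, mu]; rw [ih, lmul_comp]

theorem mu_sim {u v : 𝓑.gog.V} {p q : 𝓑.gog.Path u v} (h : Sim p q) : Sim (𝓑.mu p) (𝓑.mu q) := by
  induction h with
  | @basic u v a f c b =>
    have hc : (Subtype.val (𝓑.gog.ω f c) : 𝔸.A (𝓑.vtype v)) =
      (𝓑.labω f)⁻¹ * 𝔸.ω (𝓑.etype f) c.1 * ((𝓑.labω f)⁻¹)⁻¹ := rfl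
    have hd : (Subtype.val (a * 𝓑.gog.α f c * b) : 𝔸.A (𝓑.vtype u)) =
      Subtype.val a * (𝓑.labα f * 𝔸.α (𝓑.etype f) c.1 * (𝓑.labα f)⁻¹) * Subtype.val b := rfl
    simp only [mu, hc, hd, lmul_nil, lmul_cons, 𝓑.etype_inv, 𝓑.labα_inv, 𝓑.labω_inv]
    convert Sim.basic (Subtype.val a * 𝓑.labα f) (𝓑.etype f) c.1
      ((𝓑.labα f)⁻¹ * Subtype.val b) using 2
    · congr 1
      group
    · group
  | comp _ _ h1 h2 => rw [mu_comp, mu_comp]; exact Sim.comp h1 h2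
  | refl p => exact Sim.refl _
  | symm _ h => exact h.symm
  | trans _ _ h1 h2 => exact h1.trans h2

/-- `𝓑` is folded: (1) there are no two distinct edges `f₁`, `f₂` with the same origin `z` and the same
type `e` such that `(f₂)_α = a' (f₁)_α α_e(c)` for some `a' ∈ B_z` and `c ∈ A_e`, and (2) there is no
edge `f` with `α_e⁻¹(f_α⁻¹ B_{o(f)} f_α) ≠ ω_e⁻¹(f_ω B_{t(f)} f_ω⁻¹)`, where `e = [f]`. -/
def Folded : Prop :=
  (¬ ∃ (z x y : 𝓑.V) (f₁ : 𝓑.E z x) (f₂ : 𝓑.E z y),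
      (⟨x, f₁⟩ : Σ t, 𝓑.E z t) ≠ ⟨y, f₂⟩ ∧
      (⟨𝓑.vtype x, 𝓑.etype f₁⟩ : Σ t, 𝔸.E (𝓑.vtype z) t) = ⟨𝓑.vtype y, 𝓑.etype f₂⟩ ∧
      ∃ a' ∈ 𝓑.B z, ∃ c : 𝔸.Ae (𝓑.etype f₁),
        𝓑.labα f₂ = a' * 𝓑.labα f₁ * 𝔸.α (𝓑.etype f₁) c) ∧
  ¬ ∃ (u v : 𝓑.V) (f : 𝓑.E u v), 𝓑.edgeα f ≠ 𝓑.edgeω f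

variable (u₀ : 𝓑.V) {v₀ : 𝔸.V} (h₀ : 𝓑.vtype u₀ = v₀)

/-- The language `L(𝓑, u₀)`: the `𝔸`-paths `μ(p)`, for `p` a reduced `𝔹`-path from `u₀` to `u₀`. -/
def language : Set (𝔸.Path v₀ v₀) :=
  {q | ∃ p : 𝓑.gog.Path u₀ u₀, p.Reduced ∧ q = (𝓑.mu p).cast h₀ h₀}

/-- The homomorphism `ν : π₁(𝔹, u₀) → π₁(𝔸, v₀)` induced by `μ`. -/
def nu : 𝓑.gog.Pi1 u₀ →* 𝔸.Pi1 v₀ where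
  toFun := Quotient.map (sa := 𝓑.gog.simSetoid u₀ u₀) (sb := 𝔸.simSetoid v₀ v₀)
    (fun p => (𝓑.mu p).cast h₀ h₀) (by
      intro p q h
      subst h₀
      exact 𝓑.mu_sim h)
  map_one' := by subst h₀; rfl
  map_mul' x y := by
    subst h₀
    induction x using Quotient.inductionOn
    induction y using Quotient.inductionOn
    exact congrArg Pi1.mk (𝓑.mu_comp _ _)

/-- The map `φ` between the Bass-Serre trees of `(𝔹, u₀)` and `(𝔸, v₀)`, on vertices:
`p̄ B_u ↦ \overline{μ(p)} A_{[u]}`. -/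
def phiFun (x : 𝓑.gog.TreeVertex u₀) : 𝔸.TreeVertex v₀ :=
  ⟨𝓑.vtype x.1, Quotient.map (sa := 𝓑.gog.cosetSetoid u₀ x.1)
    (sb := 𝔸.cosetSetoid v₀ (𝓑.vtype x.1)) (fun p => (𝓑.mu p).cast h₀ rfl) (by
      rintro p q ⟨a, h⟩
      subst h₀
      refine ⟨Subtype.val a, ?_⟩
      have h' := 𝓑.mu_sim h
      rwa [mu_comp] at h') x.2⟩

/-- The simplicial map `φ` from the Bass-Serre tree of `(𝔹, u₀)` to that of `(𝔸, v₀)`. -/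
def phi : 𝓑.gog.tree u₀ →g 𝔸.tree v₀ where
  toFun := 𝓑.phiFun u₀ h₀
  map_rel' := by
    rintro x y ⟨v, v', p, a, f, rfl, rfl⟩
    subst h₀
    refine ⟨𝓑.vtype v, 𝓑.vtype v', 𝓑.mu p, Subtype.val a * 𝓑.labα f, 𝓑.etype f, rfl, ?_⟩
    refine TreeVertex.mk_eq (𝓑.labω f) ?_
    have h : 𝓑.mu (p.comp (Path.cons a f (Path.nil 1))) =
        ((𝓑.mu p).comp (Path.cons (Subtype.val a * 𝓑.labα f) (𝓑.etype f) (Path.nil 1))).comp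
          (Path.nil (𝓑.labω f)) := by
      rw [mu_comp, comp_assoc]
      simp [mu]
    change Sim (𝓑.mu (p.comp (Path.cons a f (Path.nil 1)))) _
    rw [h]
    exact Sim.refl _

end AGraph

/-! ### Algorithms, words and presentations -/

/-- There is an algorithm (a partial recursive function) that halts on every input `a` with `D a` and
then returns an output `b` with `R a b`. -/
def ExistsAlgorithm {α β : Type} [Primcodable α] [Primcodable β] (D : α → Prop)
    (R : α → β → Prop) : Prop :=
  ∃ f : α →. β, Partrec f ∧ ∀ a, D a → ∃ b ∈ f a, R a b

/-- A word in generators `x₀, x₁, …`; the letter `(i, true)` is `x_i` and `(i, false)` is `x_i⁻¹`. -/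
abbrev Word : Type := List (ℕ × Bool)

/-- The element represented by a word in the list `g` of generators (letters without a
corresponding generator stand for `1`). -/
def wordVal {G : Type*} [Group G] (g : List G) (w : Word) : G :=
  (w.map fun l => if l.2 then g.getD l.1 1 else (g.getD l.1 1)⁻¹).prod

/-- `⟨z | R⟩` is a presentation of the subgroup `H` of `G`: the elements of the list `z` generate `H`, and
the kernel of the map from the free group on the positions of `z` is the normal closure of the
relators in `R`. -/
def IsPresentation {G : Type*} [Group G] (H : Subgroup G) (z : List G) (R : Set Word) : Prop :=
  Subgroup.closure {g | g ∈ z} = H ∧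
  (FreeGroup.lift z.get).ker =
    Subgroup.normalClosure (wordVal (List.ofFn (FreeGroup.of (α := Fin z.length))) '' R)

/-- The code `w₀, e₁, w₁, …, e_k, w_k` of a path: `(w₀, [(e₁, w₁), …, (e_k, w_k)])`, with edges given by
their numbers and group elements by words. -/
abbrev PathCode : Type := Word × List (ℕ × Word)

/-- The code of a vertex of an `𝔸`-graph: the number of its type and a finite list of words
generating its group. -/
abbrev VertexCode : Type := ℕ × List Word

/-- The code of an edge `f` of an `𝔸`-graph: the positions of its origin and of its terminus in the
list of vertices, the position of `f⁻¹` in the list of edges, the number of the type of `f`, and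
words for `f_α` and `f_ω`. -/
structure EdgeCode where
  orig : ℕ
  term : ℕ
  rev : ℕ
  typ : ℕ
  wα : Word
  wω : Word

/-- Edge codes are tuples. -/
def EdgeCode.equiv : EdgeCode ≃ ℕ × ℕ × ℕ × ℕ × Word × Word where
  toFun r := (r.orig, r.term, r.rev, r.typ, r.wα, r.wω)
  invFun r := ⟨r.1, r.2.1, r.2.2.1, r.2.2.2.1, r.2.2.2.2.1, r.2.2.2.2.2⟩
  left_inv _ := rfl
  right_inv _ := rfl

instance : Primcodable EdgeCode := Primcodable.ofEquiv _ EdgeCode.equiv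

/-- The code of a finite `𝔸`-graph with base vertex: the list of vertices, the list of (oriented)
edges, and the position of the base vertex. -/
abbrev GraphCode : Type := List VertexCode × List EdgeCode × ℕ

namespace GraphOfGroups

/-- The finite explicit description of `𝔸` that algorithms refer to: the vertices and edges are
numbered, and the vertex and edge groups are given by recursive presentations on finite lists of
generators. -/
structure Marking (𝔸 : GraphOfGroups.{u₁, u₂, u₃, u₄}) where
  vnum : 𝔸.V ↪ ℕ
  enum : (Σ u v : 𝔸.V, 𝔸.E u v) ↪ ℕ
  vgen : ∀ v : 𝔸.V, List (𝔸.A v)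
  egen : ∀ {u v : 𝔸.V} (e : 𝔸.E u v), List (𝔸.Ae e)
  vpres : ∀ v : 𝔸.V, ∃ R : Set Word, REPred (fun w => w ∈ R) ∧ IsPresentation ⊤ (vgen v) R
  epres : ∀ {u v : 𝔸.V} (e : 𝔸.E u v),
    ∃ R : Set Word, REPred (fun w => w ∈ R) ∧ IsPresentation ⊤ (egen e) R

namespace Marking

variable {𝔸 : GraphOfGroups.{u₁, u₂, u₃, u₄}} (M : 𝔸.Marking)

/-- The element of `A_v` represented by a word. -/
def vval (v : 𝔸.V) (w : Word) : 𝔸.A v := wordVal (M.vgen v) w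

/-- The element of `A_e` represented by a word. -/
def eval {u v : 𝔸.V} (e : 𝔸.E u v) (w : Word) : 𝔸.Ae e := wordVal (M.egen e) w

/-- The subgroup of `A_v` generated by the elements represented by the words in `X`. -/
def vclosure (v : 𝔸.V) (X : List Word) : Subgroup (𝔸.A v) :=
  Subgroup.closure {a | a ∈ X.map (M.vval v)}

/-- The subgroup of `A_e` generated by the elements represented by the words in `X`. -/
def eclosure {u v : 𝔸.V} (e : 𝔸.E u v) (X : List Word) : Subgroup (𝔸.Ae e) :=
  Subgroup.closure {a | a ∈ X.map (M.eval e)}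

/-- `⟨X⟩ ∩ a α_e(A_e)`. -/
def cosetInter {u v : 𝔸.V} (e : 𝔸.E u v) (X : List Word) (a : Word) : Set (𝔸.A u) :=
  {x | x ∈ M.vclosure u X ∧ ∃ c : 𝔸.Ae e, x = M.vval u a * 𝔸.α e c}

/-- A benign graph of groups: a finite connected graph of finitely generated groups (with the given
recursive presentations) satisfying the four conditions `coset`, `noetherian`, `membership` and
`inter`. -/
structure Benign : Prop where
  finite_vertices : Finite 𝔸.V
  finite_edges : Finite (Σ u v : 𝔸.V, 𝔸.E u v)
  connected : ∀ u v : 𝔸.V, Relation.ReflTransGen (fun x y => Nonempty (𝔸.E x y)) u v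
  coset : ∀ {u v : 𝔸.V} (e : 𝔸.E u v),
    ExistsAlgorithm (fun _ : List Word × Word => True) fun Xa (out : Option Word) =>
      match out with
      | none => M.cosetInter e Xa.1 Xa.2 = ∅
      | some w => M.vval u w ∈ M.cosetInter e Xa.1 Xa.2
  noetherian : ∀ {u v : 𝔸.V} (e : 𝔸.E u v) (s : ℕ → Subgroup (𝔸.Ae e)), ¬ StrictMono s
  membership : ∀ {u v : 𝔸.V} (e : 𝔸.E u v),
    ExistsAlgorithm (fun _ : List Word × Word => True) fun Xa (out : Bool) =>
      (out = true ↔ M.eval e Xa.2 ∈ M.eclosure e Xa.1)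
  inter : ∀ {u v : 𝔸.V} (e : 𝔸.E u v),
    ExistsAlgorithm (fun _ : List Word => True) fun X (out : List Word) =>
      M.vclosure u out = (𝔸.α e).range ⊓ M.vclosure u X

/-- `c` is a code of the `𝔸`-path `p`. -/
inductive CodesPath : ∀ {u v : 𝔸.V}, PathCode → 𝔸.Path u v → Prop
  | nil {v : 𝔸.V} (w : Word) : CodesPath (w, []) (Path.nil (M.vval v w))
  | cons {u v x : 𝔸.V} (w : Word) (e : 𝔸.E u v) (w' : Word) (l : List (ℕ × Word))
      (p : 𝔸.Path v x) : CodesPath (w', l) p →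
      CodesPath (w, (M.enum ⟨u, v, e⟩, w') :: l) (Path.cons (M.vval u w) e p)

/-- `c` is the code of a closed `𝔸`-path at `v₀` representing `g ∈ π₁(𝔸, v₀)`. -/
def Represents {v₀ : 𝔸.V} (c : PathCode) (g : 𝔸.Pi1 v₀) : Prop :=
  ∃ p : 𝔸.Path v₀ v₀, M.CodesPath c p ∧ Pi1.mk p = g

/-- `S` is a finite list of codes of elements of `π₁(𝔸, v₀)`. -/
def IsInput (v₀ : 𝔸.V) (S : List PathCode) : Prop :=
  ∀ c ∈ S, ∃ g : 𝔸.Pi1 v₀, M.Represents c g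

/-- The subgroup of `π₁(𝔸, v₀)` generated by the elements with codes in `S`. -/
def generated (v₀ : 𝔸.V) (S : List PathCode) : Subgroup (𝔸.Pi1 v₀) :=
  Subgroup.closure {g | ∃ c ∈ S, M.Represents c g}

/-- `c` is a code of the `𝔸`-graph `𝓑` with base vertex `u₀`: for suitable enumerations of the vertices
and of the oriented edges of `𝓑`, the entries of `c` describe `𝓑`. -/
def CodesGraph (c : GraphCode) (𝓑 : AGraph.{u₁, u₂, u₃, u₄, u₅, u₆} 𝔸) (u₀ : 𝓑.V) : Prop :=
  ∃ (vert : Fin c.1.length ≃ 𝓑.V) (edge : Fin c.2.1.length ≃ (Σ u v : 𝓑.V, 𝓑.E u v)),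
    (∀ i, (c.1.get i).1 = M.vnum (𝓑.vtype (vert i)) ∧
      𝓑.B (vert i) = M.vclosure (𝓑.vtype (vert i)) (c.1.get i).2) ∧
    (∀ j (u v : 𝓑.V) (f : 𝓑.E u v), edge j = ⟨u, v, f⟩ →
      (c.2.1.get j).orig = vert.symm u ∧
      (c.2.1.get j).term = vert.symm v ∧
      (c.2.1.get j).rev = edge.symm ⟨v, u, 𝓑.inv f⟩ ∧
      (c.2.1.get j).typ = M.enum ⟨𝓑.vtype u, 𝓑.vtype v, 𝓑.etype f⟩ ∧
      M.vval (𝓑.vtype u) (c.2.1.get j).wα = 𝓑.labα f ∧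
      M.vval (𝓑.vtype v) (c.2.1.get j).wω = 𝓑.labω f) ∧
    c.2.2 = vert.symm u₀

end Marking

end GraphOfGroups

/-!
Both algorithms are unbounded searches. Since an algorithm may try all candidate outputs in parallel,
it suffices to find a recursively enumerable predicate `P S c` such that every `c` with `P S c` is a
correct output for `S` and such that every input has at least one `c` (`IsRE.existsAlgorithm`); no
folding procedure and no proof of its termination is needed. The proof splits into the geometry,
which gives correctness and existence, and the enumeration of the certificates.

*Geometry.* A reduced path that is equivalent to a path without edges has no edges; this is the
normal form theorem, proved by letting paths act on reduced paths (`Path.Red.eq_nil_of_sim`). Folded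
`𝔸`-graphs send reduced paths to reduced paths (`AGraph.Folded.red_mu`), so `ν` and `φ` are injective
(`AGraph.Folded.nu_injective`, `AGraph.Folded.phi_injective`). The image of `φ` is the subtree
spanned by the orbit of the base vertex as soon as every edge of the `𝔸`-graph can be continued to a
reduced path to its base vertex (`AGraph.Folded.map_phi_eq_hull`).

*Existence.* The quotient of the Bass–Serre tree by `U`, with stabilizers as vertex groups, is a
folded `𝔸`-graph, usually infinite (`Rep.cover`). The finitely many closed paths that represent the
given generators pass through a finite part of it. Because the edge groups satisfy the ascending
chain condition, its edge groups are finitely generated, and the elements occurring in the chosen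
paths together with these edge groups generate finitely generated vertex groups for which this finite
part is still folded (`AGraph.exists_finite_restrict`, `Rep.exists_finite_folded`).

*Enumeration.* The vertex groups and the edges generate a recursively presented group `Marking.Amb`,
in which paths with the same endpoints have the same value only if they are equivalent
(`Marking.rep_val_eq_iff`). Equality and membership in finitely generated subgroups are recursively
enumerable there. The two negative conditions, that no two edges can be folded together and that a
path does not backtrack, say that certain cosets do not meet certain subgroups, and the first
condition on benign graphs of groups decides this (`Marking.EmptyCoset`). Equality of the two edge
groups of an edge is verified on generators found by the intersection algorithm (`Marking.Fold2`).
That the language lies in `U` is certified by conjugating elements for the vertices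
(`Marking.LangLe`), and that it covers `U` by spelling the given generators (`Marking.LangGe`).

*Presentations.* By the injectivity of `ν` the group `U` is the fundamental group of `𝔹`, hence
generated by its vertex groups and edges subject to the relations of the vertex groups and of the
path groupoid. A certificate for `⟨z | R⟩` spells these generators in terms of `z` so that the
relations follow from `R`; this yields a homomorphism from `U` to the presented group that is inverse
to the evident one (`Marking.Certifies.isPresentation`).
-/


/-! ### Recursively enumerable predicates -/

/-- A predicate is recursively enumerable if it is the projection of a primitive recursive one. -/
def IsRE {α : Type*} [Primcodable α] (p : α → Prop) : Prop :=
  ∃ g : α → ℕ → Bool, Primrec₂ g ∧ ∀ a, p a ↔ ∃ n, g a n = true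

namespace IsRE

variable {α β γ : Type*} [Primcodable α] [Primcodable β] [Primcodable γ]

theorem of_iff {p q : α → Prop} (hp : IsRE p) (h : ∀ a, q a ↔ p a) : IsRE q := by
  obtain ⟨g, hg, hgp⟩ := hp
  exact ⟨g, hg, fun a => (h a).trans (hgp a)⟩

theorem of_primrecPred {p : α → Prop} (hp : PrimrecPred p) : IsRE p := by
  obtain ⟨_, hp⟩ := hp
  exact ⟨fun a _ => decide (p a), hp.comp Primrec.fst, fun a => by simp⟩

theorem eq {f g : α → β} (hf : Primrec f) (hg : Primrec g) : IsRE fun a => f a = g a := by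
  classical
  exact of_primrecPred (Primrec.eq.comp hf hg)

theorem ne {f g : α → β} (hf : Primrec f) (hg : Primrec g) : IsRE fun a => f a ≠ g a := by
  classical
  exact of_primrecPred (Primrec.eq.comp hf hg).not

theorem lt {f g : α → ℕ} (hf : Primrec f) (hg : Primrec g) : IsRE fun a => f a < g a :=
  of_primrecPred (Primrec.nat_lt.comp hf hg)

theorem const (p : Prop) : IsRE fun _ : α => p := by
  classical
  exact ⟨fun _ _ => decide p, Primrec.const _, fun a => by simp⟩

theorem comp {p : β → Prop} (hp : IsRE p) {f : α → β} (hf : Primrec f) : IsRE fun a => p (f a) := by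
  obtain ⟨g, hg, hgp⟩ := hp
  exact ⟨fun a n => g (f a) n, hg.comp (hf.comp Primrec.fst) Primrec.snd, fun a => hgp _⟩

theorem and {p q : α → Prop} (hp : IsRE p) (hq : IsRE q) : IsRE fun a => p a ∧ q a := by
  obtain ⟨g, hg, hgp⟩ := hp
  obtain ⟨k, hk, hkq⟩ := hq
  refine ⟨fun a n => g a n.unpair.1 && k a n.unpair.2,
    Primrec.and.comp
      (hg.comp Primrec.fst (Primrec.fst.comp (Primrec.unpair.comp Primrec.snd)))
      (hk.comp Primrec.fst (Primrec.snd.comp (Primrec.unpair.comp Primrec.snd))), fun a => ?_⟩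
  show p a ∧ q a ↔ _
  rw [hgp, hkq]
  constructor
  · rintro ⟨⟨m, hm⟩, n, hn⟩
    exact ⟨Nat.pair m n, by simp [hm, hn]⟩
  · rintro ⟨n, hn⟩
    rw [Bool.and_eq_true] at hn
    exact ⟨⟨_, hn.1⟩, _, hn.2⟩

theorem or {p q : α → Prop} (hp : IsRE p) (hq : IsRE q) : IsRE fun a => p a ∨ q a := by
  obtain ⟨g, hg, hgp⟩ := hp
  obtain ⟨k, hk, hkq⟩ := hq
  refine ⟨fun a n => g a n || k a n, Primrec.or.comp hg hk, fun a => ?_⟩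
  show p a ∨ q a ↔ _
  rw [hgp, hkq]
  simp [exists_or]

theorem ex {p : α → β → Prop} (hp : IsRE fun x : α × β => p x.1 x.2) :
    IsRE fun a => ∃ b, p a b := by
  obtain ⟨g, hg, hgp⟩ := hp
  refine ⟨fun a n => ((Encodable.decode (α := β) n.unpair.1).map
    fun b => g (a, b) n.unpair.2).getD false, ?_, fun a => ?_⟩
  · refine Primrec.option_getD.comp (Primrec.option_map (Primrec.decode.comp
      (Primrec.fst.comp (Primrec.unpair.comp Primrec.snd))) ?_) (Primrec.const _)
    exact hg.comp (Primrec.pair (Primrec.fst.comp Primrec.fst) Primrec.snd)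
      (Primrec.snd.comp (Primrec.unpair.comp (Primrec.snd.comp Primrec.fst)))
  · constructor
    · rintro ⟨b, hb⟩
      obtain ⟨n, hn⟩ := (hgp (a, b)).1 hb
      exact ⟨Nat.pair (Encodable.encode b) n, by simp [hn]⟩
    · rintro ⟨n, hn⟩
      cases hd : Encodable.decode (α := β) n.unpair.1 with
      | none => simp [hd] at hn
      | some b => exact ⟨b, (hgp (a, b)).2 ⟨_, by simpa [hd] using hn⟩⟩

theorem forall_mem {p : α → β → Prop} {l : α → List β} (hl : Primrec l)
    (hp : IsRE fun x : α × β => p x.1 x.2) : IsRE fun a => ∀ b ∈ l a, p a b := by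
  classical
  obtain ⟨g, hg, hgp⟩ := hp
  have h1 : PrimrecRel fun (n : ℕ) (x : α × β) => g x n = true :=
    Primrec.eq.comp (hg.comp Primrec.snd Primrec.fst) (Primrec.const true)
  have h2 : PrimrecRel fun (b : β) (x : α × ℕ) => ∃ n ∈ List.range x.2, g (x.1, b) n = true :=
    h1.exists_mem_list.comp (Primrec.list_range.comp (Primrec.snd.comp Primrec.snd))
      (Primrec.pair (Primrec.fst.comp Primrec.snd) Primrec.fst)
  have h3 : PrimrecPred fun x : α × ℕ => ∀ b ∈ l x.1, ∃ n ∈ List.range x.2, g (x.1, b) n = true :=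
    h2.forall_mem_list.comp (hl.comp Primrec.fst) Primrec.id
  obtain ⟨d, h3⟩ := h3
  refine ⟨fun a N => decide (∀ b ∈ l a, ∃ n ∈ List.range N, g (a, b) n = true), h3.of_eq fun _ => by simp,
    fun a => ?_⟩
  simp only [decide_eq_true_eq, List.mem_range]
  constructor
  · intro h
    have h' : ∀ b ∈ l a, ∃ n, g (a, b) n = true := fun b hb => (hgp (a, b)).1 (h b hb)
    generalize l a = L at h'
    induction L with
    | nil => exact ⟨0, by simp⟩
    | cons b L ih =>
      obtain ⟨N, hN⟩ := ih fun b hb => h' b (List.mem_cons_of_mem _ hb)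
      obtain ⟨n, hn⟩ := h' b List.mem_cons_self
      refine ⟨max N (n + 1), fun b' hb' => ?_⟩
      rcases List.mem_cons.1 hb' with rfl | hb'
      · exact ⟨n, by omega, hn⟩
      · obtain ⟨k, hk, hk'⟩ := hN b' hb'
        exact ⟨k, by omega, hk'⟩
  · rintro ⟨N, hN⟩ b hb
    obtain ⟨n, -, hn⟩ := hN b hb
    exact (hgp (a, b)).2 ⟨n, hn⟩

theorem forall_lt {p : α → ℕ → Prop} {l : α → ℕ} (hl : Primrec l)
    (hp : IsRE fun x : α × ℕ => p x.1 x.2) : IsRE fun a => ∀ i < l a, p a i :=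
  (forall_mem (Primrec.list_range.comp hl) hp).of_iff fun a => by simp

theorem mem {f : α → β} {l : α → List β} (hf : Primrec f) (hl : Primrec l) :
    IsRE fun a => f a ∈ l a := by
  classical
  have h : PrimrecRel fun (L : List β) (b : β) => ∃ a ∈ L, a = b :=
    (Primrec.eq (α := β)).exists_mem_list
  exact (of_primrecPred (h.comp hl hf)).of_iff fun a => by simp

theorem exists_finite {ι : Type*} [Finite ι] {p : ι → α → Prop} (hp : ∀ i, IsRE (p i)) :
    IsRE fun a => ∃ i, p i a := by
  classical
  cases nonempty_fintype ι
  have h : ∀ s : Finset ι, IsRE fun a => ∃ i ∈ s, p i a := by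
    intro s
    induction s using Finset.induction_on with
    | empty => exact (const False).of_iff fun a => by simp
    | insert i s _ ih => exact ((hp i).or ih).of_iff fun a => by simp
  exact (h Finset.univ).of_iff fun a => by simp

/-- The reflexive transitive closure of a recursively enumerable relation is recursively
enumerable: one searches for a chain. -/
theorem reflTransGen {r : γ → β → β → Prop}
    (hr : IsRE fun x : γ × β × β => r x.1 x.2.1 x.2.2) :
    IsRE fun x : γ × β × β => Relation.ReflTransGen (r x.1) x.2.1 x.2.2 := by
  have key : ∀ (r : β → β → Prop) (a b : β), Relation.ReflTransGen r a b ↔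
      ∃ l : List β, l.getD 0 b = a ∧
        ∀ i < l.length, r (l.getD i b) (l.getD (i + 1) b) := by
    intro r a b
    constructor
    · intro h
      induction h using Relation.ReflTransGen.head_induction_on with
      | refl => exact ⟨[], by simp⟩
      | @head a c hac _ ih =>
        obtain ⟨l, rfl, hl⟩ := ih
        refine ⟨a :: l, rfl, fun i hi => ?_⟩
        cases i with
        | zero => simpa using hac
        | succ i => simpa using hl i (by simpa using hi)
    · rintro ⟨l, rfl, hl⟩
      induction l with
      | nil => exact Relation.ReflTransGen.refl
      | cons c l ih =>
        refine Relation.ReflTransGen.head (b := l.getD 0 b) ?_ (ih fun i hi => ?_)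
        · simpa using hl 0 (by simp)
        · simpa using hl (i + 1) (by simpa using hi)
  have hget : Primrec fun x : ((((γ × β × β) × List β) × ℕ) × ℕ) =>
      x.1.1.2.getD x.2 x.1.1.1.2.2 := by
    refine (Primrec.option_getD.comp (Primrec.list_getElem?.comp
      (Primrec.snd.comp (Primrec.fst.comp Primrec.fst)) Primrec.snd)
      (Primrec.snd.comp (Primrec.snd.comp (Primrec.fst.comp (Primrec.fst.comp Primrec.fst))))
      ).of_eq fun x => ?_
    exact (List.getD_eq_getElem?_getD ..).symm
  refine (ex (p := fun (x : γ × β × β) (l : List β) => l.getD 0 x.2.2 = x.2.1 ∧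
    ∀ i < l.length, r x.1 (l.getD i x.2.2) (l.getD (i + 1) x.2.2)) ?_).of_iff
    fun x => key _ _ _
  refine (eq ?_ (Primrec.fst.comp (Primrec.snd.comp Primrec.fst))).and
    (forall_lt (Primrec.list_length.comp Primrec.snd) (hr.comp (f := fun x :
      ((γ × β × β) × List β) × ℕ => (x.1.1.1, x.1.2.getD x.2 x.1.1.2.2,
        x.1.2.getD (x.2 + 1) x.1.1.2.2)) ?_))
  · exact hget.comp (Primrec.pair (Primrec.pair Primrec.id (Primrec.const 0)) (Primrec.const 0))
  · exact Primrec.pair (Primrec.fst.comp (Primrec.fst.comp Primrec.fst)) (Primrec.pair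
      (hget.comp (Primrec.pair Primrec.id Primrec.snd))
      (hget.comp (Primrec.pair Primrec.id (Primrec.succ.comp Primrec.snd))))

/-- The graph of a partial recursive function is recursively enumerable. -/
theorem graph {f : α →. β} (hf : Partrec f) : IsRE fun x : α × β => x.2 ∈ f x.1 := by
  classical
  obtain ⟨c, hc⟩ := Nat.Partrec.Code.exists_code.1 hf
  have h : PrimrecRel fun (x : α × β) (k : ℕ) =>
      c.evaln k (Encodable.encode x.1) = some (Encodable.encode x.2) :=
    Primrec.eq.comp (Nat.Partrec.Code.primrec_evaln.comp (Primrec.pair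
      (Primrec.pair Primrec.snd (Primrec.const c))
      (Primrec.encode.comp (Primrec.fst.comp Primrec.fst))))
      (Primrec.option_some.comp (Primrec.encode.comp (Primrec.snd.comp Primrec.fst)))
  refine ⟨fun x k => decide (c.evaln k (Encodable.encode x.1) = some (Encodable.encode x.2)),
    h.decide, fun x => ?_⟩
  simp only [decide_eq_true_eq]
  have h1 : (∃ k, c.evaln k (Encodable.encode x.1) = some (Encodable.encode x.2)) ↔
      Encodable.encode x.2 ∈ c.eval (Encodable.encode x.1) :=
    Nat.Partrec.Code.evaln_complete.symm
  rw [h1, hc]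
  simp

theorem of_rePred {p : α → Prop} (hp : REPred p) : IsRE p :=
  ((graph hp).comp (f := fun a => (a, ())) (Primrec.pair Primrec.id (Primrec.const _))).of_iff
    fun a => by simp [Part.mem_assert_iff]

/-- Search: if `P` is recursively enumerable and every admissible input `a` has some `b` with
`P a b`, then such a `b` can be found by an algorithm. -/
theorem existsAlgorithm {α β : Type} [Primcodable α] [Primcodable β] {P : α → β → Prop}
    (hP : IsRE fun x : α × β => P x.1 x.2) {D : α → Prop} {R : α → β → Prop}
    (hex : ∀ a, D a → ∃ b, P a b) (hR : ∀ a b, D a → P a b → R a b) : ExistsAlgorithm D R := by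
  obtain ⟨g, hg, hgp⟩ := hP
  let F : α → ℕ → Option β := fun a n => (Encodable.decode (α := β) n.unpair.1).bind
    fun b => bif g (a, b) n.unpair.2 then some b else none
  have hF : Primrec₂ F := by
    refine Primrec.option_bind (Primrec.decode.comp
      (Primrec.fst.comp (Primrec.unpair.comp Primrec.snd))) ?_
    exact Primrec.cond (hg.comp (Primrec.pair (Primrec.fst.comp Primrec.fst) Primrec.snd)
      (Primrec.snd.comp (Primrec.unpair.comp (Primrec.snd.comp Primrec.fst))))
      (Primrec.option_some.comp Primrec.snd) (Primrec.const _)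
  refine ⟨_, Partrec.rfindOpt hF.to_comp, fun a ha => ?_⟩
  have hdom : (Nat.rfindOpt (F a)).Dom := by
    rw [Nat.rfindOpt_dom]
    obtain ⟨b, hb⟩ := hex a ha
    obtain ⟨n, hn⟩ := (hgp (a, b)).1 hb
    exact ⟨Nat.pair (Encodable.encode b) n, b, by simp [F, hn]⟩
  refine ⟨_, Part.get_mem hdom, hR a _ ha ?_⟩
  obtain ⟨n, hn⟩ := Nat.rfindOpt_spec (Part.get_mem hdom)
  obtain ⟨b, -, hb⟩ := Option.bind_eq_some_iff.1 hn
  cases h : g (a, b) n.unpair.2 with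
  | false => simp [h] at hb
  | true =>
    simp only [h, cond_true, Option.some.injEq] at hb
    rw [← hb]
    exact (hgp (a, b)).2 ⟨_, h⟩

/-- An algorithm without precondition on its inputs, as a recursively enumerable relation. -/
theorem of_existsAlgorithm {α β : Type} [Primcodable α] [Primcodable β] {R : α → β → Prop}
    (h : ExistsAlgorithm (fun _ => True) R) :
    ∃ P : α → β → Prop, (IsRE fun x : α × β => P x.1 x.2) ∧ (∀ a b, P a b → R a b) ∧
      ∀ a, ∃ b, P a b := by
  obtain ⟨f, hf, h⟩ := h
  refine ⟨fun a b => b ∈ f a, graph hf, fun a b hb => ?_, fun a => ?_⟩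
  · obtain ⟨b', hb', hR⟩ := h a trivial
    rwa [Part.mem_unique hb hb']
  · obtain ⟨b', hb', -⟩ := h a trivial
    exact ⟨b', hb'⟩

end IsRE

/-! ### Words and recursively presented groups -/

section Words

variable {G H : Type*} [Group G] [Group H]

/-- The value of a word when the letter `x_i` stands for `val i`. -/
def evalWord (val : ℕ → G) (w : Word) : G :=
  (w.map fun l => if l.2 then val l.1 else (val l.1)⁻¹).prod

theorem wordVal_eq_evalWord (g : List G) (w : Word) :
    wordVal g w = evalWord (fun i => g.getD i 1) w := rfl

@[simp] theorem evalWord_nil (val : ℕ → G) : evalWord val [] = 1 := rfl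

@[simp] theorem evalWord_cons (val : ℕ → G) (l : ℕ × Bool) (w : Word) :
    evalWord val (l :: w) = (if l.2 then val l.1 else (val l.1)⁻¹) * evalWord val w := by
  simp [evalWord]

@[simp] theorem evalWord_append (val : ℕ → G) (w w' : Word) :
    evalWord val (w ++ w') = evalWord val w * evalWord val w' := by
  simp [evalWord]

@[simp] theorem evalWord_invRev (val : ℕ → G) (w : Word) :
    evalWord val (FreeGroup.invRev w) = (evalWord val w)⁻¹ := by
  induction w with
  | nil => simp [FreeGroup.invRev]
  | cons l w ih =>
    rw [FreeGroup.invRev_cons, evalWord_append, ih, evalWord_cons, mul_inv_rev]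
    rcases l with ⟨i, b⟩
    cases b <;> simp [FreeGroup.invRev]

theorem map_evalWord (f : G →* H) (val : ℕ → G) (w : Word) :
    f (evalWord val w) = evalWord (fun i => f (val i)) w := by
  induction w with
  | nil => simp
  | cons l w ih => cases h : l.2 <;> simp [h, ih]

theorem evalWord_congr {val val' : ℕ → G} (h : ∀ i, val i = val' i) (w : Word) :
    evalWord val w = evalWord val' w := by
  rw [funext h]

theorem evalWord_mem {K : Subgroup G} {val : ℕ → G} (h : ∀ i, val i ∈ K) (w : Word) :
    evalWord val w ∈ K := by
  induction w with
  | nil => exact K.one_mem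
  | cons l w ih =>
    rw [evalWord_cons]
    refine K.mul_mem ?_ ih
    split_ifs
    exacts [h _, K.inv_mem (h _)]

theorem evalWord_of (w : Word) : evalWord FreeGroup.of w = FreeGroup.mk w := by
  induction w with
  | nil => rfl
  | cons l w ih =>
    rw [evalWord_cons, ih]
    rcases l with ⟨i, b⟩
    cases b <;> rfl

theorem evalWord_map_letter (f : ℕ → ℕ) (val : ℕ → G) (w : Word) :
    evalWord val (w.map fun l => (f l.1, l.2)) = evalWord (fun i => val (f i)) w := by
  simp [evalWord, Function.comp_def]

/-- Substitution of the words in `L` for the letters of a word. -/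
def substWord (L : List Word) (w : Word) : Word :=
  w.flatMap fun l => if l.2 then L.getD l.1 [] else FreeGroup.invRev (L.getD l.1 [])

theorem evalWord_substWord (val : ℕ → G) (L : List Word) (w : Word) :
    evalWord val (substWord L w) = wordVal (L.map (evalWord val)) w := by
  rw [wordVal_eq_evalWord]
  induction w with
  | nil => rfl
  | cons l w ih =>
    have h : ∀ i, (L.map (evalWord val)).getD i 1 = evalWord val (L.getD i []) := by
      intro i
      rw [← evalWord_nil val, List.getD_map]
    rw [evalWord_cons, ← ih, substWord, List.flatMap_cons, evalWord_append, h]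
    congr 1
    split_ifs <;> simp

theorem getD_mem_closure (g : List G) (i : ℕ) : g.getD i 1 ∈ Subgroup.closure {x | x ∈ g} := by
  rw [List.getD_eq_getElem?_getD]
  cases h : g[i]? with
  | none => exact Subgroup.one_mem _
  | some x => exact Subgroup.subset_closure (List.mem_of_getElem? h)

theorem mem_closure_iff_wordVal (g : List G) (x : G) :
    x ∈ Subgroup.closure {y | y ∈ g} ↔ ∃ w : Word, wordVal g w = x := by
  constructor
  · intro h
    induction h using Subgroup.closure_induction with
    | mem y hy =>
      obtain ⟨i, hi, rfl⟩ := List.mem_iff_getElem.1 hy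
      exact ⟨[(i, true)], by simp [wordVal_eq_evalWord, hi]⟩
    | one => exact ⟨[], rfl⟩
    | mul x y _ _ hx hy =>
      obtain ⟨w, rfl⟩ := hx
      obtain ⟨w', rfl⟩ := hy
      exact ⟨w ++ w', evalWord_append (fun i => g.getD i 1) _ _⟩
    | inv x _ hx =>
      obtain ⟨w, rfl⟩ := hx
      exact ⟨FreeGroup.invRev w, evalWord_invRev (fun i => g.getD i 1) _⟩
  · rintro ⟨w, rfl⟩
    exact evalWord_mem (getD_mem_closure g) w

/-- The normal closure in the free group on `x₀, x₁, …` of a set of words. -/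
def relSubgroup (R : Set Word) : Subgroup (FreeGroup ℕ) :=
  Subgroup.normalClosure (FreeGroup.mk '' R)

instance (R : Set Word) : (relSubgroup R).Normal := Subgroup.normalClosure_normal

/-- The group `⟨x₀, x₁, … | R⟩`. -/
abbrev WordGroup (R : Set Word) : Type := FreeGroup ℕ ⧸ relSubgroup R

/-- The element of `⟨x₀, x₁, … | R⟩` represented by a word. -/
def WordGroup.val (R : Set Word) (w : Word) : WordGroup R :=
  evalWord (fun i => (FreeGroup.of i : WordGroup R)) w

theorem WordGroup.val_eq_mk (R : Set Word) (w : Word) :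
    WordGroup.val R w = (FreeGroup.mk w : FreeGroup ℕ) := by
  rw [← evalWord_of]
  exact (map_evalWord (QuotientGroup.mk' (relSubgroup R)) _ w).symm

theorem WordGroup.val_eq_one_iff (R : Set Word) (w : Word) :
    WordGroup.val R w = 1 ↔ FreeGroup.mk w ∈ relSubgroup R := by
  rw [WordGroup.val_eq_mk, QuotientGroup.eq_one_iff]

theorem WordGroup.val_of_mem {R : Set Word} {w : Word} (h : w ∈ R) : WordGroup.val R w = 1 :=
  (WordGroup.val_eq_one_iff R w).2 (Subgroup.subset_normalClosure ⟨w, h, rfl⟩)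

theorem WordGroup.val_surjective (R : Set Word) (x : WordGroup R) :
    ∃ w, WordGroup.val R w = x := by
  obtain ⟨y, rfl⟩ := QuotientGroup.mk_surjective x
  exact ⟨y.toWord, by rw [WordGroup.val_eq_mk, FreeGroup.mk_toWord]⟩

/-- The homomorphism from `⟨x₀, x₁, … | R⟩` determined by an assignment that kills the relators. -/
def WordGroup.lift {R : Set Word} (val : ℕ → G) (h : ∀ r ∈ R, evalWord val r = 1) :
    WordGroup R →* G :=
  QuotientGroup.lift (relSubgroup R) (FreeGroup.lift val) (by
    have h1 : relSubgroup R ≤ (FreeGroup.lift val).ker := by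
      refine Subgroup.normalClosure_le_normal ?_
      rintro _ ⟨r, hr, rfl⟩
      change FreeGroup.lift val (FreeGroup.mk r) = 1
      rw [← evalWord_of, map_evalWord]
      simpa using h r hr
    exact h1)

@[simp] theorem WordGroup.lift_val {R : Set Word} (val : ℕ → G)
    (h : ∀ r ∈ R, evalWord val r = 1) (w : Word) :
    WordGroup.lift val h (WordGroup.val R w) = evalWord val w := by
  rw [WordGroup.val, map_evalWord]
  exact evalWord_congr (fun i => FreeGroup.lift_apply_of) w

theorem lift_get_mem {K : Subgroup G} {z : List G} (hK : Subgroup.closure {g | g ∈ z} = K)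
    (x : FreeGroup (Fin z.length)) : FreeGroup.lift z.get x ∈ K := by
  have h : (FreeGroup.lift z.get).range ≤ K := by
    rw [FreeGroup.range_lift_eq_closure, ← hK]
    refine Subgroup.closure_mono ?_
    rintro _ ⟨i, rfl⟩
    exact List.get_mem _ _
  exact h ⟨x, rfl⟩

/-- Von Dyck's theorem for `IsPresentation`. -/
theorem IsPresentation.exists_hom {K : Subgroup G} {z : List G} {R : Set Word}
    (hp : IsPresentation K z R) (γ : ℕ → H) (hγ : ∀ i, z.length ≤ i → γ i = 1)
    (hR : ∀ r ∈ R, evalWord γ r = 1) :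
    ∃ h : K →* H, ∀ (w : Word) (hw : wordVal z w ∈ K), h ⟨wordVal z w, hw⟩ = evalWord γ w := by
  obtain ⟨hK, hker⟩ := hp
  have hz : ∀ x : FreeGroup (Fin z.length), FreeGroup.lift z.get x ∈ K := lift_get_mem hK
  let p : FreeGroup (Fin z.length) →* K := (FreeGroup.lift z.get).codRestrict K hz
  have hofn : ∀ w : Word,
      FreeGroup.lift z.get (wordVal (List.ofFn (FreeGroup.of (α := Fin z.length))) w) =
        wordVal z w := by
    intro w
    rw [wordVal_eq_evalWord, map_evalWord, wordVal_eq_evalWord]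
    refine evalWord_congr (fun i => ?_) w
    by_cases hi : i < z.length
    · simp [List.getD_eq_getElem?_getD, hi]
    · simp [List.getD_eq_getElem?_getD, hi]
  have hofn' : ∀ w : Word, FreeGroup.lift (fun i : Fin z.length => γ i)
      (wordVal (List.ofFn (FreeGroup.of (α := Fin z.length))) w) = evalWord γ w := by
    intro w
    rw [wordVal_eq_evalWord, map_evalWord]
    refine evalWord_congr (fun i => ?_) w
    by_cases hi : i < z.length
    · simp [List.getD_eq_getElem?_getD, hi]
    · simp [List.getD_eq_getElem?_getD, hi, hγ i (not_lt.1 hi)]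
  have hp : Function.Surjective p := by
    rintro ⟨x, hx⟩
    rw [← hK, mem_closure_iff_wordVal] at hx
    obtain ⟨w, rfl⟩ := hx
    exact ⟨_, Subtype.ext (hofn w)⟩
  have hkp : p.ker ≤ (FreeGroup.lift (fun i : Fin z.length => γ i)).ker := by
    intro x hx
    have hx' : x ∈ (FreeGroup.lift z.get).ker := congrArg Subtype.val hx
    rw [hker] at hx'
    revert x
    suffices h : Subgroup.normalClosure (wordVal (List.ofFn (FreeGroup.of)) '' R) ≤
        (FreeGroup.lift (fun i : Fin z.length => γ i)).ker from fun x _ hx => h hx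
    refine Subgroup.normalClosure_le_normal ?_
    rintro _ ⟨r, hr, rfl⟩
    exact (hofn' r).trans (hR r hr)
  refine ⟨p.liftOfSurjective hp ⟨_, hkp⟩, fun w hw => ?_⟩
  have h1 : (⟨wordVal z w, hw⟩ : K) =
      p (wordVal (List.ofFn (FreeGroup.of (α := Fin z.length))) w) := Subtype.ext (hofn w).symm
  rw [h1, MonoidHom.liftOfRightInverse_comp_apply]
  exact hofn' w

/-- A criterion for presentations: the relators hold, and there is a homomorphism back to the
abstractly presented group. -/
theorem IsPresentation.of_hom {K : Subgroup G} {z : List G} {R : Set Word}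
    (hK : Subgroup.closure {g | g ∈ z} = K) (hR : ∀ r ∈ R, wordVal z r = 1)
    (h : K →* WordGroup R)
    (hh : ∀ (i : ℕ) (hi : i < z.length) (hz : z[i] ∈ K),
      h ⟨z[i], hz⟩ = WordGroup.val R [(i, true)]) :
    IsPresentation K z R := by
  refine ⟨hK, le_antisymm ?_ ?_⟩
  · intro x hx
    let θ : FreeGroup (Fin z.length) →* FreeGroup ℕ := FreeGroup.map Fin.val
    let κ : FreeGroup ℕ →* FreeGroup (Fin z.length) :=
      FreeGroup.lift fun i => (List.ofFn (FreeGroup.of (α := Fin z.length))).getD i 1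
    have hκθ : κ (θ x) = x := by
      have : (κ.comp θ) = MonoidHom.id _ := by
        ext i
        simp [κ, θ, List.getD_eq_getElem?_getD]
      exact DFunLike.congr_fun this x
    have hκ : relSubgroup R ≤ (Subgroup.normalClosure
        (wordVal (List.ofFn (FreeGroup.of (α := Fin z.length))) '' R)).comap κ := by
      refine Subgroup.normalClosure_le_normal ?_
      rintro _ ⟨r, hr, rfl⟩
      refine Subgroup.subset_normalClosure ⟨r, hr, ?_⟩
      rw [← evalWord_of, map_evalWord, wordVal_eq_evalWord]
      exact evalWord_congr (fun i => by simp [κ]) r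
    rw [← hκθ]
    refine hκ ?_
    have hz : ∀ x : FreeGroup (Fin z.length), FreeGroup.lift z.get x ∈ K := lift_get_mem hK
    have hcomp : h.comp ((FreeGroup.lift z.get).codRestrict K hz) =
        (QuotientGroup.mk' (relSubgroup R)).comp θ := by
      ext i
      have hmem := hz (FreeGroup.of i)
      rw [FreeGroup.lift_apply_of] at hmem
      have h1 : (FreeGroup.lift z.get).codRestrict K hz (FreeGroup.of i) =
          ⟨z[i.1], hmem⟩ := Subtype.ext (by simp)
      rw [MonoidHom.comp_apply, h1, hh i.1 i.2, WordGroup.val_eq_mk]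
      rfl
    have h2 := DFunLike.congr_fun hcomp x
    have h3 : (FreeGroup.lift z.get).codRestrict K hz x = 1 := Subtype.ext hx
    rw [MonoidHom.comp_apply, h3, map_one] at h2
    exact (QuotientGroup.eq_one_iff _).1 h2.symm
  · refine Subgroup.normalClosure_le_normal ?_
    rintro _ ⟨r, hr, rfl⟩
    change FreeGroup.lift z.get _ = 1
    rw [wordVal_eq_evalWord, map_evalWord, ← hR r hr, wordVal_eq_evalWord]
    refine evalWord_congr (fun i => ?_) r
    by_cases hi : i < z.length
    · simp [List.getD_eq_getElem?_getD, hi]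
    · simp [List.getD_eq_getElem?_getD, hi]

end Words

/-! ### Computability of word operations -/

theorem primrec_invRev : Primrec (FreeGroup.invRev : Word → Word) := by
  refine Primrec.list_reverse.comp (Primrec.list_map Primrec.id ?_)
  exact Primrec.pair (Primrec.fst.comp Primrec.snd)
    (Primrec.not.comp (Primrec.snd.comp Primrec.snd))

theorem primrec_substWord : Primrec₂ substWord := by
  have h : Primrec fun x : (List Word × Word) × (ℕ × Bool) => x.1.1.getD x.2.1 [] :=
    (Primrec.list_getD []).comp (Primrec.fst.comp Primrec.fst) (Primrec.fst.comp Primrec.snd)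
  refine (Primrec.list_flatMap Primrec.snd (Primrec.to₂ (Primrec.cond
    (Primrec.snd.comp Primrec.snd) h (primrec_invRev.comp h)))).of_eq fun x => ?_
  unfold substWord
  congr 1
  funext l
  cases l.2 <;> rfl

theorem primrec_reduce : Primrec (FreeGroup.reduce : Word → Word) := by
  let f : (ℕ × Bool) → Word → Word := fun x acc =>
    List.casesOn acc [x] fun y ys => bif (x.1 == y.1 && x.2 == !y.2) then ys else x :: y :: ys
  have hf : Primrec₂ f := by
    have hx : Primrec fun p : (((ℕ × Bool) × Word) × ((ℕ × Bool) × Word)) => p.1.1 :=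
      Primrec.fst.comp Primrec.fst
    have hy : Primrec fun p : (((ℕ × Bool) × Word) × ((ℕ × Bool) × Word)) => p.2.1 :=
      Primrec.fst.comp Primrec.snd
    have hys : Primrec fun p : (((ℕ × Bool) × Word) × ((ℕ × Bool) × Word)) => p.2.2 :=
      Primrec.snd.comp Primrec.snd
    refine Primrec.list_casesOn (f := fun p : (ℕ × Bool) × Word => p.2)
      (g := fun p => [p.1]) (h := fun p q => bif (p.1.1 == q.1.1 && p.1.2 == !q.1.2) then q.2
        else p.1 :: q.1 :: q.2) Primrec.snd
      (Primrec.list_cons.comp Primrec.fst (Primrec.const [])) ?_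
    exact Primrec.cond (Primrec.and.comp
      (Primrec.beq.comp (Primrec.fst.comp hx) (Primrec.fst.comp hy))
      (Primrec.beq.comp (Primrec.snd.comp hx) (Primrec.not.comp (Primrec.snd.comp hy)))) hys
      (Primrec.list_cons.comp hx (Primrec.list_cons.comp hy hys))
  refine (Primrec.list_foldr (h := fun _ p => f p.1 p.2) Primrec.id (Primrec.const [])
    (hf.comp (Primrec.fst.comp Primrec.snd) (Primrec.snd.comp Primrec.snd))).of_eq fun w => ?_
  induction w with
  | nil => rfl
  | cons x w ih =>
    simp only [id, List.foldr_cons] at ih ⊢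
    rw [ih, FreeGroup.reduce.cons]
    cases FreeGroup.reduce w with
    | nil => rfl
    | cons y ys =>
      by_cases h : x.1 = y.1 ∧ x.2 = !y.2
      · simp [f, h]
      · change _ = if x.1 = y.1 ∧ x.2 = !y.2 then ys else x :: y :: ys
        have : (x.1 == y.1 && x.2 == !y.2) = false := by
          rw [Bool.eq_false_iff]
          simpa using h
        simp only [f, this, cond_false, if_neg h]

/-- In a group given by a recursively enumerable set of relators, the set of words representing `1`
is recursively enumerable. -/
theorem IsRE.wordGroup {γ : Type*} [Primcodable γ] {R : γ → Set Word}
    (hR : IsRE fun x : γ × Word => x.2 ∈ R x.1) :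
    IsRE fun x : γ × Word => WordGroup.val (R x.1) x.2 = 1 := by
  let conj : Word × Word × Bool → Word := fun t =>
    t.1 ++ ((bif t.2.2 then t.2.1 else FreeGroup.invRev t.2.1) ++ FreeGroup.invRev t.1)
  have hconj : Primrec conj :=
    Primrec.list_append.comp Primrec.fst (Primrec.list_append.comp
      (Primrec.cond (Primrec.snd.comp Primrec.snd) (Primrec.fst.comp Primrec.snd)
        (primrec_invRev.comp (Primrec.fst.comp Primrec.snd)))
      (primrec_invRev.comp Primrec.fst))
  have key : ∀ (S : Set Word) (w : Word), WordGroup.val S w = 1 ↔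
      ∃ l : List (Word × Word × Bool), (∀ t ∈ l, t.2.1 ∈ S) ∧
        FreeGroup.reduce w = FreeGroup.reduce (l.flatMap conj) := by
    intro S w
    rw [WordGroup.val_eq_one_iff]
    have hred : ∀ w' : Word, FreeGroup.reduce w = FreeGroup.reduce w' ↔
        FreeGroup.mk w = FreeGroup.mk w' := fun w' =>
      ⟨FreeGroup.reduce.exact, fun h => FreeGroup.reduce.sound h⟩
    simp only [hred]
    generalize FreeGroup.mk w = x
    have hval : ∀ t : Word × Word × Bool, FreeGroup.mk (conj t) = FreeGroup.mk t.1 *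
        (bif t.2.2 then FreeGroup.mk t.2.1 else (FreeGroup.mk t.2.1)⁻¹) *
        (FreeGroup.mk t.1)⁻¹ := by
      rintro ⟨u, r, b⟩
      cases b <;> simp [conj, FreeGroup.inv_mk, FreeGroup.mul_mk]
    constructor
    · intro hx
      induction hx using Subgroup.closure_induction with
      | mem y hy =>
        obtain ⟨_, ⟨r, hr, rfl⟩, hc⟩ := Group.mem_conjugatesOfSet_iff.1 hy
        obtain ⟨c, rfl⟩ := isConj_iff.1 hc
        refine ⟨[(c.toWord, r, true)], by simpa using hr, ?_⟩
        simp [hval, FreeGroup.mk_toWord]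
      | one => exact ⟨[], by simp, rfl⟩
      | mul x y _ _ hx hy =>
        obtain ⟨l, hl, rfl⟩ := hx
        obtain ⟨l', hl', rfl⟩ := hy
        refine ⟨l ++ l', fun t ht => ?_, by simp [FreeGroup.mul_mk]⟩
        rcases List.mem_append.1 ht with h | h
        exacts [hl t h, hl' t h]
      | inv x hx' hx =>
        obtain ⟨l, hl, rfl⟩ := hx
        clear hx'
        induction l with
        | nil => exact ⟨[], by simp, rfl⟩
        | cons t l ih =>
          obtain ⟨l', hl', h⟩ := ih fun t ht => hl t (List.mem_cons_of_mem _ ht)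
          refine ⟨l' ++ [(t.1, t.2.1, !t.2.2)], fun s hs => ?_, ?_⟩
          · rcases List.mem_append.1 hs with hs | hs
            · exact hl' s hs
            · rw [List.mem_singleton.1 hs]
              exact hl t List.mem_cons_self
          · have h1 : FreeGroup.mk (conj (t.1, t.2.1, !t.2.2)) = (FreeGroup.mk (conj t))⁻¹ := by
              rw [hval, hval]
              rcases t with ⟨u, r, b⟩
              cases b <;> simp
            rw [List.flatMap_cons, ← FreeGroup.mul_mk, mul_inv_rev, h, List.flatMap_append,
              List.flatMap_singleton, ← h1, FreeGroup.mul_mk]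
    · rintro ⟨l, hl, rfl⟩
      induction l with
      | nil => exact Subgroup.one_mem _
      | cons t l ih =>
        rw [List.flatMap_cons, ← FreeGroup.mul_mk]
        refine Subgroup.mul_mem _ ?_ (ih fun t ht => hl t (List.mem_cons_of_mem _ ht))
        rw [hval]
        refine Subgroup.Normal.conj_mem inferInstance _ ?_ _
        have h1 : FreeGroup.mk t.2.1 ∈ relSubgroup S :=
          Subgroup.subset_normalClosure ⟨_, hl t List.mem_cons_self, rfl⟩
        cases t.2.2
        exacts [Subgroup.inv_mem _ h1, h1]
  refine (IsRE.ex (p := fun (x : γ × Word) (l : List (Word × Word × Bool)) =>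
    (∀ t ∈ l, t.2.1 ∈ R x.1) ∧ FreeGroup.reduce x.2 = FreeGroup.reduce (l.flatMap conj)) ?_).of_iff
    fun x => key _ _
  refine (IsRE.forall_mem Primrec.snd (hR.comp (f := fun y :
    ((γ × Word) × List (Word × Word × Bool)) × (Word × Word × Bool) => (y.1.1.1, y.2.2.1)) ?_)).and
    (IsRE.eq (primrec_reduce.comp (Primrec.snd.comp Primrec.fst))
      (primrec_reduce.comp (Primrec.list_flatMap Primrec.snd (hconj.comp Primrec.snd))))
  exact Primrec.pair (Primrec.fst.comp (Primrec.fst.comp Primrec.fst))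
    (Primrec.fst.comp (Primrec.snd.comp Primrec.snd))

/-! ### Normal forms of paths -/

namespace GraphOfGroups

variable {𝔸 : GraphOfGroups.{u₁, u₂, u₃, u₄}}

namespace Path

/-- `p` starts with `ω_e(c), e⁻¹`, so that the edge `e` followed by `p` can be shortened. -/
def Cancels {u v w : 𝔸.V} (e : 𝔸.E u v) (p : 𝔸.Path v w) : Prop :=
  ∃ (c : 𝔸.Ae e) (r : 𝔸.Path u w), p = cons (𝔸.ω e c) (𝔸.inv e) r

/-- Reducedness, by recursion on the path. -/
def Red : ∀ {u v : 𝔸.V}, 𝔸.Path u v → Prop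
  | _, _, nil _ => True
  | _, _, cons _ e p => ¬ Cancels e p ∧ p.Red

/-- Two paths of the same length that differ by moving elements of the edge groups across edges,
`a α_e(c), e, b ≈ a, e, ω_e(c) b`. -/
inductive Slide : ∀ {u v : 𝔸.V}, 𝔸.Path u v → 𝔸.Path u v → Prop
  | base {v : 𝔸.V} (a : 𝔸.A v) : Slide (nil a) (nil a)
  | step {u v w : 𝔸.V} (a : 𝔸.A u) (e : 𝔸.E u v) (c : 𝔸.Ae e) {p p' : 𝔸.Path v w} :
      Slide (p.lmul (𝔸.ω e c)) p' → Slide (cons (a * 𝔸.α e c) e p) (cons a e p')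

/-- The identification of `Ae (inv e)` with `Ae e`. -/
theorem exists_edge_of_inv {u v : 𝔸.V} (e : 𝔸.E u v) (d : 𝔸.Ae (𝔸.inv e)) :
    ∃ c : 𝔸.Ae e, 𝔸.α (𝔸.inv e) d = 𝔸.ω e c ∧ 𝔸.ω (𝔸.inv e) d = 𝔸.α e c := by
  obtain ⟨φ, hφ⟩ := 𝔸.rev e
  obtain ⟨c, rfl⟩ := φ.surjective d
  exact ⟨c, hφ c⟩

theorem exists_inv_of_edge {u v : 𝔸.V} (e : 𝔸.E u v) (c : 𝔸.Ae e) :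
    ∃ d : 𝔸.Ae (𝔸.inv e), 𝔸.α (𝔸.inv e) d = 𝔸.ω e c ∧ 𝔸.ω (𝔸.inv e) d = 𝔸.α e c := by
  obtain ⟨φ, hφ⟩ := 𝔸.rev e
  exact ⟨φ c, hφ c⟩

theorem Slide.lmul {u v : 𝔸.V} {p q : 𝔸.Path u v} (h : Slide p q) (b : 𝔸.A u) :
    Slide (p.lmul b) (q.lmul b) := by
  cases h with
  | base a => exact Slide.base _
  | step a e c h =>
    simp only [lmul_cons, ← mul_assoc]
    exact Slide.step _ _ _ h

theorem Slide.consCongr {u v w : 𝔸.V} (a : 𝔸.A u) (e : 𝔸.E u v) {p p' : 𝔸.Path v w}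
    (h : Slide p p') : Slide (cons a e p) (cons a e p') := by
  simpa using Slide.step a e 1 (by simpa using h)

theorem Slide.refl {u v : 𝔸.V} (p : 𝔸.Path u v) : Slide p p := by
  induction p with
  | nil a => exact Slide.base a
  | cons a e p ih => exact Slide.consCongr a e ih

theorem Slide.symm {u v : 𝔸.V} {p q : 𝔸.Path u v} (h : Slide p q) : Slide q p := by
  induction h with
  | base a => exact Slide.base a
  | step a e c h ih =>
    have h1 := ih.lmul (𝔸.ω e c⁻¹)
    rw [lmul_lmul, ← map_mul, inv_mul_cancel, map_one, one_lmul] at h1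
    simpa [mul_assoc] using Slide.step (a * 𝔸.α e c) e c⁻¹ h1

theorem Slide.trans {u v : 𝔸.V} {p q r : 𝔸.Path u v} (h : Slide p q) (h' : Slide q r) :
    Slide p r := by
  induction h with
  | base a => exact h'
  | @step u v w a e c p p' h ih =>
    generalize hq : cons a e p' = q at h'
    cases h' with
    | base b => cases hq
    | step b e' d h' =>
      cases hq
      rw [mul_assoc, ← map_mul]
      refine Slide.step _ _ _ ?_
      have h1 := h'.lmul (𝔸.ω e d⁻¹)
      rw [lmul_lmul, ← map_mul, inv_mul_cancel, map_one, one_lmul] at h1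
      have h2 := (ih h1).lmul (𝔸.ω e d)
      rwa [lmul_lmul, lmul_lmul, ← map_mul, ← map_mul, mul_inv_cancel, map_one, one_lmul] at h2

theorem Slide.length_eq {u v : 𝔸.V} {p q : 𝔸.Path u v} (h : Slide p q) :
    p.length = q.length := by
  induction h with
  | base a => rfl
  | step a e c h ih => simpa [length] using ih

theorem Slide.sim {u v : 𝔸.V} {p q : 𝔸.Path u v} (h : Slide p q) : Sim p q := by
  induction h with
  | base a => exact Sim.refl _
  | @step u v w a e c p p' h ih =>
    have h1 : Sim ((nil a).comp (((cons 1 e (cons (𝔸.ω e c) (𝔸.inv e) (nil 1)))).comp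
        (cons 1 e p))) ((nil a).comp ((nil (1 * 𝔸.α e c * 1)).comp (cons 1 e p))) :=
      Sim.comp (Sim.refl _) (Sim.comp (Sim.basic 1 e c 1) (Sim.refl _))
    have h2 : Sim ((cons a e (nil (𝔸.ω e c))).comp ((cons 1 (𝔸.inv e) (cons 1 e (nil 1))).comp p))
        ((cons a e (nil (𝔸.ω e c))).comp ((nil 1).comp p)) :=
      Sim.comp (Sim.refl _) (Sim.comp (sim_inv_edge e) (Sim.refl _))
    have h3 : Sim ((cons a e (nil 1)).comp (p.lmul (𝔸.ω e c))) ((cons a e (nil 1)).comp p') :=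
      Sim.comp (Sim.refl _) ih
    simp only [nil_comp, cons_comp, lmul_cons, one_lmul, mul_one, one_mul] at h1 h2 h3
    exact (h1.symm.trans h2).trans h3

theorem Slide.cancels {u v w : 𝔸.V} {e : 𝔸.E u v} {p q : 𝔸.Path v w} (h : Slide p q)
    (hp : Cancels e p) : Cancels e q := by
  obtain ⟨c, r, rfl⟩ := hp
  generalize hx : 𝔸.ω e c = x at h
  generalize hi : 𝔸.inv e = i at h
  cases h with
  | step a _ d h =>
    subst hi
    obtain ⟨d', hd, -⟩ := exists_edge_of_inv e d
    rename_i r'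
    refine ⟨c * d'⁻¹, r', ?_⟩
    rw [map_mul, map_inv, hx, hd]
    simp

@[simp] theorem red_lmul {u v : 𝔸.V} (a : 𝔸.A u) (p : 𝔸.Path u v) :
    (p.lmul a).Red ↔ p.Red := by
  cases p <;> rfl

theorem cancels_lmul {u v w : 𝔸.V} (e : 𝔸.E u v) (c : 𝔸.Ae e) {p : 𝔸.Path v w} :
    Cancels e (p.lmul (𝔸.ω e c)) ↔ Cancels e p := by
  constructor
  · rintro ⟨d, r, h⟩
    refine ⟨c⁻¹ * d, r, ?_⟩
    have h' := congrArg (lmul (𝔸.ω e c⁻¹)) h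
    rw [lmul_lmul, ← map_mul, inv_mul_cancel, map_one, one_lmul, lmul_cons, ← map_mul] at h'
    exact h'
  · rintro ⟨d, r, rfl⟩
    exact ⟨c * d, r, by rw [lmul_cons, ← map_mul]⟩

open Classical in
/-- Left multiplication of a reduced path by an edge, cancelling if possible. -/
noncomputable def stepE {u v w : 𝔸.V} (e : 𝔸.E u v) (p : 𝔸.Path v w) : 𝔸.Path u w :=
  if h : ∃ x : 𝔸.Ae e × 𝔸.Path u w, p = cons (𝔸.ω e x.1) (𝔸.inv e) x.2 then
    h.choose.2.lmul (𝔸.α e h.choose.1)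
  else cons 1 e p

theorem stepE_cancel {u v w : 𝔸.V} (e : 𝔸.E u v) (c : 𝔸.Ae e) (r : 𝔸.Path u w) :
    stepE e (cons (𝔸.ω e c) (𝔸.inv e) r) = r.lmul (𝔸.α e c) := by
  have h : ∃ x : 𝔸.Ae e × 𝔸.Path u w,
      cons (𝔸.ω e c) (𝔸.inv e) r = cons (𝔸.ω e x.1) (𝔸.inv e) x.2 := ⟨(c, r), rfl⟩
  rw [stepE, dif_pos h]
  have h' := h.choose_spec
  generalize h.choose = x at h'
  simp only [cons.injEq, heq_eq_eq, true_and] at h'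
  rw [← h'.2, ← 𝔸.ω_injective e h'.1]

theorem stepE_of_not {u v w : 𝔸.V} (e : 𝔸.E u v) {p : 𝔸.Path v w} (h : ¬ Cancels e p) :
    stepE e p = cons 1 e p := by
  exact dif_neg fun ⟨x, hx⟩ => h ⟨x.1, x.2, hx⟩

theorem slide_stepE {u v w : 𝔸.V} (e : 𝔸.E u v) {p q : 𝔸.Path v w} (h : Slide p q) :
    Slide (stepE e p) (stepE e q) := by
  by_cases hp : Cancels e p
  · obtain ⟨c', r', rfl⟩ := h.cancels hp
    obtain ⟨c, r, rfl⟩ := hp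
    rw [stepE_cancel, stepE_cancel]
    generalize hx : 𝔸.ω e c = x at h
    generalize hx' : 𝔸.ω e c' = x' at h
    cases h with
    | step a _ d h =>
      obtain ⟨d', hd, hd'⟩ := exists_edge_of_inv e d
      rw [hd, ← hx', ← map_mul] at hx
      rw [𝔸.ω_injective e hx, map_mul, ← lmul_lmul, ← hd']
      exact h.lmul _
  · rw [stepE_of_not e hp, stepE_of_not e (fun hq => hp (h.symm.cancels hq))]
    exact Slide.consCongr _ _ h

theorem red_stepE {u v w : 𝔸.V} (e : 𝔸.E u v) {p : 𝔸.Path v w} (h : p.Red) : (stepE e p).Red := by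
  by_cases hp : Cancels e p
  · obtain ⟨c, r, rfl⟩ := hp
    rw [stepE_cancel, red_lmul]
    exact h.2
  · rw [stepE_of_not e hp]
    exact ⟨hp, h⟩

theorem sim_stepE {u v w : 𝔸.V} (e : 𝔸.E u v) (p : 𝔸.Path v w) : Sim (stepE e p) (cons 1 e p) := by
  by_cases hp : Cancels e p
  · obtain ⟨c, r, rfl⟩ := hp
    rw [stepE_cancel]
    simpa using (Sim.comp (Sim.basic 1 e c 1) (Sim.refl r)).symm
  · rw [stepE_of_not e hp]
    exact Sim.refl _

theorem length_stepE {u v w : 𝔸.V} (e : 𝔸.E u v) (p : 𝔸.Path v w) :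
    (stepE e p).length ≤ p.length + 1 := by
  by_cases hp : Cancels e p
  · obtain ⟨c, r, rfl⟩ := hp
    rw [stepE_cancel, length_lmul]
    simp only [length]
    omega
  · rw [stepE_of_not e hp]
    exact le_rfl

/-- The action of paths on reduced paths. -/
noncomputable def act : ∀ {u v w : 𝔸.V}, 𝔸.Path u v → 𝔸.Path v w → 𝔸.Path u w
  | _, _, _, nil a, x => x.lmul a
  | _, _, _, cons a e p, x => (stepE e (act p x)).lmul a

theorem act_lmul {u v w : 𝔸.V} (a : 𝔸.A u) (p : 𝔸.Path u v) (x : 𝔸.Path v w) :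
    act (p.lmul a) x = (act p x).lmul a := by
  cases p <;> simp [act, lmul_lmul]

theorem act_comp {u v w x : 𝔸.V} (p : 𝔸.Path u v) (q : 𝔸.Path v w) (y : 𝔸.Path w x) :
    act (p.comp q) y = act p (act q y) := by
  induction p with
  | nil a => simp [act, act_lmul]
  | cons a e p ih => simp [act, ih]

theorem red_act {u v w : 𝔸.V} (p : 𝔸.Path u v) {x : 𝔸.Path v w} (hx : x.Red) : (act p x).Red := by
  induction p with
  | nil a => simpa [act] using hx
  | cons a e p ih => simpa [act] using red_stepE e (ih hx)

theorem slide_act {u v w : 𝔸.V} (p : 𝔸.Path u v) {x y : 𝔸.Path v w} (h : Slide x y) :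
    Slide (act p x) (act p y) := by
  induction p with
  | nil a => exact h.lmul a
  | cons a e p ih => exact (slide_stepE e (ih h)).lmul a

theorem sim_act {u v w : 𝔸.V} (p : 𝔸.Path u v) (x : 𝔸.Path v w) : Sim (act p x) (p.comp x) := by
  induction p with
  | nil a => exact Sim.refl _
  | cons a e p ih =>
    have h1 := Sim.comp (Sim.refl (nil a)) ((sim_stepE e (act p x)).trans
      (by simpa using Sim.comp (Sim.refl (cons 1 e (nil 1))) (ih x)))
    simpa [act] using h1

theorem length_act {u v w : 𝔸.V} (p : 𝔸.Path u v) (x : 𝔸.Path v w) :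
    (act p x).length ≤ p.length + x.length := by
  induction p with
  | nil a => simp [act, length]
  | cons a e p ih =>
    have h1 := length_stepE e (act p x)
    have h2 := ih x
    simp only [act, length_lmul, length]
    omega

theorem slide_stepE_stepE {u v w : 𝔸.V} (e : 𝔸.E u v) (c : 𝔸.Ae e) {y : 𝔸.Path u w} (hy : y.Red) :
    Slide (stepE e ((stepE (𝔸.inv e) y).lmul (𝔸.ω e c))) (y.lmul (𝔸.α e c)) := by
  by_cases h : Cancels (𝔸.inv e) y
  · obtain ⟨d, r, rfl⟩ := h
    obtain ⟨d', hd, hd'⟩ := exists_edge_of_inv e d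
    have hr : ¬ Cancels e r := by simpa [𝔸.inv_inv] using hy.1
    rw [stepE_cancel, lmul_lmul, hd, hd', ← map_mul, 𝔸.inv_inv,
      stepE_of_not e (fun h => hr ((cancels_lmul e _).1 h)), lmul_cons, ← map_mul]
    simpa using (Slide.step 1 e (c * d') (Slide.refl _)).symm
  · rw [stepE_of_not _ h, lmul_cons, mul_one, stepE_cancel]
    exact Slide.refl _

theorem Sim.act_slide {u v w : 𝔸.V} {p q : 𝔸.Path u v} (h : Sim p q) {x : 𝔸.Path v w}
    (hx : x.Red) : Slide (act p x) (act q x) := by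
  induction h with
  | basic a e c b =>
    have h1 := (slide_stepE_stepE e c (y := x.lmul b) ((red_lmul _ _).2 hx)).lmul a
    simpa [Path.act, lmul_lmul, mul_assoc] using h1
  | comp h1 h2 ih1 ih2 =>
    rw [act_comp, act_comp]
    exact (slide_act _ (ih2 hx)).trans (ih1 (red_act _ hx))
  | refl p => exact Slide.refl _
  | symm _ ih => exact (ih hx).symm
  | trans _ _ ih1 ih2 => exact (ih1 hx).trans (ih2 hx)

theorem Red.act_slide {u v : 𝔸.V} {p : 𝔸.Path u v} (hp : p.Red) : Slide (act p (nil 1)) p := by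
  induction p with
  | nil a => simpa [act] using Slide.refl _
  | cons a e p ih =>
    have h1 := ih hp.2
    have h2 : ¬ Cancels e (act p (nil 1)) := fun h => hp.1 (h1.cancels h)
    simpa [act, stepE_of_not e h2] using Slide.consCongr a e h1

/-- The normal form theorem: equivalent reduced paths differ by slides only. -/
theorem Sim.slide {u v : 𝔸.V} {p q : 𝔸.Path u v} (h : Sim p q) (hp : p.Red) (hq : q.Red) :
    Slide p q :=
  (hp.act_slide.symm.trans (h.act_slide (x := nil 1) trivial)).trans hq.act_slide

theorem exists_red {u v : 𝔸.V} (p : 𝔸.Path u v) :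
    ∃ q : 𝔸.Path u v, q.Red ∧ Sim p q ∧ q.length ≤ p.length :=
  ⟨act p (nil 1), red_act p trivial, by simpa using (sim_act p (nil 1)).symm,
    by simpa [length] using length_act p (nil 1)⟩

theorem Sim.length_le {u v : 𝔸.V} {p q : 𝔸.Path u v} (h : Sim p q) (hp : p.Red) :
    p.length ≤ q.length := by
  obtain ⟨r, hr, hqr, hl⟩ := exists_red q
  rw [((h.trans hqr).slide hp hr).length_eq]
  exact hl

theorem Red.eq_nil_of_sim {u : 𝔸.V} {p : 𝔸.Path u u} (hp : p.Red) {a : 𝔸.A u}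
    (h : Sim p (nil a)) : p = nil a := by
  have h1 := h.slide hp trivial
  generalize hx : nil a = x at h1
  cases h1 with
  | base b => rfl
  | step b e c h => cases hx

theorem nil_sim_nil {u : 𝔸.V} {a b : 𝔸.A u} (h : Sim (nil a) (nil b)) : a = b := by
  have := Red.eq_nil_of_sim (p := nil a) trivial h
  simpa using this

/-- A path without edges has equal endpoints, so an equivalence with one is detected by length. -/
theorem exists_eq_nil_of_length {u v : 𝔸.V} {p : 𝔸.Path u v} (h : p.length = 0) :
    ∃ (huv : u = v) (a : 𝔸.A u), p = (nil a : 𝔸.Path u u).cast rfl huv := by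
  cases p with
  | nil a => exact ⟨rfl, a, rfl⟩
  | cons a e p => simp [length] at h

theorem eq_nil_of_length {u : 𝔸.V} {p : 𝔸.Path u u} (h : p.length = 0) : ∃ a, p = nil a := by
  obtain ⟨_, a, ha⟩ := exists_eq_nil_of_length h
  exact ⟨a, ha⟩

theorem Red.of_comp_right {u v w : 𝔸.V} {p : 𝔸.Path u v} {q : 𝔸.Path v w} (h : (p.comp q).Red) :
    q.Red := by
  induction p with
  | nil a => simpa using h
  | cons a e p ih => exact ih h.2

theorem reduced_iff_red {u v : 𝔸.V} (p : 𝔸.Path u v) : p.Reduced ↔ p.Red := by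
  constructor
  · intro h
    induction p with
    | nil a => trivial
    | @cons u v w a e p ih =>
      refine ⟨?_, ih fun x y q b f c r hq => h x y (cons a e q) b f c r (by rw [hq, cons_comp])⟩
      rintro ⟨c, r, rfl⟩
      exact h _ _ (nil 1) a e c r (by simp)
  · rintro h x y q a e c r rfl
    exact h.of_comp_right.1 ⟨c, r, rfl⟩

theorem sim_reverse_reverse {u v : 𝔸.V} (p : 𝔸.Path u v) : Sim p.reverse.reverse p := by
  have h1 := Sim.comp (Sim.refl p) (comp_reverse p.reverse)
  have h2 := Sim.comp (comp_reverse p) (Sim.refl p.reverse.reverse)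
  rw [comp_assoc] at h2
  simpa using h2.symm.trans (by simpa using h1)

theorem length_reverse {u v : 𝔸.V} (p : 𝔸.Path u v) : p.reverse.length = p.length := by
  induction p with
  | nil a => rfl
  | cons a e p ih => simp [reverse, length, ih]

/-- Reduced paths are the shortest paths in their classes, a property that passes to inverses. -/
theorem Red.reverse {u v : 𝔸.V} {p : 𝔸.Path u v} (hp : p.Red) : p.reverse.Red := by
  rw [← reduced_iff_red]
  intro x y q a e c r h
  have h1 : Sim p.reverse (q.comp ((nil (a * 𝔸.α e c * 1)).comp r)) := by
    rw [h]
    simpa using Sim.comp (Sim.refl q) (Sim.comp (Sim.basic a e c 1) (Sim.refl r))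
  have h2 := (sim_reverse_reverse p).symm.trans h1.reverse
  have h3 := h2.length_le hp
  have h4 := congrArg length h
  simp [length_reverse, length] at h3 h4
  omega

end Path

end GraphOfGroups

/-! ### The Bass–Serre tree -/

namespace GraphOfGroups

variable {𝔸 : GraphOfGroups.{u₁, u₂, u₃, u₄}}

namespace Path

theorem cancels_cons_iff {u v w x y : 𝔸.V} (e : 𝔸.E u v) (a : 𝔸.A v) (f : 𝔸.E v w)
    (p : 𝔸.Path w x) (q : 𝔸.Path w y) : Cancels e (cons a f p) ↔ Cancels e (cons a f q) := by
  have h : ∀ {x y : 𝔸.V} (p : 𝔸.Path w x) (q : 𝔸.Path w y), Cancels e (cons a f p) →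
      Cancels e (cons a f q) := by
    rintro x y p q ⟨c, r, h⟩
    cases h
    exact ⟨c, q, rfl⟩
  exact ⟨h p q, h q p⟩

theorem not_cancels_nil {u v : 𝔸.V} (e : 𝔸.E u v) (a : 𝔸.A v) : ¬ Cancels e (nil a) := by
  rintro ⟨c, r, h⟩
  generalize 𝔸.inv e = i at h
  cases h

theorem Red.of_comp_left {u v w : 𝔸.V} {p : 𝔸.Path u v} {q : 𝔸.Path v w} (h : (p.comp q).Red) :
    p.Red := by
  induction p with
  | nil a => trivial
  | cons a e p ih =>
    refine ⟨fun hc => h.1 ?_, ih h.2⟩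
    cases p with
    | nil b => exact absurd hc (not_cancels_nil e b)
    | cons b f p => exact (cancels_cons_iff e b f _ _).1 hc

theorem red_nil {v : 𝔸.V} (a : 𝔸.A v) : (nil a : 𝔸.Path v v).Red := trivial

theorem red_comp_nil {u v : 𝔸.V} {p : 𝔸.Path u v} (a : 𝔸.A v) :
    (p.comp (nil a)).Red ↔ p.Red := by
  refine ⟨Red.of_comp_left, fun h => ?_⟩
  induction p with
  | nil b => trivial
  | cons b e p ih =>
    refine ⟨fun hc => h.1 ?_, ih _ h.2⟩
    cases p with
    | nil b => exact absurd hc (not_cancels_nil e _)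
    | cons b f p => exact (cancels_cons_iff e b f _ _).1 hc

/-- Reducedness of a concatenation only depends on the edges at the junction. -/
theorem Red.glue {u v w x : 𝔸.V} {p : 𝔸.Path u v} {a : 𝔸.A v} {e : 𝔸.E v w} {b : 𝔸.A w}
    {q : 𝔸.Path w x} {a' : 𝔸.A v} (hp : (p.comp (cons a e (nil b))).Red)
    (hq : (cons a' e q).Red) : (p.comp (cons a e q)).Red := by
  induction p with
  | nil y => exact hq
  | cons y g p ih =>
    refine ⟨fun hc => hp.1 ?_, ih hp.2 hq⟩
    cases p with
    | nil z => exact (cancels_cons_iff g (z * a) e _ _).1 hc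
    | cons z f p => exact (cancels_cons_iff g z f _ _).1 hc

/-- A concatenation of reduced paths is reduced unless there is a cancellation at the junction. -/
theorem red_comp_or {u v w x : 𝔸.V} {p : 𝔸.Path u v} {a : 𝔸.A v} {e : 𝔸.E v w} {q : 𝔸.Path w x}
    (hp : p.Red) (hq : (cons a e q).Red) :
    (p.comp (cons a e q)).Red ∨ ∃ (q' : 𝔸.Path u w) (b : 𝔸.A w) (f : 𝔸.E w v) (b' : 𝔸.A v)
      (c : 𝔸.Ae f), e = 𝔸.inv f ∧ p = q'.comp (cons b f (nil b')) ∧ b' * a = 𝔸.ω f c := by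
  induction p with
  | nil y => exact Or.inl hq
  | @cons u z v y g p ih =>
    rcases ih hp.2 hq with h | ⟨q', b, f, b', c, he, rfl, hc⟩
    · by_cases hc : Cancels g (p.comp (cons a e q))
      · cases p with
        | nil b' =>
          right
          obtain ⟨c, r, hr⟩ := hc
          rw [nil_comp, lmul_cons] at hr
          generalize hx : b' * a = x at hr
          generalize hy : 𝔸.ω g c = z at hr
          cases hr
          exact ⟨nil 1, y, g, b', c, rfl, by simp, hx.trans hy.symm⟩
        | cons z f p => exact absurd ((cancels_cons_iff g z f _ _).1 hc) hp.1
      · exact Or.inl ⟨hc, h⟩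
    · exact Or.inr ⟨cons y g q', b, f, b', c, he, rfl, hc⟩

end Path

open _root_.GraphOfGroups.Path

theorem TreeVertex.mk_eq_iff {v₀ v : 𝔸.V} {p q : 𝔸.Path v₀ v} :
    TreeVertex.mk p = TreeVertex.mk q ↔ ∃ a : 𝔸.A v, Sim p (q.comp (nil a)) := by
  constructor
  · intro h
    have h' := eq_of_heq (Sigma.mk.inj h).2
    exact Quotient.exact h'
  · rintro ⟨a, h⟩
    exact TreeVertex.mk_eq a h

theorem TreeVertex.mk_eq_of_sim {v₀ v : 𝔸.V} {p q : 𝔸.Path v₀ v} (h : Sim p q) :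
    TreeVertex.mk p = TreeVertex.mk q :=
  TreeVertex.mk_eq 1 (by simpa using h)

theorem TreeVertex.mk_comp_nil {v₀ v : 𝔸.V} (p : 𝔸.Path v₀ v) (a : 𝔸.A v) :
    TreeVertex.mk (p.comp (nil a)) = TreeVertex.mk p :=
  TreeVertex.mk_eq a (Sim.refl _)

theorem TreeVertex.exists_red_rep {v₀ : 𝔸.V} (x : 𝔸.TreeVertex v₀) :
    ∃ (v : 𝔸.V) (p : 𝔸.Path v₀ v), p.Red ∧ x = TreeVertex.mk p := by
  obtain ⟨v, x⟩ := x
  induction x using Quotient.inductionOn with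
  | _ p =>
    obtain ⟨q, hq, h, -⟩ := exists_red p
    exact ⟨v, q, hq, TreeVertex.mk_eq_of_sim h⟩

/-- The distance from the base vertex. -/
noncomputable def TreeVertex.depth {v₀ : 𝔸.V} (x : 𝔸.TreeVertex v₀) : ℕ :=
  (TreeVertex.exists_red_rep x).choose_spec.choose.length

theorem TreeVertex.mk_fst {v₀ v w : 𝔸.V} {p : 𝔸.Path v₀ v} {q : 𝔸.Path v₀ w}
    (h : TreeVertex.mk p = TreeVertex.mk q) : v = w := congrArg Sigma.fst h

theorem TreeVertex.depth_mk {v₀ v : 𝔸.V} {p : 𝔸.Path v₀ v} (hp : p.Red) :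
    (TreeVertex.mk p).depth = p.length := by
  have h := (TreeVertex.exists_red_rep (TreeVertex.mk p)).choose_spec.choose_spec
  unfold TreeVertex.depth
  generalize (TreeVertex.exists_red_rep (TreeVertex.mk p)).choose_spec.choose = q at h ⊢
  generalize (TreeVertex.exists_red_rep (TreeVertex.mk p)).choose = w at q h ⊢
  obtain ⟨hq, h⟩ := h
  obtain rfl := TreeVertex.mk_fst h
  obtain ⟨a, ha⟩ := TreeVertex.mk_eq_iff.1 h
  have := (ha.slide hp ((red_comp_nil a).2 hq)).length_eq
  simpa [length] using this.symm

/-- `x` is the vertex preceding `y` on the way from the base vertex to `y`. -/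
def Precedes {v₀ : 𝔸.V} (x y : 𝔸.TreeVertex v₀) : Prop :=
  ∃ (v w : 𝔸.V) (p : 𝔸.Path v₀ v) (a : 𝔸.A v) (e : 𝔸.E v w),
    (p.comp (cons a e (nil 1))).Red ∧ x = TreeVertex.mk p ∧
      y = TreeVertex.mk (p.comp (cons a e (nil 1)))

theorem Precedes.depth {v₀ : 𝔸.V} {x y : 𝔸.TreeVertex v₀} (h : Precedes x y) :
    y.depth = x.depth + 1 := by
  obtain ⟨v, w, p, a, e, hr, rfl, rfl⟩ := h
  rw [TreeVertex.depth_mk hr, TreeVertex.depth_mk hr.of_comp_left]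
  simp [length]

theorem precedes_or {v₀ : 𝔸.V} {x y : 𝔸.TreeVertex v₀} (h : (𝔸.tree v₀).Adj x y) :
    Precedes x y ∨ Precedes y x := by
  obtain ⟨v, w, p, a, e, rfl, rfl⟩ := h
  obtain ⟨q, hq, hpq, -⟩ := exists_red p
  rw [TreeVertex.mk_eq_of_sim hpq, TreeVertex.mk_eq_of_sim (Sim.comp hpq (Sim.refl _))]
  rcases red_comp_or (a := a) (e := e) (q := nil 1) hq ⟨not_cancels_nil _ _, trivial⟩ with
    h | ⟨q', b, f, b', c, rfl, rfl, hc⟩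
  · exact Or.inl ⟨v, w, q, a, e, h, rfl, rfl⟩
  · right
    have h1 : q'.comp (cons b f (nil b')) = (q'.comp (cons b f (nil 1))).comp (nil b') := by
      simp [comp_assoc]
    refine ⟨w, v, q', b, f, ?_, ?_, ?_⟩
    · rw [h1, red_comp_nil] at hq
      exact hq
    · refine TreeVertex.mk_eq (b * 𝔸.α f c) ?_
      have h2 := Sim.comp (Sim.refl q') (Sim.basic b f c 1)
      simpa [comp_assoc, hc] using h2
    · rw [h1, TreeVertex.mk_comp_nil]

theorem TreeVertex.mk_cons {u v w x : 𝔸.V} (a : 𝔸.A u) (e : 𝔸.E u v) {p : 𝔸.Path v w}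
    {q : 𝔸.Path v x} (h : TreeVertex.mk p = TreeVertex.mk q) :
    TreeVertex.mk (cons a e p) = TreeVertex.mk (cons a e q) := by
  obtain rfl := TreeVertex.mk_fst h
  obtain ⟨b, hb⟩ := TreeVertex.mk_eq_iff.1 h
  refine TreeVertex.mk_eq b ?_
  simpa using Sim.comp (Sim.refl (cons a e (nil 1))) hb

theorem slide_snoc {u v w v' x : 𝔸.V} (p : 𝔸.Path u v) (z : 𝔸.A u) (a : 𝔸.A v) (e : 𝔸.E v w)
    (b : 𝔸.A w) (p' : 𝔸.Path u v') (a' : 𝔸.A v') (e' : 𝔸.E v' x) (b' : 𝔸.A x) (hx : w = x)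
    (h : Slide ((p.lmul z).comp (cons a e (nil b)))
      ((p'.comp (cons a' e' (nil b'))).cast rfl hx.symm)) :
    TreeVertex.mk (p.lmul z) = TreeVertex.mk p' := by
  subst hx
  change Slide _ (p'.comp (cons a' e' (nil b'))) at h
  induction p with
  | nil y =>
    cases p' with
    | nil y' =>
      refine TreeVertex.mk_eq (y'⁻¹ * (z * y)) ?_
      simpa using Sim.refl _
    | cons y' g p' =>
      have := h.length_eq
      simp [length] at this
  | cons y g p ih =>
    simp only [lmul_cons, cons_comp] at h ⊢
    generalize z * y = t at h ⊢
    generalize hq : p'.comp (cons a' e' (nil b')) = q at h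
    cases h with
    | step y' _ c h =>
      cases p' with
      | nil y'' =>
        cases hq
        have := h.length_eq
        simp [length] at this
      | cons y'' g' p' =>
        cases hq
        rw [← lmul_comp] at h
        exact (TreeVertex.mk_eq_of_sim (Slide.step _ _ c (Slide.refl _)).sim).trans
          (TreeVertex.mk_cons _ _ (ih _ _ _ _ h))

theorem Precedes.unique {v₀ : 𝔸.V} {x x' y : 𝔸.TreeVertex v₀} (h : Precedes x y)
    (h' : Precedes x' y) : x = x' := by
  obtain ⟨v, w, p, a, e, hr, rfl, rfl⟩ := h
  obtain ⟨v', w', p', a', e', hr', rfl, h⟩ := h'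
  obtain rfl := TreeVertex.mk_fst h
  obtain ⟨b, hb⟩ := TreeVertex.mk_eq_iff.1 h
  have h1 := hb.slide hr ((red_comp_nil b).2 hr')
  rw [comp_assoc] at h1
  simpa using slide_snoc p 1 a e 1 p' a' e' (1 * b) rfl (by rw [one_lmul]; exact h1)

/-- A vertex of maximal depth on a cycle would have two different predecessors. -/
theorem tree_isAcyclic (v₀ : 𝔸.V) : (𝔸.tree v₀).IsAcyclic := by
  classical
  intro v c hc
  obtain ⟨x, hx, hmax⟩ := c.support.toFinset.exists_max_image TreeVertex.depth
    ⟨v, by simp⟩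
  rw [List.mem_toFinset] at hx
  have hmax' : ∀ y, y ∈ c.support → ¬ Precedes x y := by
    intro y hy h
    have h1 := hmax y (by simpa using hy)
    have h2 := h.depth
    omega
  have hc' := SimpleGraph.Walk.IsCycle.rotate hx hc
  have hsup : ∀ y, y ∈ (c.rotate x hx).support → y ∈ c.support := by
    intro y hy
    exact (c.mem_support_rotate_iff x hx).1 hy
  refine hc'.snd_ne_penultimate (Precedes.unique (y := x) ?_ ?_)
  · refine ((precedes_or ((c.rotate x hx).adj_snd hc'.not_nil)).resolve_left (hmax' _ (hsup _ ?_)))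
    exact SimpleGraph.Walk.getVert_mem_support _ _
  · refine ((precedes_or ((c.rotate x hx).adj_penultimate hc'.not_nil)).resolve_right
      (hmax' _ (hsup _ ?_)))
    exact SimpleGraph.Walk.getVert_mem_support _ _

/-- The walk from the base vertex through the initial segments of a reduced path has no repeated
vertices, because the depth increases along it. -/
theorem exists_isPath_extend {v₀ v w : 𝔸.V} (q : 𝔸.Path v w) (p : 𝔸.Path v₀ v)
    (hr : (p.comp q).Red) {x₀ : 𝔸.TreeVertex v₀} (W : (𝔸.tree v₀).Walk x₀ (TreeVertex.mk p)) (hW : W.IsPath)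
    (hd : ∀ x ∈ W.support, x.depth ≤ p.length) :
    ∃ W' : (𝔸.tree v₀).Walk x₀ (TreeVertex.mk (p.comp q)), W'.IsPath ∧
      (∀ x ∈ W'.support, x.depth ≤ (p.comp q).length) ∧ ∀ s ∈ W.edges, s ∈ W'.edges := by
  induction q with
  | nil a => 
    rw [TreeVertex.mk_comp_nil]
    exact ⟨W, hW, by simpa [length] using hd, fun _ h => h⟩
  | @cons v x w a e q ih =>
    have h1 : p.comp (cons a e q) = (p.comp (cons a e (nil 1))).comp q := by
      simp [comp_assoc]
    rw [h1] at hr ⊢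
    have hadj : (𝔸.tree v₀).Adj (TreeVertex.mk p) (TreeVertex.mk (p.comp (cons a e (nil 1)))) :=
      ⟨v, x, p, a, e, rfl, rfl⟩
    have hdep := TreeVertex.depth_mk hr.of_comp_left
    have hlen : (p.comp (cons a e (nil 1))).length = p.length + 1 := by simp [length]
    obtain ⟨W', hW', hd', he'⟩ := ih _ hr (W.concat hadj)
      (hW.concat (fun h => by have := hd _ h; omega) hadj) (by
        intro y hy
        rw [SimpleGraph.Walk.support_concat, List.mem_append,
          List.mem_singleton] at hy
        rcases hy with hy | rfl
        · have := hd y hy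
          omega
        · omega)
    refine ⟨W', hW', hd', fun s hs => he' s ?_⟩
    simp [SimpleGraph.Walk.edges_concat, hs]

theorem exists_isPath_of_red {v₀ v : 𝔸.V} {p : 𝔸.Path v₀ v} (hp : p.Red) :
    ∃ W : (𝔸.tree v₀).Walk (𝔸.treeBase v₀) (TreeVertex.mk p), W.IsPath ∧
      ∀ x ∈ W.support, x.depth ≤ p.length := by
  have h0 : (nil 1).comp p = p := by simp
  obtain ⟨W, hW, hd, -⟩ := exists_isPath_extend p (nil 1) (by simpa using hp)
    (SimpleGraph.Walk.nil (u := TreeVertex.mk (nil 1))) SimpleGraph.Walk.IsPath.nil (by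
      intro x hx
      rw [SimpleGraph.Walk.support_nil, List.mem_singleton] at hx
      rw [hx, TreeVertex.depth_mk (red_nil 1)])
  revert W
  rw [h0]
  exact fun W hW hd => ⟨W, hW, hd⟩

theorem exists_isPath_of_red_comp {v₀ v w x : 𝔸.V} {p : 𝔸.Path v₀ v} {a : 𝔸.A v} {e : 𝔸.E v w}
    {q : 𝔸.Path w x} (hr : (p.comp (cons a e q)).Red) :
    ∃ W : (𝔸.tree v₀).Walk (𝔸.treeBase v₀) (TreeVertex.mk (p.comp (cons a e q))), W.IsPath ∧
      s(TreeVertex.mk p, TreeVertex.mk (p.comp (cons a e (nil 1)))) ∈ W.edges := by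
  have h1 : p.comp (cons a e q) = (p.comp (cons a e (nil 1))).comp q := by simp [comp_assoc]
  rw [h1] at hr ⊢
  obtain ⟨W, hW, hd⟩ := exists_isPath_of_red hr.of_comp_left.of_comp_left
  have hadj : (𝔸.tree v₀).Adj (TreeVertex.mk p) (TreeVertex.mk (p.comp (cons a e (nil 1)))) :=
    ⟨v, w, p, a, e, rfl, rfl⟩
  have hdep := TreeVertex.depth_mk hr.of_comp_left
  have hlen : (p.comp (cons a e (nil 1))).length = p.length + 1 := by simp [length]
  obtain ⟨W', hW', -, he'⟩ := exists_isPath_extend q _ hr (W.concat hadj)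
    (hW.concat (fun h => by have := hd _ h; omega) hadj) (by
      intro y hy
      rw [SimpleGraph.Walk.support_concat, List.mem_append, List.mem_singleton] at hy
      rcases hy with hy | rfl
      · have := hd y hy
        omega
      · omega)
  exact ⟨W', hW', he' _ (by simp [SimpleGraph.Walk.edges_concat])⟩

theorem tree_reachable_base {v₀ : 𝔸.V} (x : 𝔸.TreeVertex v₀) :
    (𝔸.tree v₀).Reachable (𝔸.treeBase v₀) x := by
  obtain ⟨v, p, hp, rfl⟩ := x.exists_red_rep
  obtain ⟨W, -⟩ := exists_isPath_of_red hp
  exact ⟨W⟩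

end GraphOfGroups

/-! ### Folded `𝔸`-graphs -/

namespace GraphOfGroups

variable {𝔸 : GraphOfGroups.{u₁, u₂, u₃, u₄}}

open _root_.GraphOfGroups.Path

theorem Path.cons_eq_cons {u v v' w : 𝔸.V} {a a' : 𝔸.A u} {e : 𝔸.E u v} {e' : 𝔸.E u v'}
    {p : 𝔸.Path v w} {p' : 𝔸.Path v' w} (h : cons a e p = cons a' e' p') :
    a = a' ∧ (⟨v, e⟩ : Σ t, 𝔸.E u t) = ⟨v', e'⟩ := by
  cases h
  exact ⟨rfl, rfl⟩

theorem Path.sim_reverse_of_comp {u v : 𝔸.V} {p : 𝔸.Path u v} {q : 𝔸.Path v u}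
    (h : Sim (p.comp q) (nil 1)) : Sim q p.reverse := by
  have h1 := Sim.comp (reverse_comp p) (Sim.refl q)
  have h2 := Sim.comp (Sim.refl p.reverse) h
  rw [comp_assoc] at h1
  simpa using h1.symm.trans (by simpa using h2)

/-- Paths leading to the same vertex of the tree differ by a path without edges. -/
theorem TreeVertex.length_eq_zero_of_mk_eq {v₀ v w : 𝔸.V} {p : 𝔸.Path v₀ v} {q : 𝔸.Path v₀ w}
    (h : TreeVertex.mk p = TreeVertex.mk q) {r : 𝔸.Path w v} (hr : r.Red)
    (hs : Sim (q.reverse.comp p) r) : r.length = 0 := by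
  obtain rfl := TreeVertex.mk_fst h
  obtain ⟨a, ha⟩ := TreeVertex.mk_eq_iff.1 h
  have h1 := Sim.comp (Sim.refl q.reverse) ha
  have h2 := Sim.comp (reverse_comp q) (Sim.refl (nil a))
  rw [comp_assoc] at h2
  have h3 := (hs.symm.trans h1).trans h2
  rw [nil_comp, one_lmul] at h3
  rw [hr.eq_nil_of_sim h3]
  rfl

theorem toSubgraph_le_hull {v₀ : 𝔸.V} {U : Subgroup (𝔸.Pi1 v₀)} {g : 𝔸.Pi1 v₀} (hg : g ∈ U)
    {x y : 𝔸.TreeVertex v₀} (hx : x = 𝔸.treeBase v₀) (hy : y = g • 𝔸.treeBase v₀)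
    (W : (𝔸.tree v₀).Walk x y) (hW : W.IsPath) : W.toSubgraph ≤ hull U := by
  subst hx hy
  exact le_iSup₂_of_le g hg (le_iSup₂_of_le W hW le_rfl)

theorem Pi1.mk_smul_treeBase {v₀ : 𝔸.V} (p : 𝔸.Path v₀ v₀) :
    Pi1.mk p • 𝔸.treeBase v₀ = TreeVertex.mk p :=
  congrArg TreeVertex.mk (comp_one p)

end GraphOfGroups

namespace AGraph

open GraphOfGroups GraphOfGroups.Path

variable {𝔸 : GraphOfGroups.{u₁, u₂, u₃, u₄}} (𝓑 : AGraph.{u₁, u₂, u₃, u₄, u₅, u₆} 𝔸)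

theorem exists_edge_inv {u v : 𝓑.V} (f : 𝓑.E u v) (c : 𝔸.Ae (𝓑.etype f)) :
    ∃ d : 𝔸.Ae (𝓑.etype (𝓑.inv f)), 𝔸.α (𝓑.etype (𝓑.inv f)) d = 𝔸.ω (𝓑.etype f) c ∧
      𝔸.ω (𝓑.etype (𝓑.inv f)) d = 𝔸.α (𝓑.etype f) c := by
  rw [𝓑.etype_inv]
  exact exists_inv_of_edge _ c

@[simp] theorem length_mu {u v : 𝓑.gog.V} (p : 𝓑.gog.Path u v) : (𝓑.mu p).length = p.length := by
  induction p with
  | nil a => rfl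
  | cons a f p ih => simp [mu, length, ih]

/-- Reduced `𝔹`-paths are mapped to reduced `𝔸`-paths when `𝓑` is folded. -/
theorem Folded.red_mu {𝓑 : AGraph.{u₁, u₂, u₃, u₄, u₅, u₆} 𝔸} (hF : 𝓑.Folded)
    {u v : 𝓑.gog.V} {p : 𝓑.gog.Path u v} (hp : p.Red) : (𝓑.mu p).Red := by
  induction p with
  | nil a => trivial
  | @cons u v w b f p ih =>
    refine ⟨?_, (red_lmul _ _).2 (ih hp.2)⟩
    rintro ⟨c, r, h⟩
    cases p with
    | nil b' => exact not_cancels_nil (𝓑.etype f) _ ⟨c, r, h⟩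
    | @cons _ x _ b' f' p =>
      obtain ⟨h1, h2⟩ := cons_eq_cons h
      rw [← 𝓑.etype_inv] at h2
      obtain ⟨d, hd, -⟩ := 𝓑.exists_edge_inv f c
      have h3 : (⟨u, 𝓑.inv f⟩ : Σ t, 𝓑.E v t) = ⟨x, f'⟩ := by
        by_contra hne
        refine hF.1 ⟨v, u, x, 𝓑.inv f, f', hne, h2.symm, (Subtype.val b')⁻¹,
          (𝓑.B v).inv_mem b'.2, d, ?_⟩
        rw [hd, ← h1, 𝓑.labα_inv]
        group
      cases h3
      rw [𝓑.labα_inv] at h1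
      have h4 : 𝓑.conjω f c = Subtype.val b' := by
        change (𝓑.labω f)⁻¹ * 𝔸.ω (𝓑.etype f) c * (𝓑.labω f)⁻¹⁻¹ = _
        rw [← h1]
        group
      have h5 : c ∈ 𝓑.edgeω f := by
        change 𝓑.conjω f c ∈ 𝓑.B v
        rw [h4]
        exact b'.2
      have h6 : 𝓑.edgeα f = 𝓑.edgeω f := by
        by_contra hne
        exact hF.2 ⟨_, _, f, hne⟩
      refine hp.1 ⟨⟨c, h6 ▸ h5, h5⟩, p, ?_⟩
      congr 1
      exact Subtype.ext h4.symm

theorem red_of_red_mu {u v : 𝓑.gog.V} {p : 𝓑.gog.Path u v} (hp : (𝓑.mu p).Red) : p.Red := by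
  induction p with
  | nil a => trivial
  | @cons u v w b f p ih =>
    refine ⟨?_, ih ((red_lmul _ _).1 hp.2)⟩
    rintro ⟨c, r, rfl⟩
    refine hp.1 ⟨c.1, (𝓑.mu r).lmul (𝓑.labω (𝓑.inv f)), ?_⟩
    have hc : (Subtype.val (𝓑.gog.ω f c) : 𝔸.A (𝓑.vtype v)) =
      (𝓑.labω f)⁻¹ * 𝔸.ω (𝓑.etype f) c.1 * ((𝓑.labω f)⁻¹)⁻¹ := rfl
    simp only [mu, lmul_cons, hc, 𝓑.etype_inv, 𝓑.labα_inv]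
    congr 1
    group

theorem mu_reverse {u v : 𝓑.gog.V} (p : 𝓑.gog.Path u v) :
    Sim (𝓑.mu p.reverse) (𝓑.mu p).reverse := by
  refine sim_reverse_of_comp ?_
  rw [← mu_comp]
  exact 𝓑.mu_sim (comp_reverse p)

variable {𝓑} (u₀ : 𝓑.V) {v₀ : 𝔸.V} (h₀ : 𝓑.vtype u₀ = v₀)

theorem Folded.nu_injective (hF : 𝓑.Folded) : Function.Injective (𝓑.nu u₀ h₀) := by
  subst h₀
  rw [injective_iff_map_eq_one]
  intro x hx
  induction x using Quotient.inductionOn with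
  | _ p =>
    obtain ⟨q, hq, hpq, -⟩ := exists_red p
    have h1 : Sim (𝓑.mu p) (nil 1) := Quotient.exact hx
    have h2 := (hF.red_mu hq).eq_nil_of_sim ((𝓑.mu_sim hpq).symm.trans h1)
    have h3 : q.length = 0 := by rw [← 𝓑.length_mu, h2]; rfl
    obtain ⟨b, rfl⟩ := eq_nil_of_length h3
    have h4 : Subtype.val b = 1 := by
      have h5 : (nil (Subtype.val b) : 𝔸.Path _ _) = nil 1 := h2
      simpa using h5
    have h6 : b = 1 := Subtype.ext h4
    subst h6
    exact Quotient.sound hpq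

theorem Folded.phi_injective (hF : 𝓑.Folded) : Function.Injective (𝓑.phi u₀ h₀) := by
  subst h₀
  rintro ⟨u, x⟩ ⟨w, y⟩ h
  induction x using Quotient.inductionOn with
  | _ p =>
  induction y using Quotient.inductionOn with
  | _ q =>
    have h1 : TreeVertex.mk (𝓑.mu p) = TreeVertex.mk (𝓑.mu q) := h
    obtain ⟨r, hr, hs, -⟩ := exists_red (q.reverse.comp p)
    have h2 : Sim ((𝓑.mu q).reverse.comp (𝓑.mu p)) (𝓑.mu r) := by
      have h3 := Sim.comp (𝓑.mu_reverse q).symm (Sim.refl (𝓑.mu p))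
      rw [← mu_comp] at h3
      exact h3.trans (𝓑.mu_sim hs)
    have h4 := TreeVertex.length_eq_zero_of_mk_eq h1 (hF.red_mu hr) h2
    rw [length_mu] at h4
    obtain ⟨rfl, -⟩ := exists_eq_nil_of_length h4
    obtain ⟨b, rfl⟩ := eq_nil_of_length h4
    refine TreeVertex.mk_eq b ?_
    have h5 := Sim.comp (Sim.refl q) hs
    have h6 := Sim.comp (comp_reverse q) (Sim.refl p)
    rw [comp_assoc] at h6
    simpa using h6.symm.trans h5

theorem phi_smul (x : 𝓑.gog.Pi1 u₀) :
    𝓑.phi u₀ h₀ (x • 𝓑.gog.treeBase u₀) = 𝓑.nu u₀ h₀ x • 𝔸.treeBase v₀ := by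
  subst h₀
  induction x using Quotient.inductionOn with
  | _ p =>
    have h1 : (Pi1.mk p : 𝓑.gog.Pi1 u₀) • 𝓑.gog.treeBase u₀ = TreeVertex.mk p :=
      Pi1.mk_smul_treeBase p
    exact (congrArg _ h1).trans (Pi1.mk_smul_treeBase (𝓑.mu p)).symm

/-- For a folded `𝔸`-graph in which every edge can be completed to a reduced path ending at the
base vertex, the image of the tree is the union of the segments from `x₀` to its translates. -/
theorem Folded.map_phi_eq_hull (hF : 𝓑.Folded)
    (hcore : ∀ (u v : 𝓑.V) (f : 𝓑.E u v), ∃ q : 𝓑.gog.Path v u₀,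
      (cons 1 f q : 𝓑.gog.Path u u₀).Red) :
    (⊤ : (𝓑.gog.tree u₀).Subgraph).map (𝓑.phi u₀ h₀) = hull (𝓑.nu u₀ h₀).range := by
  have hbase : 𝓑.phi u₀ h₀ (𝓑.gog.treeBase u₀) = 𝔸.treeBase v₀ := by subst h₀; rfl
  have hinj := hF.phi_injective u₀ h₀
  apply le_antisymm
  · have hprec : ∀ x y, Precedes x y →
        (hull (𝓑.nu u₀ h₀).range).Adj (𝓑.phi u₀ h₀ x) (𝓑.phi u₀ h₀ y) := by
      rintro _ _ ⟨v, w, p, a, f, hr, rfl, rfl⟩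
      obtain ⟨q, hq⟩ := hcore v w f
      obtain ⟨W, hW, he⟩ := exists_isPath_of_red_comp (hr.glue hq)
      have hle := toSubgraph_le_hull (U := (𝓑.nu u₀ h₀).range)
        (g := 𝓑.nu u₀ h₀ (Pi1.mk (p.comp (cons a f q)))) ⟨_, rfl⟩ hbase
        (by rw [← phi_smul, Pi1.mk_smul_treeBase]) (W.map (𝓑.phi u₀ h₀))
        (SimpleGraph.Walk.IsPath.map hinj hW)
      refine hle.2 ?_
      rw [SimpleGraph.Walk.adj_toSubgraph_iff_mem_edges, SimpleGraph.Walk.edges_map]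
      exact List.mem_map.2 ⟨_, he, rfl⟩
    have hadj : ∀ x y, (𝓑.gog.tree u₀).Adj x y →
        (hull (𝓑.nu u₀ h₀).range).Adj (𝓑.phi u₀ h₀ x) (𝓑.phi u₀ h₀ y) := by
      intro x y h
      rcases precedes_or h with h | h
      exacts [hprec x y h, (hprec y x h).symm]
    refine ⟨?_, ?_⟩
    · rintro _ ⟨x, -, rfl⟩
      by_cases hx : x = 𝓑.gog.treeBase u₀
      · subst hx
        have hle := toSubgraph_le_hull (U := (𝓑.nu u₀ h₀).range) (one_mem _) hbase
          (by rw [hbase, one_smul]) SimpleGraph.Walk.nil SimpleGraph.Walk.IsPath.nil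
        exact hle.1 (SimpleGraph.Walk.start_mem_verts_toSubgraph _)
      · obtain ⟨W⟩ := (tree_reachable_base x).symm
        cases W with
        | nil => exact absurd rfl hx
        | cons h W => exact (hadj _ _ h).fst_mem
    · rintro _ _ ⟨x, y, h, rfl, rfl⟩
      exact hadj x y h
  · refine iSup₂_le fun g hg => iSup₂_le fun W hW => ?_
    obtain ⟨y, rfl⟩ := hg
    obtain ⟨W', hW'⟩ := (tree_reachable_base (y • 𝓑.gog.treeBase u₀)).exists_isPath
    have h1 := SimpleGraph.Walk.IsPath.map hinj hW'
    have key : ∀ {a b c d : 𝔸.TreeVertex v₀} (hac : a = c) (hbd : b = d)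
        (P : (𝔸.tree v₀).Walk a b) (Q : (𝔸.tree v₀).Walk c d), P.IsPath → Q.IsPath →
        Q.toSubgraph = P.toSubgraph := by
      rintro a b _ _ rfl rfl P Q hP hQ
      have := (tree_isAcyclic v₀).subsingleton_path a b
      have h : P = Q := congrArg Subtype.val
        (Subsingleton.elim (⟨P, hP⟩ : (𝔸.tree v₀).Path a b) ⟨Q, hQ⟩)
      rw [h]
    rw [key hbase (phi_smul u₀ h₀ y) _ W h1 hW, SimpleGraph.Walk.toSubgraph_map]
    exact SimpleGraph.Subgraph.map_mono le_top

/-- Every class of closed paths contains a reduced one. -/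
theorem mk_image_language :
    Pi1.mk '' 𝓑.language u₀ h₀ = ((𝓑.nu u₀ h₀).range : Set (𝔸.Pi1 v₀)) := by
  subst h₀
  ext g
  constructor
  · rintro ⟨_, ⟨p, -, rfl⟩, rfl⟩
    exact ⟨Pi1.mk p, rfl⟩
  · rintro ⟨x, rfl⟩
    induction x using Quotient.inductionOn with
    | _ p =>
      obtain ⟨q, hq, hpq, -⟩ := exists_red p
      exact ⟨_, ⟨q, (reduced_iff_red q).2 hq, rfl⟩, Quotient.sound (𝓑.mu_sim hpq.symm)⟩

end AGraph

/-! ### Representations of the path groupoid -/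

namespace GraphOfGroups

variable {𝔸 : GraphOfGroups.{u₁, u₂, u₃, u₄}}

open _root_.GraphOfGroups.Path

/-- A representation of a graph of groups in a group `Γ`: homomorphisms of the vertex groups and
images of the edges that satisfy the defining relations of the path groupoid. -/
structure Rep (𝔸 : GraphOfGroups.{u₁, u₂, u₃, u₄}) (Γ : Type*) [Group Γ] where
  vert : ∀ v : 𝔸.V, 𝔸.A v →* Γ
  edge : ∀ {u v : 𝔸.V}, 𝔸.E u v → Γ
  edge_inv : ∀ {u v : 𝔸.V} (e : 𝔸.E u v), edge e * edge (𝔸.inv e) = 1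
  edge_mul : ∀ {u v : 𝔸.V} (e : 𝔸.E u v) (c : 𝔸.Ae e),
    edge e * vert v (𝔸.ω e c) = vert u (𝔸.α e c) * edge e

namespace Rep

variable {Γ Δ : Type*} [Group Γ] [Group Δ] (ρ : Rep 𝔸 Γ)

/-- The value of a path under a representation. -/
def val : ∀ {u v : 𝔸.V}, 𝔸.Path u v → Γ
  | _, _, nil a => ρ.vert _ a
  | _, _, cons a e p => ρ.vert _ a * (ρ.edge e * val p)

theorem val_lmul {u v : 𝔸.V} (a : 𝔸.A u) (p : 𝔸.Path u v) :
    ρ.val (p.lmul a) = ρ.vert u a * ρ.val p := by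
  cases p <;> simp [val, mul_assoc]

@[simp] theorem val_comp {u v w : 𝔸.V} (p : 𝔸.Path u v) (q : 𝔸.Path v w) :
    ρ.val (p.comp q) = ρ.val p * ρ.val q := by
  induction p with
  | nil a => exact ρ.val_lmul a q
  | cons a e p ih => simp [val, ih, mul_assoc]

theorem val_sim {u v : 𝔸.V} {p q : 𝔸.Path u v} (h : Sim p q) : ρ.val p = ρ.val q := by
  induction h with
  | basic a e c b =>
    have h1 := ρ.edge_mul e c
    have h2 := ρ.edge_inv e
    simp only [val, map_mul]
    rw [← mul_assoc (ρ.edge e), h1, mul_assoc _ (ρ.edge e), ← mul_assoc (ρ.edge e), h2]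
    simp [mul_assoc]
  | comp _ _ h1 h2 => rw [val_comp, val_comp, h1, h2]
  | refl p => rfl
  | symm _ h => exact h.symm
  | trans _ _ h1 h2 => exact h1.trans h2

/-- The homomorphism on the fundamental group induced by a representation. -/
def hom (v₀ : 𝔸.V) : 𝔸.Pi1 v₀ →* Γ where
  toFun := Quotient.lift (s := 𝔸.simSetoid v₀ v₀) (fun p => ρ.val p) fun _ _ h => ρ.val_sim h
  map_one' := map_one (ρ.vert v₀)
  map_mul' x y := by
    induction x using Quotient.inductionOn
    induction y using Quotient.inductionOn
    exact ρ.val_comp _ _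

@[simp] theorem hom_mk {v₀ : 𝔸.V} (p : 𝔸.Path v₀ v₀) : ρ.hom v₀ (Pi1.mk p) = ρ.val p := rfl

theorem map_val (ψ : Γ →* Δ) (σ : Rep 𝔸 Δ) (hv : ∀ v a, ψ (ρ.vert v a) = σ.vert v a)
    (he : ∀ {u v : 𝔸.V} (e : 𝔸.E u v), ψ (ρ.edge e) = σ.edge e) {u v : 𝔸.V} (p : 𝔸.Path u v) :
    ψ (ρ.val p) = σ.val p := by
  induction p with
  | nil a => exact hv _ a
  | cons a e p ih => simp [val, hv, he, ih]

end Rep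

theorem Pi1.mk_eq_iff {v₀ : 𝔸.V} {p q : 𝔸.Path v₀ v₀} : Pi1.mk p = Pi1.mk q ↔ Sim p q :=
  ⟨fun h => Quotient.exact h, fun h => Quotient.sound h⟩

theorem Pi1.mk_surjective {v₀ : 𝔸.V} (g : 𝔸.Pi1 v₀) : ∃ p, Pi1.mk p = g := by
  induction g using Quotient.inductionOn with
  | _ p => exact ⟨p, rfl⟩

section Conn

variable {v₀ : 𝔸.V} (c : ∀ v, 𝔸.Path v₀ v)

/-- A path made closed by means of a choice of paths from the base vertex. -/
def loop {u v : 𝔸.V} (p : 𝔸.Path u v) : 𝔸.Pi1 v₀ := Pi1.mk ((c u).comp (p.comp (c v).reverse))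

theorem loop_sim {u v : 𝔸.V} {p q : 𝔸.Path u v} (h : Sim p q) : loop c p = loop c q :=
  Pi1.mk_eq_iff.2 (Sim.comp (Sim.refl _) (Sim.comp h (Sim.refl _)))

theorem loop_comp {u v w : 𝔸.V} (p : 𝔸.Path u v) (q : 𝔸.Path v w) :
    loop c p * loop c q = loop c (p.comp q) := by
  refine Pi1.mk_eq_iff.2 ?_
  have h := Sim.comp (Sim.refl ((c u).comp p)) (Sim.comp (reverse_comp (c v))
    (Sim.refl (q.comp (c w).reverse)))
  simpa [comp_assoc] using h

theorem loop_one (v : 𝔸.V) : loop c (nil (1 : 𝔸.A v)) = 1 := by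
  refine Pi1.mk_eq_iff.2 ?_
  simpa using comp_reverse (c v)

theorem sim_of_loop_eq {u v : 𝔸.V} {p q : 𝔸.Path u v} (h : loop c p = loop c q) : Sim p q := by
  have key : ∀ p : 𝔸.Path u v,
      Sim ((c u).reverse.comp (((c u).comp (p.comp (c v).reverse)).comp (c v))) p := by
    intro p
    have h := Sim.comp (reverse_comp (c u)) (Sim.comp (Sim.refl p) (reverse_comp (c v)))
    simpa [comp_assoc] using h
  exact ((key p).symm.trans (Sim.comp (Sim.refl _)
    (Sim.comp (Pi1.mk_eq_iff.1 h) (Sim.refl _)))).trans (key q)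

/-- The representation of a connected graph of groups in its fundamental group. -/
def loopRep : Rep 𝔸 (𝔸.Pi1 v₀) where
  vert v :=
    { toFun := fun a => loop c (nil a)
      map_one' := loop_one c v
      map_mul' := fun a b => by rw [loop_comp]; rfl }
  edge e := loop c (cons 1 e (nil 1))
  edge_inv e := by
    rw [loop_comp, ← loop_one c]
    refine loop_sim c ?_
    simpa using sim_edge_inv e
  edge_mul {u v} e d := by
    change loop c _ * loop c _ = loop c _ * loop c _
    rw [loop_comp, loop_comp]
    refine loop_sim c ?_
    simpa using (Slide.step (p := nil 1) 1 e d (Slide.refl _)).sim.symm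

theorem val_loopRep {u v : 𝔸.V} (p : 𝔸.Path u v) : (loopRep c).val p = loop c p := by
  induction p with
  | nil a => rfl
  | cons a e p ih =>
    change loop c _ * (loop c _ * _) = _
    rw [ih, loop_comp, loop_comp]
    simp

end Conn

/-! ### The word problem for paths -/

namespace Marking

variable (M : 𝔸.Marking)

/-- The numbers of the letters standing for the generators of the vertex groups. -/
def vletter (n i : ℕ) : ℕ := 2 * Nat.pair n i

/-- The numbers of the letters standing for the edges. -/
def eletter (n : ℕ) : ℕ := 2 * n + 1

/-- A word in the generators of the vertex group with number `n`, in the common alphabet. -/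
def vword (n : ℕ) (w : Word) : Word := w.map fun l => (vletter n l.1, l.2)

theorem exists_word (v : 𝔸.V) (a : 𝔸.A v) : ∃ w, M.vval v w = a := by
  obtain ⟨R, -, hR, -⟩ := M.vpres v
  have h : a ∈ Subgroup.closure {g | g ∈ M.vgen v} := by rw [hR]; trivial
  exact (mem_closure_iff_wordVal _ _).1 h

/-- A word representing a given element of a vertex group. -/
noncomputable def wordOf (v : 𝔸.V) (a : 𝔸.A v) : Word := (M.exists_word v a).choose

@[simp] theorem vval_wordOf (v : 𝔸.V) (a : 𝔸.A v) : M.vval v (M.wordOf v a) = a :=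
  (M.exists_word v a).choose_spec

/-- The relators of the vertex group `A_v`. -/
def vrel (v : 𝔸.V) : Set Word := (M.vpres v).choose

theorem vrel_re (v : 𝔸.V) : IsRE fun w => w ∈ M.vrel v :=
  IsRE.of_rePred (M.vpres v).choose_spec.1

theorem vrel_pres (v : 𝔸.V) : IsPresentation ⊤ (M.vgen v) (M.vrel v) :=
  (M.vpres v).choose_spec.2

/-- The relator expressing that `e ω_e(c) e⁻¹ = α_e(c)` for the `i`-th generator `c` of `A_e`. -/
noncomputable def edgeRelator {u v : 𝔸.V} (e : 𝔸.E u v) (i : ℕ) : Word :=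
  (eletter (M.enum ⟨u, v, e⟩), true) ::
    (vword (M.vnum v) (M.wordOf v (𝔸.ω e ((M.egen e).getD i 1))) ++
      (eletter (M.enum ⟨u, v, e⟩), false) ::
        FreeGroup.invRev (vword (M.vnum u) (M.wordOf u (𝔸.α e ((M.egen e).getD i 1)))))

/-- Defining relators, in the common alphabet, for the group generated by the vertex groups and the
edges in which the relations of the path groupoid hold.  Letters `x_{v,i}` without a corresponding
generator are killed. -/
def relators : Set Word :=
  {w | (∃ v, ∃ r ∈ M.vrel v, w = vword (M.vnum v) r) ∨
    (∃ v, ∃ i, (M.vgen v).length ≤ i ∧ w = [(vletter (M.vnum v) i, true)]) ∨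
    (∃ t : Σ u v : 𝔸.V, 𝔸.E u v, w = [(eletter (M.enum t), true),
      (eletter (M.enum ⟨t.2.1, t.1, 𝔸.inv t.2.2⟩), true)]) ∨
    ∃ t : Σ u v : 𝔸.V, 𝔸.E u v, ∃ i : Fin (M.egen t.2.2).length, w = M.edgeRelator t.2.2 i}

theorem primrec_vletter : Primrec₂ vletter :=
  Primrec.nat_double.comp Primrec₂.natPair

theorem primrec_eletter : Primrec eletter := Primrec.nat_double_succ

theorem primrec_vword : Primrec₂ vword :=
  Primrec.list_map Primrec.snd (Primrec.pair
    (primrec_vletter.comp (Primrec.fst.comp Primrec.fst) (Primrec.fst.comp Primrec.snd))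
    (Primrec.snd.comp Primrec.snd))

theorem relators_re (hM : M.Benign) : IsRE fun w => w ∈ M.relators := by
  have := hM.finite_vertices
  have := hM.finite_edges
  refine IsRE.or ?_ (IsRE.or ?_ (IsRE.or ?_ ?_))
  · refine IsRE.exists_finite fun v => IsRE.ex (IsRE.and ((M.vrel_re v).comp Primrec.snd) ?_)
    exact IsRE.eq Primrec.fst (primrec_vword.comp (Primrec.const _) Primrec.snd)
  · refine IsRE.exists_finite fun v => IsRE.ex (IsRE.and
      (IsRE.of_primrecPred (Primrec.nat_le.comp (Primrec.const _) Primrec.snd)) ?_)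
    exact IsRE.eq Primrec.fst (Primrec.list_cons.comp (Primrec.pair
      (primrec_vletter.comp (Primrec.const _) Primrec.snd) (Primrec.const _)) (Primrec.const _))
  · exact IsRE.exists_finite fun t => IsRE.eq Primrec.id (Primrec.const _)
  · exact IsRE.exists_finite fun t => IsRE.exists_finite fun i =>
      IsRE.eq Primrec.id (Primrec.const _)

/-- The group generated by the vertex groups and the edges. -/
abbrev Amb : Type := WordGroup M.relators

/-- The value of a word of the common alphabet. -/
def wval (w : Word) : M.Amb := WordGroup.val M.relators w

theorem wval_vword (n : ℕ) (w : Word) : M.wval (vword n w) =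
    evalWord (fun i => M.wval [(vletter n i, true)]) w := by
  rw [wval, WordGroup.val, vword, evalWord_map_letter]
  exact evalWord_congr (fun i => by simp [wval, WordGroup.val]) w

@[simp] theorem wval_append (w w' : Word) : M.wval (w ++ w') = M.wval w * M.wval w' :=
  evalWord_append (fun i => (FreeGroup.of i : M.Amb)) _ _

@[simp] theorem wval_nil : M.wval [] = 1 := rfl

@[simp] theorem wval_invRev (w : Word) : M.wval (FreeGroup.invRev w) = (M.wval w)⁻¹ :=
  evalWord_invRev (fun i => (FreeGroup.of i : M.Amb)) _

theorem wval_cons_true (i : ℕ) (w : Word) :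
    M.wval ((i, true) :: w) = M.wval [(i, true)] * M.wval w :=
  M.wval_append [(i, true)] w

theorem wval_cons_false (i : ℕ) (w : Word) :
    M.wval ((i, false) :: w) = (M.wval [(i, true)])⁻¹ * M.wval w := by
  rw [← wval_invRev]
  exact M.wval_append [(i, false)] w

theorem exists_vertHom (v : 𝔸.V) : ∃ h : 𝔸.A v →* M.Amb,
    ∀ w, h (M.vval v w) = M.wval (vword (M.vnum v) w) := by
  obtain ⟨h, hh⟩ := (M.vrel_pres v).exists_hom
    (fun i => M.wval [(vletter (M.vnum v) i, true)])
    (fun i hi => WordGroup.val_of_mem (Or.inr (Or.inl ⟨v, i, hi, rfl⟩)))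
    (fun r hr => by
      rw [← wval_vword]
      exact WordGroup.val_of_mem (Or.inl ⟨v, r, hr, rfl⟩))
  refine ⟨h.comp Subgroup.topEquiv.symm.toMonoidHom, fun w => ?_⟩
  rw [wval_vword]
  exact hh w trivial

/-- The canonical representation of `𝔸` in the group generated by the vertex groups and the
edges. -/
noncomputable def rep : Rep 𝔸 M.Amb where
  vert v := (M.exists_vertHom v).choose
  edge {u v} e := M.wval [(eletter (M.enum ⟨u, v, e⟩), true)]
  edge_inv {u v} e := by
    rw [← wval_append]
    exact WordGroup.val_of_mem (Or.inr (Or.inr (Or.inl ⟨⟨u, v, e⟩, rfl⟩)))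
  edge_mul {u v} e c := by
    set t := M.wval [(eletter (M.enum ⟨u, v, e⟩), true)] with ht
    have key : ((MulAut.conj t).toMonoidHom.comp (M.exists_vertHom v).choose).comp (𝔸.ω e) =
        (M.exists_vertHom u).choose.comp (𝔸.α e) := by
      obtain ⟨R, -, hR, -⟩ := M.epres e
      refine MonoidHom.eq_of_eqOn_dense hR ?_
      intro c hc
      obtain ⟨i, hi, rfl⟩ := List.mem_iff_getElem.1 hc
      have h1 : M.wval (M.edgeRelator e i) = 1 :=
        WordGroup.val_of_mem (Or.inr (Or.inr (Or.inr ⟨⟨u, v, e⟩, ⟨i, hi⟩, rfl⟩)))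
      have h2 : (M.egen e).getD i 1 = (M.egen e)[i] := by simp [hi]
      rw [edgeRelator, wval_cons_true, wval_append, wval_cons_false, wval_invRev,
        ← (M.exists_vertHom v).choose_spec, ← (M.exists_vertHom u).choose_spec, vval_wordOf,
        vval_wordOf, h2, ← ht] at h1
      simp only [MonoidHom.comp_apply, MulEquiv.coe_toMonoidHom, MulAut.conj_apply]
      rw [← mul_inv_eq_one, ← h1]
      group
    have h3 := DFunLike.congr_fun key c
    simp only [MonoidHom.comp_apply, MulEquiv.coe_toMonoidHom, MulAut.conj_apply] at h3
    rw [← h3]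
    group

theorem rep_vert_vval (v : 𝔸.V) (w : Word) :
    M.rep.vert v (M.vval v w) = M.wval (vword (M.vnum v) w) :=
  (M.exists_vertHom v).choose_spec w

theorem rep_edge {u v : 𝔸.V} (e : 𝔸.E u v) :
    M.rep.edge e = M.wval [(eletter (M.enum ⟨u, v, e⟩), true)] := rfl

end Marking

end GraphOfGroups

theorem IsPresentation.wordVal_eq_one {G : Type*} [Group G] {K : Subgroup G} {z : List G}
    {R : Set Word} (hp : IsPresentation K z R) {r : Word} (hr : r ∈ R) : wordVal z r = 1 := by
  have h : wordVal (List.ofFn (FreeGroup.of (α := Fin z.length))) r ∈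
      (FreeGroup.lift z.get).ker := by
    rw [hp.2]
    exact Subgroup.subset_normalClosure ⟨r, hr, rfl⟩
  rw [MonoidHom.mem_ker, wordVal_eq_evalWord, map_evalWord] at h
  rw [← h, wordVal_eq_evalWord]
  refine evalWord_congr (fun i => ?_) r
  by_cases hi : i < z.length
  · simp [List.getD_eq_getElem?_getD, hi]
  · simp [List.getD_eq_getElem?_getD, hi]

namespace GraphOfGroups

variable {𝔸 : GraphOfGroups.{u₁, u₂, u₃, u₄}}

open _root_.GraphOfGroups.Path

namespace Marking

variable (M : 𝔸.Marking)

open Classical in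
/-- The elements of the fundamental group that correspond to the letters of the common alphabet. -/
noncomputable def letterVal {v₀ : 𝔸.V} (c : ∀ v, 𝔸.Path v₀ v) (n : ℕ) : 𝔸.Pi1 v₀ :=
  if h : ∃ x : 𝔸.V × ℕ, n = vletter (M.vnum x.1) x.2 then
    loop c (nil ((M.vgen h.choose.1).getD h.choose.2 1))
  else if h : ∃ t : Σ u v : 𝔸.V, 𝔸.E u v, n = eletter (M.enum t) then
    loop c (cons 1 h.choose.2.2 (nil 1))
  else 1

theorem letterVal_vletter {v₀ : 𝔸.V} (c : ∀ v, 𝔸.Path v₀ v) (v : 𝔸.V) (i : ℕ) :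
    M.letterVal c (vletter (M.vnum v) i) = loop c (nil ((M.vgen v).getD i 1)) := by
  have h : ∃ x : 𝔸.V × ℕ, vletter (M.vnum v) i = vletter (M.vnum x.1) x.2 := ⟨(v, i), rfl⟩
  rw [letterVal, dif_pos h]
  have hs := h.choose_spec
  generalize h.choose = x at hs
  obtain ⟨w, j⟩ := x
  have h1 : Nat.pair (M.vnum v) i = Nat.pair (M.vnum w) j := by
    simpa [vletter] using hs
  obtain ⟨h2, rfl⟩ := Nat.pair_eq_pair.1 h1
  obtain rfl := M.vnum.injective h2
  rfl

theorem letterVal_eletter {v₀ : 𝔸.V} (c : ∀ v, 𝔸.Path v₀ v) {u v : 𝔸.V} (e : 𝔸.E u v) :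
    M.letterVal c (eletter (M.enum ⟨u, v, e⟩)) = loop c (cons 1 e (nil 1)) := by
  have h0 : ¬ ∃ x : 𝔸.V × ℕ, eletter (M.enum ⟨u, v, e⟩) = vletter (M.vnum x.1) x.2 := by
    rintro ⟨x, hx⟩
    simp only [eletter, vletter] at hx
    omega
  have h : ∃ t : Σ u v : 𝔸.V, 𝔸.E u v, eletter (M.enum ⟨u, v, e⟩) = eletter (M.enum t) := ⟨_, rfl⟩
  rw [letterVal, dif_neg h0, dif_pos h]
  have hs := h.choose_spec
  generalize h.choose = t at hs
  have h1 : M.enum ⟨u, v, e⟩ = M.enum t := by simpa [eletter] using hs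
  obtain rfl := M.enum.injective h1
  rfl

theorem evalWord_letterVal_vword {v₀ : 𝔸.V} (c : ∀ v, 𝔸.Path v₀ v) (v : 𝔸.V) (w : Word) :
    evalWord (M.letterVal c) (vword (M.vnum v) w) = (loopRep c).vert v (M.vval v w) := by
  rw [vword, evalWord_map_letter, vval, wordVal_eq_evalWord, map_evalWord]
  exact evalWord_congr (fun i => M.letterVal_vletter c v i) w

theorem evalWord_letterVal_relators {v₀ : 𝔸.V} (c : ∀ v, 𝔸.Path v₀ v) {r : Word}
    (hr : r ∈ M.relators) : evalWord (M.letterVal c) r = 1 := by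
  rcases hr with ⟨v, r, hr, rfl⟩ | ⟨v, i, hi, rfl⟩ | ⟨⟨u, v, e⟩, rfl⟩ | ⟨⟨u, v, e⟩, i, rfl⟩
  · rw [evalWord_letterVal_vword, vval, (M.vrel_pres v).wordVal_eq_one hr, map_one]
  · have h : (M.vgen v).getD i 1 = 1 := by simp [List.getD_eq_getElem?_getD, hi]
    rw [evalWord_cons, evalWord_nil, mul_one, letterVal_vletter, h, loop_one]
    rfl
  · have h := (loopRep c).edge_inv e
    simp only [evalWord_cons, letterVal_eletter, evalWord_nil, mul_one, if_true]
    exact h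
  · have h := (loopRep c).edge_mul e ((M.egen e).getD i 1)
    simp only [edgeRelator, evalWord_cons, evalWord_append, letterVal_eletter, if_true,
      evalWord_letterVal_vword, vval_wordOf, evalWord_invRev]
    change (loopRep c).edge e * (_ * ((if false = true then _ else ((loopRep c).edge e)⁻¹) * _)) = 1
    rw [← mul_assoc, h]
    simp

/-- Equality in the ambient group of paths with the same endpoints is equivalence of paths. -/
theorem rep_val_eq_iff (hM : M.Benign) {u v : 𝔸.V} {p q : 𝔸.Path u v} :
    M.rep.val p = M.rep.val q ↔ Sim p q := by
  refine ⟨fun h => ?_, fun h => M.rep.val_sim h⟩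
  have hc : ∀ w, Nonempty (𝔸.Path u w) := by
    intro w
    induction hM.connected u w with
    | refl => exact ⟨nil 1⟩
    | tail _ h ih =>
      obtain ⟨p⟩ := ih
      obtain ⟨e⟩ := h
      exact ⟨p.comp (cons 1 e (nil 1))⟩
  let c : ∀ w, 𝔸.Path u w := fun w => (hc w).some
  let ψ : M.Amb →* 𝔸.Pi1 u := WordGroup.lift (M.letterVal c)
    fun r hr => M.evalWord_letterVal_relators c hr
  have h1 : ∀ p : 𝔸.Path u v, ψ (M.rep.val p) = loop c p := by
    intro p
    rw [← val_loopRep]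
    refine M.rep.map_val ψ (loopRep c) (fun w a => ?_) (fun {x y} e => ?_) p
    · rw [← M.vval_wordOf w a, rep_vert_vval, ← evalWord_letterVal_vword]
      exact WordGroup.lift_val _ _ _
    · refine (WordGroup.lift_val _ _ _).trans ?_
      simp [letterVal_eletter, loopRep]
  exact sim_of_loop_eq c (by rw [← h1, ← h1, h])

theorem rep_vert_injective (hM : M.Benign) (v : 𝔸.V) : Function.Injective (M.rep.vert v) :=
  fun _ _ h => nil_sim_nil ((M.rep_val_eq_iff hM).1 h)

theorem rep_hom_injective (hM : M.Benign) (v₀ : 𝔸.V) : Function.Injective (M.rep.hom v₀) := by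
  intro x y h
  obtain ⟨p, rfl⟩ := Pi1.mk_surjective x
  obtain ⟨q, rfl⟩ := Pi1.mk_surjective y
  exact Pi1.mk_eq_iff.2 ((M.rep_val_eq_iff hM).1 h)

end Marking

end GraphOfGroups

/-! ### The covering `𝔸`-graph of a subgroup -/

/-- An involution that respects an equivalence relation and fixes no class admits an invariant
transversal: in each pair of classes that are interchanged a representative is chosen from the
smaller class, with respect to some well-ordering. -/
theorem exists_invariant_transversal {X : Type*} (s : Setoid X) (i : X → X)
    (hi : ∀ x, i (i x) = x) (hs : ∀ x y, s x y → s (i x) (i y)) (hne : ∀ x, ¬ s x (i x)) :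
    ∃ K : Set X, (∀ x ∈ K, i x ∈ K) ∧ (∀ x ∈ K, ∀ y ∈ K, s x y → x = y) ∧
      ∀ x, ∃ y ∈ K, s y x := by
  let r : Quotient s → Quotient s → Prop := WellOrderingRel
  let mk : X → Quotient s := Quotient.mk s
  have hmk : ∀ {x y}, s x y ↔ mk x = mk y := fun {x y} => (Quotient.eq (r := s)).symm
  have hout : ∀ q : Quotient s, mk q.out = q := fun q => Quotient.out_eq q
  have hasymm : ∀ a b, r a b → ¬ r b a := fun a b h h' => asymm_of WellOrderingRel h h'
  refine ⟨{x | (r (mk x) (mk (i x)) ∧ x = (mk x).out) ∨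
    (r (mk (i x)) (mk x) ∧ i x = (mk (i x)).out)}, ?_, ?_, ?_⟩
  · intro x hx
    simpa only [Set.mem_ofPred_eq, hi] using hx.symm
  · intro x hx y hy hxy
    have h1 := hmk.1 hxy
    have h2 := hmk.1 (hs x y hxy)
    rcases hx with ⟨hx, hx'⟩ | ⟨hx, hx'⟩ <;> rcases hy with ⟨hy, hy'⟩ | ⟨hy, hy'⟩
    · rw [hx', hy', h1]
    · rw [← h1, ← h2] at hy
      exact absurd hx (hasymm _ _ hy)
    · rw [← h1, ← h2] at hy
      exact absurd hx (hasymm _ _ hy)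
    · rw [← hi x, ← hi y, hx', hy', h2]
  · intro x
    rcases trichotomous_of WellOrderingRel (mk x) (mk (i x)) with h | h | h
    · have h1 : s (mk x).out x := hmk.2 (hout _)
      refine ⟨(mk x).out, Or.inl ?_, h1⟩
      rw [hmk.1 (hs _ _ h1), hout]
      exact ⟨h, rfl⟩
    · exact absurd (hmk.2 h) (hne x)
    · have h1 : s (mk (i x)).out (i x) := hmk.2 (hout _)
      have h2 := hs _ _ h1
      rw [hi] at h2
      refine ⟨i (mk (i x)).out, Or.inr ?_, h2⟩
      rw [hi, hmk.1 h2, hout]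
      exact ⟨h, rfl⟩

namespace GraphOfGroups

variable {𝔸 : GraphOfGroups.{u₁, u₂, u₃, u₄}}

open _root_.GraphOfGroups.Path

namespace Rep

variable {Γ : Type u₅} [Group Γ] (ρ : Rep 𝔸 Γ) (U : Subgroup Γ)

theorem edge_inv' {u v : 𝔸.V} (e : 𝔸.E u v) : ρ.edge (𝔸.inv e) = (ρ.edge e)⁻¹ :=
  eq_inv_of_mul_eq_one_right (ρ.edge_inv e)

/-- The double cosets `U \ Γ / K`. -/
def dcoset (K : Subgroup Γ) : Setoid Γ where
  r g g' := ∃ k ∈ K, g * k * g'⁻¹ ∈ U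
  iseqv := by
    refine ⟨fun g => ⟨1, K.one_mem, by simp⟩, ?_, ?_⟩
    · rintro g g' ⟨k, hk, h⟩
      refine ⟨k⁻¹, K.inv_mem hk, ?_⟩
      have := U.inv_mem h
      simpa [mul_assoc] using this
    · rintro g g' g'' ⟨k, hk, h⟩ ⟨k', hk', h'⟩
      refine ⟨k * k', K.mul_mem hk hk', ?_⟩
      have := U.mul_mem h h'
      simpa [mul_assoc] using this

/-- The vertices of the covering `𝔸`-graph: the double cosets `U g A_v`. -/
abbrev CoverVertex : Type (max u₁ u₅) := Σ v : 𝔸.V, Quotient (dcoset U (ρ.vert v).range)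

/-- The base vertex. -/
def coverBase (v₀ : 𝔸.V) : ρ.CoverVertex U := ⟨v₀, Quotient.mk _ 1⟩

variable (v₀ : 𝔸.V)

open Classical in
/-- Representatives of the double cosets; the base vertex is represented by `1`. -/
noncomputable def coverRep (x : ρ.CoverVertex U) : Γ :=
  if x = ρ.coverBase U v₀ then 1 else x.2.out

theorem mk_coverRep (x : ρ.CoverVertex U) :
    Quotient.mk (dcoset U (ρ.vert x.1).range) (ρ.coverRep U v₀ x) = x.2 := by
  unfold coverRep
  split_ifs with h
  · subst h
    rfl
  · exact Quotient.out_eq _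

theorem coverRep_base : ρ.coverRep U v₀ (ρ.coverBase U v₀) = 1 := if_pos rfl

theorem coverVertex_ext {x y : ρ.CoverVertex U} (h : x.1 = y.1) {a : 𝔸.A y.1}
    (ha : ρ.coverRep U v₀ x * ρ.vert y.1 a * (ρ.coverRep U v₀ y)⁻¹ ∈ U) : x = y := by
  have hx := ρ.mk_coverRep U v₀ x
  have hy := ρ.mk_coverRep U v₀ y
  generalize ρ.coverRep U v₀ x = g at *
  generalize ρ.coverRep U v₀ y = g' at *
  obtain ⟨v, x⟩ := x
  obtain ⟨w, y⟩ := y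
  obtain rfl : v = w := h
  have hs : dcoset U (ρ.vert v).range g g' := ⟨_, ⟨a, rfl⟩, ha⟩
  exact congrArg (Sigma.mk v) (hx.symm.trans ((Quotient.sound hs).trans hy))

/-- All possible edges `x → y` of the covering `𝔸`-graph with their labels: triples `(a, e, k)` such
that `a e k` leads from the coset of `x` to the coset of `y`. -/
def Triple (x y : ρ.CoverVertex U) : Type (max u₂ u₃) :=
  {t : 𝔸.E x.1 y.1 × 𝔸.A x.1 × 𝔸.A y.1 //
    ρ.coverRep U v₀ x * (ρ.vert _ t.2.1 * (ρ.edge t.1 * ρ.vert _ t.2.2)) *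
      (ρ.coverRep U v₀ y)⁻¹ ∈ U}

variable {v₀} {U} {ρ}

/-- The inverse triple. -/
def Triple.inv {x y : ρ.CoverVertex U} (t : ρ.Triple U v₀ x y) : ρ.Triple U v₀ y x :=
  ⟨(𝔸.inv t.1.1, t.1.2.2⁻¹, t.1.2.1⁻¹), by
    have h := U.inv_mem t.2
    simpa [mul_assoc, edge_inv'] using h⟩

theorem Triple.inv_inv {x y : ρ.CoverVertex U} (t : ρ.Triple U v₀ x y) : t.inv.inv = t := by
  refine Subtype.ext ?_
  simp [Triple.inv, 𝔸.inv_inv]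

variable (v₀ U ρ) in
/-- All triples. -/
abbrev AnyTriple : Type (max u₁ u₂ u₃ u₅) := Σ x y : ρ.CoverVertex U, ρ.Triple U v₀ x y

variable (U ρ) in
/-- The edges of the quotient of the tree by `U`: double cosets `U g α_e(A_e)`. -/
abbrev EdgeOrbit : Type (max u₁ u₂ u₅) :=
  Σ t : (Σ u v : 𝔸.V, 𝔸.E u v), Quotient (dcoset U ((ρ.vert t.1).comp (𝔸.α t.2.2)).range)

/-- The edge orbit of a triple. -/
noncomputable def AnyTriple.orbit (t : ρ.AnyTriple U v₀) : ρ.EdgeOrbit U :=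
  ⟨⟨t.1.1, t.2.1.1, t.2.2.1.1⟩, Quotient.mk _ (ρ.coverRep U v₀ t.1 * ρ.vert _ t.2.2.1.2.1)⟩

/-- The inverse edge orbit. -/
def EdgeOrbit.inv (t : ρ.EdgeOrbit U) : ρ.EdgeOrbit U :=
  ⟨⟨t.1.2.1, t.1.1, 𝔸.inv t.1.2.2⟩, Quotient.map (fun g => g * ρ.edge t.1.2.2) (by
    rintro g g' ⟨_, ⟨c, rfl⟩, h⟩
    obtain ⟨d, hd, -⟩ := exists_inv_of_edge t.1.2.2 c
    refine ⟨_, ⟨d, rfl⟩, ?_⟩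
    have h1 := ρ.edge_mul t.1.2.2 c
    rw [MonoidHom.comp_apply] at h ⊢
    rw [hd, mul_assoc g, h1]
    simpa [mul_assoc] using h) t.2⟩

theorem AnyTriple.orbit_inv (t : ρ.AnyTriple U v₀) :
    AnyTriple.orbit (⟨t.2.1, t.1, t.2.2.inv⟩ : ρ.AnyTriple U v₀) = EdgeOrbit.inv t.orbit := by
  obtain ⟨x, y, ⟨⟨e, a, k⟩, ht⟩⟩ := t
  refine congrArg (Sigma.mk _) (Quotient.sound ⟨1, Subgroup.one_mem _, ?_⟩)
  have h := U.inv_mem ht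
  simpa [mul_assoc, Triple.inv, AnyTriple.orbit] using h

theorem AnyTriple.orbit_ne_inv (t : ρ.AnyTriple U v₀) : t.orbit ≠ EdgeOrbit.inv t.orbit := by
  intro h
  have h1 : (⟨t.1.1, t.2.1.1, t.2.2.1.1⟩ : Σ u v : 𝔸.V, 𝔸.E u v) =
      ⟨t.2.1.1, t.1.1, 𝔸.inv t.2.2.1.1⟩ := congrArg Sigma.fst h
  generalize t.2.2.1.1 = e at h1
  generalize t.1.1 = u at e h1
  generalize t.2.1.1 = v at e h1
  obtain rfl : u = v := congrArg Sigma.fst h1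
  simp only [Sigma.mk.injEq, heq_eq_eq, true_and] at h1
  exact 𝔸.inv_ne e h1.symm

variable (v₀ U ρ) in
theorem exists_coverEdges : ∃ K : Set (ρ.AnyTriple U v₀),
    (∀ t ∈ K, ⟨t.2.1, t.1, t.2.2.inv⟩ ∈ K) ∧ (∀ t ∈ K, ∀ t' ∈ K, t.orbit = t'.orbit → t = t') ∧
      ∀ t : ρ.AnyTriple U v₀, ∃ t' ∈ K, t'.orbit = t.orbit := by
  refine exists_invariant_transversal (Setoid.ker AnyTriple.orbit)
    (fun t => ⟨t.2.1, t.1, t.2.2.inv⟩) ?_ ?_ ?_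
  · rintro ⟨x, y, t⟩
    simp [Triple.inv_inv]
  · intro t t' h
    have h' : t.orbit = t'.orbit := h
    change AnyTriple.orbit _ = AnyTriple.orbit _
    rw [AnyTriple.orbit_inv, AnyTriple.orbit_inv, h']
  · intro t h
    have h' : t.orbit = AnyTriple.orbit _ := h
    rw [AnyTriple.orbit_inv] at h'
    exact t.orbit_ne_inv h'

variable (v₀ U ρ) in
/-- A choice of one labelled edge for each edge orbit, compatible with inversion. -/
def coverEdges : Set (ρ.AnyTriple U v₀) := (exists_coverEdges ρ U v₀).choose

variable (v₀ U ρ) in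
/-- The covering `𝔸`-graph of `U`: the quotient of the Bass–Serre tree by `U`, with the stabilizers
as vertex groups. -/
noncomputable abbrev cover : AGraph.{u₁, u₂, u₃, u₄, max u₁ u₅, max u₂ u₃} 𝔸 where
  V := ρ.CoverVertex U
  E x y := {t : ρ.Triple U v₀ x y // ⟨x, y, t⟩ ∈ coverEdges ρ U v₀}
  inv t := ⟨t.1.inv, (exists_coverEdges ρ U v₀).choose_spec.1 _ t.2⟩
  inv_inv t := Subtype.ext t.1.inv_inv
  inv_ne t h := 𝔸.inv_ne t.1.1.1 (congrArg (fun s => s.1.1.1) h)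
  vtype x := x.1
  etype t := t.1.1.1
  etype_inv _ := rfl
  B x := U.comap ((MulAut.conj (ρ.coverRep U v₀ x)).toMonoidHom.comp (ρ.vert x.1))
  labα t := t.1.1.2.1
  labω t := t.1.1.2.2
  labα_inv _ := rfl

theorem mem_cover_B {x : (cover ρ U v₀).V} {a : 𝔸.A x.1} : a ∈ (cover ρ U v₀).B x ↔
    ρ.coverRep U v₀ x * ρ.vert x.1 a * (ρ.coverRep U v₀ x)⁻¹ ∈ U := Iff.rfl

theorem cover_edge_mem {x y : (cover ρ U v₀).V} (f : (cover ρ U v₀).E x y) :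
    ρ.coverRep U v₀ x * (ρ.vert _ ((cover ρ U v₀).labα f) *
      (ρ.edge ((cover ρ U v₀).etype f) * ρ.vert _ ((cover ρ U v₀).labω f))) *
      (ρ.coverRep U v₀ y)⁻¹ ∈ U := f.1.2

/-- Edges of the same type whose first labels differ by the vertex group and the edge group have
the same orbit. -/
theorem orbit_eq_of_label {u v v' : 𝔸.V} {e : 𝔸.E u v} {e' : 𝔸.E u v'} {a₁ a₂ a : 𝔸.A u} {g : Γ}
    (htyp : (⟨v, e⟩ : Σ t, 𝔸.E u t) = ⟨v', e'⟩) (ha : g * ρ.vert u a * g⁻¹ ∈ U) (c : 𝔸.Ae e)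
    (hc : a₂ = a * a₁ * 𝔸.α e c) :
    (⟨⟨u, v, e⟩, Quotient.mk _ (g * ρ.vert u a₁)⟩ : ρ.EdgeOrbit U) =
      ⟨⟨u, v', e'⟩, Quotient.mk _ (g * ρ.vert u a₂)⟩ := by
  cases htyp
  refine congrArg (Sigma.mk _) (Quotient.sound ⟨_, ⟨c, rfl⟩, ?_⟩)
  have := U.inv_mem ha
  simpa [mul_assoc, hc] using this

theorem conj_mem_iff {g g' A E K w α' : Γ} (h : g * (A * (E * K)) * g'⁻¹ ∈ U)
    (hα : α' = E * w * E⁻¹) :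
    g * (A * α' * A⁻¹) * g⁻¹ ∈ U ↔ g' * (K⁻¹ * w * K) * g'⁻¹ ∈ U := by
  have h1 : g * (A * α' * A⁻¹) * g⁻¹ = g * (A * (E * K)) * g'⁻¹ * (g' * (K⁻¹ * w * K) * g'⁻¹) *
      (g * (A * (E * K)) * g'⁻¹)⁻¹ := by
    subst hα
    group
  rw [h1, Subgroup.mul_mem_cancel_right U (U.inv_mem h), Subgroup.mul_mem_cancel_left U h]

theorem cover_folded : (cover ρ U v₀).Folded := by
  refine ⟨?_, ?_⟩
  · rintro ⟨z, x, y, f₁, f₂, hne, htyp, a, ha, c, hc⟩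
    have h1 : AnyTriple.orbit (⟨z, x, f₁.1⟩ : ρ.AnyTriple U v₀) =
        AnyTriple.orbit (⟨z, y, f₂.1⟩ : ρ.AnyTriple U v₀) :=
      orbit_eq_of_label htyp (mem_cover_B.1 ha) c hc
    have h2 := (exists_coverEdges ρ U v₀).choose_spec.2.1 _ f₁.2 _ f₂.2 h1
    apply hne
    obtain ⟨f₁, hf₁⟩ := f₁
    obtain ⟨f₂, hf₂⟩ := f₂
    cases h2
    rfl
  · rintro ⟨x, y, f, hne⟩
    apply hne
    ext c
    have h1 := ρ.edge_mul f.1.1.1 c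
    have h2 := conj_mem_iff (α' := ρ.vert x.1 (𝔸.α f.1.1.1 c)) (cover_edge_mem f)
      (eq_mul_inv_of_mul_eq h1.symm)
    simpa [AGraph.edgeα, AGraph.edgeω, AGraph.conjα, AGraph.conjω] using h2

theorem exists_cover_edge (x : ρ.CoverVertex U) {v : 𝔸.V} (a : 𝔸.A x.1) (e : 𝔸.E x.1 v) :
    ∃ (y : (cover ρ U v₀).V) (f : (cover ρ U v₀).E x y),
      (⟨y.1, (cover ρ U v₀).etype f⟩ : Σ t, 𝔸.E x.1 t) = ⟨v, e⟩ ∧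
      ∃ b ∈ (cover ρ U v₀).B x, ∃ c : 𝔸.Ae e, a = b * (cover ρ U v₀).labα f * 𝔸.α e c := by
  let y : ρ.CoverVertex U := ⟨v, Quotient.mk _ (ρ.coverRep U v₀ x * (ρ.vert _ a * ρ.edge e))⟩
  obtain ⟨_, ⟨k, rfl⟩, hk⟩ := Quotient.exact (ρ.mk_coverRep U v₀ y)
  let t : ρ.Triple U v₀ x y := ⟨(e, a, k⁻¹), by
    have := U.inv_mem hk
    simpa [mul_assoc] using this⟩
  obtain ⟨⟨x', y', t'⟩, ht', ho⟩ := (exists_coverEdges ρ U v₀).choose_spec.2.2 ⟨x, y, t⟩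
  obtain ⟨⟨e', a', k'⟩, h'⟩ := t'
  have h1 : (⟨x'.1, y'.1, e'⟩ : Σ u v : 𝔸.V, 𝔸.E u v) = ⟨x.1, v, e⟩ := congrArg Sigma.fst ho
  have key : ∀ (w : 𝔸.V) (a' : 𝔸.A w) (v' : 𝔸.V) (e' : 𝔸.E w v') (g : Γ),
      (⟨⟨w, v', e'⟩, Quotient.mk _ (g * ρ.vert _ a')⟩ : ρ.EdgeOrbit U) =
        ⟨⟨x.1, v, e⟩, Quotient.mk _ (ρ.coverRep U v₀ x * ρ.vert _ a)⟩ →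
      ∃ (hw : w = x.1) (c : 𝔸.Ae e),
        g * ρ.vert _ (hw ▸ a') * ρ.vert _ (𝔸.α e c) * (ρ.coverRep U v₀ x * ρ.vert _ a)⁻¹ ∈ U := by
    intro w a' v' e' g h
    obtain rfl : w = x.1 := congrArg (fun s => s.1.1) h
    have h2 := congrArg Sigma.fst h
    cases h2
    obtain ⟨_, ⟨c, rfl⟩, hc⟩ := Quotient.exact (eq_of_heq (Sigma.mk.inj h).2)
    exact ⟨rfl, c, hc⟩
  obtain ⟨hw, c, hc⟩ := key _ _ _ _ _ ho
  have hxx : x' = x := by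
    refine ρ.coverVertex_ext U v₀ hw (a := (hw ▸ a') * 𝔸.α e c * a⁻¹) ?_
    simpa [mul_assoc] using hc
  subst hxx
  simp only [Sigma.mk.injEq, heq_eq_eq, true_and] at h1
  refine ⟨y', ⟨⟨(e', a', k'), h'⟩, ht'⟩, ?_, a * (a' * 𝔸.α e c)⁻¹, ?_, c, ?_⟩
  · exact Sigma.ext h1.1 h1.2
  · rw [mem_cover_B]
    have := U.inv_mem hc
    simpa [mul_assoc] using this
  · change a = _ * a' * _
    group

theorem cover_val_mem {x y : (cover ρ U v₀).gog.V} (p : (cover ρ U v₀).gog.Path x y) :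
    ρ.coverRep U v₀ x * ρ.val ((cover ρ U v₀).mu p) * (ρ.coverRep U v₀ y)⁻¹ ∈ U := by
  induction p with
  | nil b => exact b.2
  | @cons x z y b f p ih =>
    have h := U.mul_mem (U.mul_mem (mem_cover_B.1 b.2) (cover_edge_mem f)) ih
    simp only [AGraph.mu, val, val_lmul, map_mul]
    simpa [mul_assoc] using h

theorem exists_cover_lift {u w : 𝔸.V} (q : 𝔸.Path u w) (x : ρ.CoverVertex U) (hx : x.1 = u)
    (z : 𝔸.A u) : ∃ (y : (cover ρ U v₀).V) (_ : y.1 = w) (p : (cover ρ U v₀).gog.Path x y)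
      (k : 𝔸.A w), ρ.vert u z * ρ.val q = ρ.val ((cover ρ U v₀).mu p) * ρ.vert w k := by
  induction q generalizing x with
  | nil a =>
    subst hx
    exact ⟨x, rfl, nil 1, z * a, by simp [AGraph.mu, val]⟩
  | @cons u v w a e q ih =>
    subst hx
    obtain ⟨y, f, hf, b, hb, c, hc⟩ := exists_cover_edge (v₀ := v₀) x (z * a) e
    obtain rfl : y.1 = v := congrArg Sigma.fst hf
    obtain rfl : (cover ρ U v₀).etype f = e := by simpa using hf
    obtain ⟨y', hy', p, k, hk⟩ := ih y rfl (((cover ρ U v₀).labω f)⁻¹ * 𝔸.ω _ c)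
    refine ⟨y', hy', cons ⟨b, hb⟩ f p, k, ?_⟩
    have h1 := ρ.edge_mul ((cover ρ U v₀).etype f) c
    simp only [AGraph.mu, val, val_lmul, map_mul, map_inv, mul_assoc] at hk ⊢
    rw [← hk, ← mul_assoc (ρ.vert _ z), ← map_mul, hc, mul_inv_cancel_left]
    simp only [map_mul, mul_assoc]
    rw [← mul_assoc (ρ.vert _ (𝔸.α _ c)), ← h1]
    simp [mul_assoc]

/-- The closed paths at the base vertex of the covering `𝔸`-graph represent all elements of `U`. -/
theorem exists_cover_loop (q : 𝔸.Path v₀ v₀) (hq : ρ.val q ∈ U) :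
    ∃ p : (cover ρ U v₀).gog.Path (ρ.coverBase U v₀) (ρ.coverBase U v₀), p.Red ∧
      ρ.val ((cover ρ U v₀).mu p) = ρ.val q := by
  obtain ⟨y, hy, p, k, hk⟩ := exists_cover_lift (v₀ := v₀) q (ρ.coverBase U v₀) rfl 1
  have h1 := cover_val_mem p
  rw [ρ.coverRep_base, one_mul] at h1
  rw [map_one, one_mul] at hk
  have h2 : ρ.coverRep U v₀ y * ρ.vert v₀ k * (ρ.coverRep U v₀ (ρ.coverBase U v₀))⁻¹ ∈ U := by
    have h3 := U.mul_mem (U.inv_mem h1) hq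
    rw [hk] at h3
    simpa [mul_assoc, coverRep_base] using h3
  obtain rfl := ρ.coverVertex_ext U v₀ (x := y) (y := ρ.coverBase U v₀) hy (a := k) h2
  have hb : k ∈ (cover ρ U v₀).B (ρ.coverBase U v₀) := h2
  obtain ⟨r, hr, hs, -⟩ := exists_red (p.comp (nil ⟨k, hb⟩))
  refine ⟨r, hr, ?_⟩
  rw [hk, ← ρ.val_sim ((cover ρ U v₀).mu_sim hs), AGraph.mu_comp, val_comp]
  rfl

end Rep

end GraphOfGroups

/-! ### Finite folded subgraphs of `𝔸`-graphs -/

/-- In a group without infinite strictly ascending sequences of subgroups, all subgroups are finitely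
generated. -/
theorem Subgroup.fg_of_noetherian {G : Type*} [Group G] (h : ∀ s : ℕ → Subgroup G, ¬ StrictMono s)
    (H : Subgroup G) : H.FG := by
  have hwf : WellFoundedGT (Subgroup G) := by
    rw [wellFoundedGT_iff_monotone_chain_condition']
    by_contra! hc
    obtain ⟨a, ha⟩ := hc
    choose m hm hlt using ha
    refine h (fun n => a (m^[n] 0)) (strictMono_nat_of_lt_succ fun n => ?_)
    rw [Function.iterate_succ_apply']
    exact hlt _
  obtain ⟨K, ⟨hK, hKH⟩, hmax⟩ := hwf.wf.has_min {K : Subgroup G | K.FG ∧ K ≤ H}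
    ⟨⊥, Subgroup.FG.bot, bot_le⟩
  have : K = H := by
    refine le_antisymm hKH fun x hx => ?_
    by_contra hxK
    refine hmax (K ⊔ Subgroup.zpowers x) ⟨hK.sup ?_, sup_le hKH ?_⟩
      (lt_of_le_of_ne le_sup_left fun he => hxK ?_)
    · exact (Subgroup.fg_iff _).2 ⟨{x}, (Subgroup.zpowers_eq_closure x).symm, Set.finite_singleton x⟩
    · exact (Subgroup.zpowers_le).2 hx
    · rw [he]
      exact (le_sup_right : _ ≤ K ⊔ _) (Subgroup.mem_zpowers x)
  exact this ▸ hK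

namespace GraphOfGroups.Path

variable {𝔸 : GraphOfGroups.{u₁, u₂, u₃, u₄}}

/-- The edges of a path. -/
def edges : ∀ {u v : 𝔸.V}, 𝔸.Path u v → Set (Σ u v : 𝔸.V, 𝔸.E u v)
  | _, _, nil _ => ∅
  | _, _, cons _ e p => insert ⟨_, _, e⟩ p.edges

/-- The group elements of a path. -/
def elts : ∀ {u v : 𝔸.V}, 𝔸.Path u v → Set (Σ u : 𝔸.V, 𝔸.A u)
  | _, _, nil a => {⟨_, a⟩}
  | _, _, cons a _ p => insert ⟨_, a⟩ p.elts

theorem edges_finite {u v : 𝔸.V} (p : 𝔸.Path u v) : p.edges.Finite := by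
  induction p with
  | nil a => exact Set.finite_empty
  | cons a e p ih => exact ih.insert _

theorem elts_finite {u v : 𝔸.V} (p : 𝔸.Path u v) : p.elts.Finite := by
  induction p with
  | nil a => exact Set.finite_singleton _
  | cons a e p ih => exact ih.insert _

@[simp] theorem edges_lmul {u v : 𝔸.V} (a : 𝔸.A u) (p : 𝔸.Path u v) :
    (p.lmul a).edges = p.edges := by
  cases p <;> rfl

@[simp] theorem edges_comp {u v w : 𝔸.V} (p : 𝔸.Path u v) (q : 𝔸.Path v w) :
    (p.comp q).edges = p.edges ∪ q.edges := by
  induction p with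
  | nil a => simp [edges]
  | cons a e p ih => simp [edges, ih, Set.insert_union]

theorem inv_mem_edges_reverse {u v : 𝔸.V} (p : 𝔸.Path u v) {x y : 𝔸.V} {e : 𝔸.E x y}
    (h : ⟨x, y, e⟩ ∈ p.edges) : ⟨y, x, 𝔸.inv e⟩ ∈ p.reverse.edges := by
  induction p with
  | nil a => exact absurd h (Set.notMem_empty _)
  | cons a e' p ih =>
    rw [reverse, edges_comp]
    rcases h with h | h
    · right
      cases h
      exact Or.inl rfl
    · exact Or.inl (ih h)

theorem edges_reverse_subset {u v : 𝔸.V} (p : 𝔸.Path u v) {x y : 𝔸.V} {e : 𝔸.E x y}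
    (h : ⟨x, y, e⟩ ∈ p.reverse.edges) : ⟨y, x, 𝔸.inv e⟩ ∈ p.edges := by
  induction p with
  | nil a => exact absurd h (Set.notMem_empty _)
  | cons a e' p ih =>
    rw [reverse, edges_comp] at h
    rcases h with h | h | h
    · exact Or.inr (ih h)
    · cases h
      left
      rw [𝔸.inv_inv]
    · exact absurd h (Set.notMem_empty _)

/-- A reduced path can be continued, after each of its edges, to a reduced path to its endpoint. -/
theorem Red.exists_suffix {u v : 𝔸.V} {p : 𝔸.Path u v} (hp : p.Red) {x y : 𝔸.V} {e : 𝔸.E x y}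
    (h : ⟨x, y, e⟩ ∈ p.edges) :
    ∃ q : 𝔸.Path y v, (cons 1 e q).Red ∧ q.edges ⊆ p.edges ∧ q.elts ⊆ p.elts := by
  induction p with
  | nil a => exact absurd h (Set.notMem_empty _)
  | cons a e' p ih =>
    rcases h with h | h
    · cases h
      exact ⟨p, hp, Set.subset_insert _ _, Set.subset_insert _ _⟩
    · obtain ⟨q, h1, h2, h3⟩ := ih hp.2 h
      exact ⟨q, h1, h2.trans (Set.subset_insert _ _), h3.trans (Set.subset_insert _ _)⟩

end GraphOfGroups.Path

namespace AGraph

open GraphOfGroups GraphOfGroups.Path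

variable {𝔸 : GraphOfGroups.{u₁, u₂, u₃, u₄}} (𝓑 : AGraph.{u₁, u₂, u₃, u₄, u₅, u₆} 𝔸)

/-- The `𝔸`-graph obtained from `𝓑` by restricting the vertices, the edges and the vertex groups. -/
abbrev restrict (W : Set 𝓑.V) (K : Set (Σ u v : 𝓑.V, 𝓑.E u v))
    (hK : ∀ u v (f : 𝓑.E u v), ⟨u, v, f⟩ ∈ K → ⟨v, u, 𝓑.inv f⟩ ∈ K)
    (B' : ∀ u, Subgroup (𝔸.A (𝓑.vtype u))) : AGraph.{u₁, u₂, u₃, u₄, u₅, u₆} 𝔸 where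
  V := W
  E x y := {f : 𝓑.E x.1 y.1 // ⟨x.1, y.1, f⟩ ∈ K}
  inv f := ⟨𝓑.inv f.1, hK _ _ _ f.2⟩
  inv_inv f := Subtype.ext (𝓑.inv_inv f.1)
  inv_ne f h := 𝓑.inv_ne f.1 (congrArg Subtype.val h)
  vtype x := 𝓑.vtype x.1
  etype f := 𝓑.etype f.1
  etype_inv f := 𝓑.etype_inv f.1
  B x := B' x.1
  labα f := 𝓑.labα f.1
  labω f := 𝓑.labω f.1
  labα_inv f := 𝓑.labα_inv f.1

variable {𝓑} {W : Set 𝓑.V} {K : Set (Σ u v : 𝓑.V, 𝓑.E u v)}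
  {hK : ∀ u v (f : 𝓑.E u v), ⟨u, v, f⟩ ∈ K → ⟨v, u, 𝓑.inv f⟩ ∈ K}
  {B' : ∀ u, Subgroup (𝔸.A (𝓑.vtype u))}

/-- A path of `𝓑` whose edges and group elements survive is a path of the restriction. -/
theorem exists_restrict_path (hKW : ∀ u v (f : 𝓑.E u v), ⟨u, v, f⟩ ∈ K → u ∈ W)
    {u v : 𝓑.gog.V} (p : 𝓑.gog.Path u v) (hv : v ∈ W) (hp : p.edges ⊆ K)
    (hB : ∀ u (a : 𝓑.B u), (⟨u, a⟩ : Σ u, 𝓑.gog.A u) ∈ p.elts → a.1 ∈ B' u) (hu : u ∈ W) :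
    ∃ q : (𝓑.restrict W K hK B').gog.Path ⟨u, hu⟩ ⟨v, hv⟩,
      (𝓑.restrict W K hK B').mu q = 𝓑.mu p := by
  induction p with
  | nil a => exact ⟨nil ⟨a.1, hB _ a rfl⟩, rfl⟩
  | @cons u w v a f p ih =>
    have hf := hp (Set.mem_insert _ _)
    have hw : w ∈ W := hKW _ _ _ (hK _ _ _ hf)
    obtain ⟨q, hq⟩ := ih hv ((Set.subset_insert _ _).trans hp)
      (fun u a h => hB u a (Set.mem_insert_of_mem _ h)) hw
    refine ⟨cons (v := (⟨w, hw⟩ : W)) ⟨a.1, hB _ a (Set.mem_insert _ _)⟩ ⟨f, hf⟩ q, ?_⟩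
    simp only [mu]
    rw [hq]

theorem restrict_folded (hF : 𝓑.Folded) (hB : ∀ u, B' u ≤ 𝓑.B u)
    (hE : ∀ u v (f : 𝓑.E u v), ⟨u, v, f⟩ ∈ K → ∀ c ∈ 𝓑.edgeα f, 𝓑.conjα f c ∈ B' u) :
    (𝓑.restrict W K hK B').Folded := by
  refine ⟨?_, ?_⟩
  · rintro ⟨z, x, y, f₁, f₂, hne, htyp, a, ha, c, hc⟩
    refine hF.1 ⟨z, x, y, f₁.1, f₂.1, fun h => hne ?_, htyp, a, hB _ ha, c, hc⟩
    obtain ⟨x, hx⟩ := x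
    obtain ⟨y, hy⟩ := y
    obtain ⟨f₁, h₁⟩ := f₁
    obtain ⟨f₂, h₂⟩ := f₂
    cases h
    rfl
  · rintro ⟨u, v, f, hne⟩
    have h0 : 𝓑.edgeα f.1 = 𝓑.edgeω f.1 := by
      by_contra h
      exact hF.2 ⟨_, _, f.1, h⟩
    have h1 : (𝓑.restrict W K hK B').edgeα f = 𝓑.edgeα f.1 :=
      le_antisymm (fun c hc => hB _ hc) (fun c hc => hE _ _ f.1 f.2 c hc)
    have h2 : (𝓑.restrict W K hK B').edgeω f = 𝓑.edgeω f.1 := by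
      refine le_antisymm (fun c hc => hB _ hc) fun c hc => ?_
      obtain ⟨φ, hφ⟩ := 𝓑.exists_rev f.1
      change 𝓑.conjω f.1 c ∈ B' v
      rw [← (hφ c).1]
      refine hE _ _ _ (hK _ _ _ f.2) _ ?_
      change 𝓑.conjα _ _ ∈ 𝓑.B v
      rw [(hφ c).1]
      exact hc
    exact hne (h1.trans (h0.trans h2.symm))

/-- A folded `𝔸`-graph contains, for finitely many closed paths, a finite folded `𝔸`-graph with
finitely generated vertex groups through which these paths factor: keep their edges and vertices,
and let the vertex groups be generated by the group elements of the paths and by the (finitely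
generated) edge groups. -/
theorem exists_finite_restrict (hN : ∀ {u v : 𝔸.V} (e : 𝔸.E u v) (s : ℕ → Subgroup (𝔸.Ae e)),
      ¬ StrictMono s) (hF : 𝓑.Folded) (u₀ : 𝓑.gog.V) (T : Set (𝓑.gog.Path u₀ u₀)) (hT : T.Finite)
    (hred : ∀ p ∈ T, p.Red) :
    ∃ (W : Set 𝓑.V) (K : Set (Σ u v : 𝓑.V, 𝓑.E u v))
      (hK : ∀ u v (f : 𝓑.E u v), ⟨u, v, f⟩ ∈ K → ⟨v, u, 𝓑.inv f⟩ ∈ K)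
      (B' : ∀ u, Subgroup (𝔸.A (𝓑.vtype u))) (hu₀ : u₀ ∈ W),
      W.Finite ∧ K.Finite ∧ (∀ u, (B' u).FG) ∧ (∀ u, B' u ≤ 𝓑.B u) ∧
      (𝓑.restrict W K hK B').Folded ∧
      (∀ u v (f : (𝓑.restrict W K hK B').E u v),
        ∃ q : (𝓑.restrict W K hK B').gog.Path v ⟨u₀, hu₀⟩, (cons 1 f q).Red) ∧
      (∀ u, Nonempty ((𝓑.restrict W K hK B').gog.Path ⟨u₀, hu₀⟩ u)) ∧
      ∀ p ∈ T, ∃ q : (𝓑.restrict W K hK B').gog.Path ⟨u₀, hu₀⟩ ⟨u₀, hu₀⟩,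
        (𝓑.restrict W K hK B').mu q = 𝓑.mu p := by
  have hgens : ∀ t : Σ u v : 𝓑.V, 𝓑.E u v, ∃ s : Set (𝔸.A (𝓑.vtype t.1)),
      s.Finite ∧ Subgroup.closure s = (𝓑.edgeα t.2.2).map (𝓑.conjα t.2.2) := by
    intro t
    obtain ⟨s, hs, hfin⟩ := (Subgroup.fg_iff _).1
      (Subgroup.fg_of_noetherian (hN (𝓑.etype t.2.2)) (𝓑.edgeα t.2.2))
    exact ⟨_, hfin.image (𝓑.conjα t.2.2), by rw [← MonoidHom.map_closure, hs]⟩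
  choose gens hfin hgens using hgens
  let T' : Set (𝓑.gog.Path u₀ u₀) := T ∪ Path.reverse '' T
  have hT' : T'.Finite := hT.union (hT.image _)
  have hred' : ∀ p ∈ T', p.Red := by
    rintro p (h | ⟨p, h, rfl⟩)
    · exact hred p h
    · exact (hred p h).reverse
  let K : Set (Σ u v : 𝓑.V, 𝓑.E u v) := ⋃ p ∈ T', Path.edges p
  have hKfin : K.Finite := hT'.biUnion fun p _ => p.edges_finite
  have hK : ∀ u v (f : 𝓑.E u v), ⟨u, v, f⟩ ∈ K → ⟨v, u, 𝓑.inv f⟩ ∈ K := by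
    intro u v f hf
    obtain ⟨p, hp, hf⟩ := Set.mem_iUnion₂.1 hf
    rcases hp with hp | ⟨p, hp, rfl⟩
    · exact Set.mem_iUnion₂.2 ⟨p.reverse, Or.inr ⟨p, hp, rfl⟩, inv_mem_edges_reverse p hf⟩
    · exact Set.mem_iUnion₂.2 ⟨p, Or.inl hp, edges_reverse_subset p hf⟩
  let W : Set 𝓑.V := insert u₀ (Sigma.fst '' K)
  have hKW : ∀ u v (f : 𝓑.E u v), ⟨u, v, f⟩ ∈ K → u ∈ W := fun u v f hf => Or.inr ⟨_, hf, rfl⟩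
  let val : (Σ u : 𝓑.V, 𝓑.B u) → Σ u : 𝓑.V, 𝔸.A (𝓑.vtype u) := fun a => ⟨a.1, a.2.1⟩
  let S : Set (Σ u : 𝓑.V, 𝔸.A (𝓑.vtype u)) :=
    (⋃ p ∈ T', val '' Path.elts p) ∪ ⋃ t ∈ K, Sigma.mk t.1 '' gens t
  have hS : S.Finite := (hT'.biUnion fun p _ => p.elts_finite.image _).union
    (hKfin.biUnion fun t _ => (hfin t).image _)
  let B' : ∀ u, Subgroup (𝔸.A (𝓑.vtype u)) := fun u =>
    Subgroup.closure {a | ⟨u, a⟩ ∈ S}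
  have hu₀ : u₀ ∈ W := Set.mem_insert _ _
  have hB : ∀ u, B' u ≤ 𝓑.B u := by
    intro u
    refine (Subgroup.closure_le _).2 ?_
    rintro a (ha | ha)
    · obtain ⟨p, hp, ⟨u, b⟩, hb, h⟩ := Set.mem_iUnion₂.1 ha
      cases h
      exact b.2
    · obtain ⟨⟨u, v, f⟩, ht, b, hb, h⟩ := Set.mem_iUnion₂.1 ha
      cases h
      have h1 := Subgroup.subset_closure hb
      rw [hgens] at h1
      obtain ⟨c, hc, rfl⟩ := h1
      exact hc
  have hE : ∀ u v (f : 𝓑.E u v), ⟨u, v, f⟩ ∈ K → ∀ c ∈ 𝓑.edgeα f, 𝓑.conjα f c ∈ B' u := by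
    intro u v f hf c hc
    have h1 : 𝓑.conjα f c ∈ Subgroup.closure (gens ⟨u, v, f⟩) := by
      rw [hgens]
      exact ⟨c, hc, rfl⟩
    refine Subgroup.closure_mono (fun b hb => ?_) h1
    exact Or.inr (Set.mem_iUnion₂.2 ⟨_, hf, b, hb, rfl⟩)
  have hF' : (𝓑.restrict W K hK B').Folded := restrict_folded hF hB hE
  have helts : ∀ p ∈ T', ∀ u (a : 𝓑.B u), (⟨u, a⟩ : Σ u, 𝓑.gog.A u) ∈ Path.elts p →
      a.1 ∈ B' u := fun p hp u a ha =>
    Subgroup.subset_closure (Or.inl (Set.mem_iUnion₂.2 ⟨p, hp, ⟨u, a⟩, ha, rfl⟩))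
  have hKT : ∀ p ∈ T', Path.edges p ⊆ K := fun p hp f hf => Set.mem_iUnion₂.2 ⟨p, hp, hf⟩
  have hcore : ∀ u v (f : (𝓑.restrict W K hK B').E u v),
      ∃ q : (𝓑.restrict W K hK B').gog.Path v ⟨u₀, hu₀⟩, (cons 1 f q).Red := by
    intro u v f
    obtain ⟨p, hp, hf⟩ := Set.mem_iUnion₂.1 f.2
    obtain ⟨q, hq, h1, h2⟩ := Red.exists_suffix (hred' p hp) hf
    have h3 := hF.red_mu hq
    obtain ⟨q', hq'⟩ := exists_restrict_path (hK := hK) (B' := B') hKW q hu₀ (h1.trans (hKT p hp))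
      (fun u a ha => helts p hp u a (h2 ha)) v.2
    refine ⟨q', red_of_red_mu (𝓑.restrict W K hK B') (p := cons 1 f q') ?_⟩
    have h4 : (𝓑.restrict W K hK B').mu (cons 1 f q') = 𝓑.mu (cons 1 f.1 q) := by
      simp only [mu]
      rw [hq']
      rfl
    rw [h4]
    exact h3
  refine ⟨W, K, hK, B', hu₀, (hKfin.image _).insert _, hKfin, fun u => ?_, hB, hF', hcore, ?_, ?_⟩
  · exact (Subgroup.fg_iff _).2 ⟨_, rfl, hS.preimage sigma_mk_injective.injOn⟩
  · rintro ⟨u, rfl | ⟨⟨u, v, f⟩, hf, rfl⟩⟩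
    · exact ⟨nil 1⟩
    · let f' : (𝓑.restrict W K hK B').E ⟨v, hKW _ _ _ (hK _ _ _ hf)⟩ ⟨u, hKW _ _ _ hf⟩ :=
        ⟨𝓑.inv f, hK _ _ _ hf⟩
      exact ⟨(hcore _ _ f').choose.reverse⟩
  · intro p hp
    exact exists_restrict_path hKW p hu₀ (hKT p (Or.inl hp)) (helts p (Or.inl hp)) hu₀

end AGraph

namespace GraphOfGroups.Rep

variable {𝔸 : GraphOfGroups.{u₁, u₂, u₃, u₄}} {Γ : Type u₅} [Group Γ]

open _root_.GraphOfGroups.Path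

/-- A finite folded `𝔸`-graph whose closed paths represent elements of a subgroup `U`, including
finitely many prescribed elements of `U`. -/
theorem exists_finite_folded (ρ : Rep 𝔸 Γ) (U : Subgroup Γ) (v₀ : 𝔸.V)
    (hN : ∀ {u v : 𝔸.V} (e : 𝔸.E u v) (s : ℕ → Subgroup (𝔸.Ae e)), ¬ StrictMono s)
    (T : Set (𝔸.Path v₀ v₀)) (hT : T.Finite) (hU : ∀ q ∈ T, ρ.val q ∈ U) :
    ∃ (𝓑 : AGraph.{u₁, u₂, u₃, u₄, max u₁ u₅, max u₂ u₃} 𝔸) (u₀ : 𝓑.V),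
      𝓑.vtype u₀ = v₀ ∧ Finite 𝓑.V ∧ Finite (Σ u v : 𝓑.V, 𝓑.E u v) ∧ (∀ u, (𝓑.B u).FG) ∧
      𝓑.Folded ∧
      (∀ u v (f : 𝓑.E u v), ∃ q : 𝓑.gog.Path v u₀, (cons 1 f q).Red) ∧
      (∀ u, Nonempty (𝓑.gog.Path u₀ u)) ∧
      (∃ g : 𝓑.V → Γ, g u₀ = 1 ∧ (∀ u, ∀ b ∈ 𝓑.B u, g u * ρ.vert _ b * (g u)⁻¹ ∈ U) ∧
        ∀ u v (f : 𝓑.E u v), g u * (ρ.vert _ (𝓑.labα f) *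
          (ρ.edge (𝓑.etype f) * ρ.vert _ (𝓑.labω f))) * (g v)⁻¹ ∈ U) ∧
      ∀ q ∈ T, ∃ p : 𝓑.gog.Path u₀ u₀, ρ.val (𝓑.mu p) = ρ.val q := by
  have hloop : ∀ q : T, ∃ p : (cover ρ U v₀).gog.Path (ρ.coverBase U v₀) (ρ.coverBase U v₀),
      p.Red ∧ ρ.val ((cover ρ U v₀).mu p) = ρ.val q.1 := fun q => exists_cover_loop q.1 (hU _ q.2)
  choose p hp hval using hloop
  have := hT.to_subtype
  obtain ⟨W, K, hK, B', hu₀, hW, hKf, hfg, hB, hF, hcore, hconn, hpaths⟩ :=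
    AGraph.exists_finite_restrict hN cover_folded (ρ.coverBase U v₀) (Set.range p)
      (Set.finite_range p) (by rintro _ ⟨q, rfl⟩; exact hp q)
  refine ⟨(cover ρ U v₀).restrict W K hK B', ⟨ρ.coverBase U v₀, hu₀⟩, rfl, hW.to_subtype, ?_,
    fun u => hfg u.1, hF, hcore, hconn, ⟨fun u => ρ.coverRep U v₀ u.1, ρ.coverRep_base U v₀,
    fun u b hb => mem_cover_B.1 (hB _ hb), fun u v f => cover_edge_mem f.1⟩, ?_⟩
  · have := hKf.to_subtype
    refine Finite.of_injective (β := K) (fun t => ⟨⟨t.1.1, t.2.1.1, t.2.2.1⟩, t.2.2.2⟩) ?_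
    rintro ⟨⟨u, hu⟩, ⟨v, hv⟩, ⟨f, hf⟩⟩ ⟨⟨u', hu'⟩, ⟨v', hv'⟩, ⟨f', hf'⟩⟩ h
    have h' := congrArg Subtype.val h
    cases h'
    rfl
  · intro q hq
    obtain ⟨r, hr⟩ := hpaths _ ⟨⟨q, hq⟩, rfl⟩
    exact ⟨r, by rw [hr, hval]⟩

end GraphOfGroups.Rep

/-! ### Primitive recursive functions on words and codes -/

namespace Primrec

variable {α β γ : Type*} [Primcodable α] [Primcodable β] [Primcodable γ]

theorem comp_fun {f : β → γ} {g : α → β} (hf : Primrec f) (hg : Primrec g) :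
    Primrec fun a => f (g a) := hf.comp hg

theorem id_fun : Primrec fun a : α => a := Primrec.id

theorem const_fun (b : β) : Primrec fun _ : α => b := Primrec.const b

theorem pair_fun {f : α → β} {g : α → γ} (hf : Primrec f) (hg : Primrec g) :
    Primrec fun a => (f a, g a) := hf.pair hg

theorem fst_fun {f : α → β × γ} (hf : Primrec f) : Primrec fun a => (f a).1 := Primrec.fst.comp hf

theorem snd_fun {f : α → β × γ} (hf : Primrec f) : Primrec fun a => (f a).2 := Primrec.snd.comp hf

theorem append_fun {f g : α → List β} (hf : Primrec f) (hg : Primrec g) :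
    Primrec fun a => f a ++ g a := Primrec.list_append.comp hf hg

theorem cons_fun {f : α → β} {g : α → List β} (hf : Primrec f) (hg : Primrec g) :
    Primrec fun a => f a :: g a := Primrec.list_cons.comp hf hg

theorem length_fun {f : α → List β} (hf : Primrec f) : Primrec fun a => (f a).length :=
  Primrec.list_length.comp hf

theorem getD_fun {f : α → List β} {g : α → ℕ} (d : β) (hf : Primrec f) (hg : Primrec g) :
    Primrec fun a => (f a).getD (g a) d := (Primrec.list_getD d).comp hf hg

theorem map_fun {f : α → List β} {g : α → β → γ} (hf : Primrec f)
    (hg : Primrec fun x : α × β => g x.1 x.2) : Primrec fun a => (f a).map (g a) :=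
  Primrec.list_map hf hg

theorem flatMap_fun {f : α → List β} {g : α → β → List γ} (hf : Primrec f)
    (hg : Primrec fun x : α × β => g x.1 x.2) : Primrec fun a => (f a).flatMap (g a) :=
  Primrec.list_flatMap hf hg

theorem invRev_fun {f : α → Word} (hf : Primrec f) : Primrec fun a => FreeGroup.invRev (f a) :=
  primrec_invRev.comp hf

theorem substWord_fun {f : α → List Word} {g : α → Word} (hf : Primrec f) (hg : Primrec g) :
    Primrec fun a => substWord (f a) (g a) := primrec_substWord.comp hf hg

theorem vword_fun {f : α → ℕ} {g : α → Word} (hf : Primrec f) (hg : Primrec g) :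
    Primrec fun a => GraphOfGroups.Marking.vword (f a) (g a) :=
  GraphOfGroups.Marking.primrec_vword.comp hf hg

theorem eletter_fun {f : α → ℕ} (hf : Primrec f) :
    Primrec fun a => GraphOfGroups.Marking.eletter (f a) :=
  GraphOfGroups.Marking.primrec_eletter.comp hf

theorem edgeCode_equiv : Primrec EdgeCode.equiv := Primrec.of_equiv

theorem orig_fun {f : α → EdgeCode} (hf : Primrec f) : Primrec fun a => (f a).orig :=
  Primrec.fst.comp (edgeCode_equiv.comp hf)

theorem term_fun {f : α → EdgeCode} (hf : Primrec f) : Primrec fun a => (f a).term :=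
  Primrec.fst.comp (Primrec.snd.comp (edgeCode_equiv.comp hf))

theorem rev_fun {f : α → EdgeCode} (hf : Primrec f) : Primrec fun a => (f a).rev :=
  Primrec.fst.comp (Primrec.snd.comp (Primrec.snd.comp (edgeCode_equiv.comp hf)))

theorem typ_fun {f : α → EdgeCode} (hf : Primrec f) : Primrec fun a => (f a).typ :=
  Primrec.fst.comp (Primrec.snd.comp (Primrec.snd.comp (Primrec.snd.comp (edgeCode_equiv.comp hf))))

theorem wα_fun {f : α → EdgeCode} (hf : Primrec f) : Primrec fun a => (f a).wα :=
  Primrec.fst.comp (Primrec.snd.comp (Primrec.snd.comp (Primrec.snd.comp (Primrec.snd.comp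
    (edgeCode_equiv.comp hf)))))

theorem wω_fun {f : α → EdgeCode} (hf : Primrec f) : Primrec fun a => (f a).wω :=
  Primrec.snd.comp (Primrec.snd.comp (Primrec.snd.comp (Primrec.snd.comp (Primrec.snd.comp
    (edgeCode_equiv.comp hf)))))

/-- Functions that vanish outside a finite set are primitive recursive. -/
theorem of_finite_support {f : ℕ → ℕ} (hf : {n | f n ≠ 0}.Finite) : Primrec f := by
  obtain ⟨N, hN⟩ := hf.bddAbove
  refine (getD_fun 0 (const_fun ((List.range (N + 1)).map f)) id_fun).of_eq fun n => ?_
  by_cases h : n < N + 1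
  · simp [List.getD_eq_getElem?_getD, h]
  · have h1 : f n = 0 := by
      by_contra h2
      exact h (Nat.lt_succ_of_le (hN h2))
    simp [List.getD_eq_getElem?_getD, h, h1]

end Primrec

attribute [fun_prop] Primrec Primrec.comp_fun Primrec.id_fun Primrec.const_fun Primrec.pair_fun
  Primrec.fst_fun Primrec.snd_fun Primrec.append_fun Primrec.cons_fun Primrec.length_fun
  Primrec.getD_fun Primrec.map_fun Primrec.flatMap_fun Primrec.invRev_fun Primrec.substWord_fun
  Primrec.vword_fun Primrec.eletter_fun Primrec.orig_fun Primrec.term_fun Primrec.rev_fun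
  Primrec.typ_fun Primrec.wα_fun Primrec.wω_fun

namespace GraphOfGroups.Marking

variable {𝔸 : GraphOfGroups.{u₁, u₂, u₃, u₄}} (M : 𝔸.Marking)

open _root_.GraphOfGroups.Path

/-! ### Words of paths -/

theorem wval_eq_re (hM : M.Benign) {α : Type*} [Primcodable α] {f g : α → Word} (hf : Primrec f)
    (hg : Primrec g) : IsRE fun a => M.wval (f a) = M.wval (g a) := by
  have h : IsRE fun x : Unit × Word => x.2 ∈ M.relators := (M.relators_re hM).comp Primrec.snd
  refine ((IsRE.wordGroup (R := fun _ : Unit => M.relators) h).comp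
    (f := fun a => ((), f a ++ FreeGroup.invRev (g a))) (by fun_prop)).of_iff fun a => ?_
  change _ ↔ M.wval _ = 1
  rw [wval_append, wval_invRev, mul_inv_eq_one]

/-- The subgroup of the ambient group generated by a list of words. -/
def gen (X : List Word) : Subgroup M.Amb := Subgroup.closure {x | x ∈ X.map M.wval}

theorem mem_gen_iff (X : List Word) (x : M.Amb) :
    x ∈ M.gen X ↔ ∃ y, M.wval (substWord X y) = x := by
  rw [gen, mem_closure_iff_wordVal]
  have h : ∀ y, M.wval (substWord X y) = wordVal (X.map M.wval) y := fun y =>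
    evalWord_substWord (fun i => (FreeGroup.of i : M.Amb)) X y
  simp only [h]

theorem mem_gen_re (hM : M.Benign) {α : Type*} [Primcodable α] {f : α → List Word} {g : α → Word}
    (hf : Primrec f) (hg : Primrec g) : IsRE fun a => M.wval (g a) ∈ M.gen (f a) :=
  (IsRE.ex (p := fun a y => M.wval (substWord (f a) y) = M.wval (g a))
    (M.wval_eq_re hM (by fun_prop) (by fun_prop))).of_iff fun a => M.mem_gen_iff _ _

theorem gen_vword (v : 𝔸.V) (X : List Word) :
    M.gen (X.map (vword (M.vnum v))) = (M.vclosure v X).map (M.rep.vert v) := by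
  rw [vclosure, MonoidHom.map_closure, gen]
  congr 1
  ext x
  simp [← rep_vert_vval]

theorem vert_mem_gen_iff (hM : M.Benign) (v : 𝔸.V) (X : List Word) (a : 𝔸.A v) :
    M.rep.vert v a ∈ M.gen (X.map (vword (M.vnum v))) ↔ a ∈ M.vclosure v X := by
  rw [gen_vword]
  exact Subgroup.mem_map_iff_mem (M.rep_vert_injective hM v)

open Classical in
/-- The number of the terminal vertex of the edge with a given number. -/
noncomputable def target (n : ℕ) : ℕ :=
  if h : ∃ t : Σ u v : 𝔸.V, 𝔸.E u v, M.enum t = n then M.vnum h.choose.2.1 else 0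

theorem target_enum (t : Σ u v : 𝔸.V, 𝔸.E u v) : M.target (M.enum t) = M.vnum t.2.1 := by
  have h : ∃ t' : Σ u v : 𝔸.V, 𝔸.E u v, M.enum t' = M.enum t := ⟨t, rfl⟩
  rw [target, dif_pos h, M.enum.injective h.choose_spec]

theorem primrec_target (hM : M.Benign) : Primrec M.target := by
  have := hM.finite_edges
  refine Primrec.of_finite_support ((Set.finite_range M.enum).subset fun n hn => ?_)
  by_contra h
  exact hn (dif_neg h)

/-- The word, in the common alphabet, of a path code starting at the vertex with number `n`. -/
noncomputable def pathWord (n : ℕ) (c : PathCode) : Word :=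
  vword n c.1 ++ c.2.flatMap fun x => (eletter x.1, true) :: vword (M.target x.1) x.2

theorem primrec_pathWord (hM : M.Benign) {α : Type*} [Primcodable α] {f : α → ℕ} {g : α → PathCode}
    (hf : Primrec f) (hg : Primrec g) : Primrec fun a => M.pathWord (f a) (g a) := by
  have := M.primrec_target hM
  unfold pathWord
  fun_prop

theorem wval_pathWord {u v : 𝔸.V} {c : PathCode} {p : 𝔸.Path u v} (h : M.CodesPath c p) :
    M.wval (M.pathWord (M.vnum u) c) = M.rep.val p := by
  induction h with
  | nil w => simp [pathWord, Rep.val, rep_vert_vval]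
  | cons w e w' l p _ ih =>
    rw [pathWord] at ih ⊢
    rw [List.flatMap_cons, List.cons_append, wval_append, wval_cons_true, target_enum, Rep.val,
      ← ih, rep_vert_vval, rep_edge]

theorem exists_codesPath {u v : 𝔸.V} (p : 𝔸.Path u v) : ∃ c, M.CodesPath c p := by
  induction p with
  | nil a =>
    obtain ⟨w, rfl⟩ := M.exists_word _ a
    exact ⟨_, .nil w⟩
  | cons a e p ih =>
    obtain ⟨⟨w', l⟩, h⟩ := ih
    obtain ⟨w, rfl⟩ := M.exists_word _ a
    exact ⟨_, .cons w e w' l p h⟩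

theorem exists_represents {v₀ : 𝔸.V} (g : 𝔸.Pi1 v₀) : ∃ c, M.Represents c g := by
  obtain ⟨p, rfl⟩ := Pi1.mk_surjective g
  obtain ⟨c, h⟩ := M.exists_codesPath p
  exact ⟨c, p, h, rfl⟩

theorem Represents.wval_eq {v₀ : 𝔸.V} {c : PathCode} {g : 𝔸.Pi1 v₀} (h : M.Represents c g) :
    M.wval (M.pathWord (M.vnum v₀) c) = M.rep.hom v₀ g := by
  obtain ⟨p, h, rfl⟩ := h
  exact M.wval_pathWord h

/-- `c` is the code of a closed path at `v₀`. -/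
def Closed (v₀ : 𝔸.V) (c : PathCode) : Prop := ∃ g : 𝔸.Pi1 v₀, M.Represents c g

/-- Reading off the first edge of the tail of a path code, at the vertex with a given number. -/
def ReadEdge (s s' : ℕ × List (ℕ × Word)) : Prop :=
  ∃ t : Σ u v : 𝔸.V, 𝔸.E u v, ∃ w : Word,
    s = (M.vnum t.1, (M.enum t, w) :: s'.2) ∧ s'.1 = M.vnum t.2.1

theorem CodesPath.readEdge {u v : 𝔸.V} {c : PathCode} {p : 𝔸.Path u v} (h : M.CodesPath c p) :
    Relation.ReflTransGen M.ReadEdge (M.vnum u, c.2) (M.vnum v, []) := by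
  induction h with
  | nil w => exact .refl
  | cons w e w' l p _ ih => exact .head ⟨⟨_, _, e⟩, w', rfl, rfl⟩ ih

theorem exists_codesPath_of_readEdge {s : ℕ × List (ℕ × Word)} {v : 𝔸.V}
    (h : Relation.ReflTransGen M.ReadEdge s (M.vnum v, [])) (u : 𝔸.V) (hu : M.vnum u = s.1)
    (w : Word) : ∃ p : 𝔸.Path u v, M.CodesPath (w, s.2) p := by
  induction h using Relation.ReflTransGen.head_induction_on generalizing u w with
  | refl =>
    obtain rfl := M.vnum.injective hu
    exact ⟨_, .nil w⟩
  | head h _ ih =>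
    obtain ⟨⟨x, y, e⟩, w', rfl, hy⟩ := h
    obtain rfl := M.vnum.injective hu
    obtain ⟨p, hp⟩ := ih y hy.symm w'
    exact ⟨_, .cons w e w' _ p hp⟩

theorem closed_re (hM : M.Benign) (v₀ : 𝔸.V) : IsRE (M.Closed v₀) := by
  have := hM.finite_edges
  have h : IsRE fun x : Unit × (ℕ × List (ℕ × Word)) × (ℕ × List (ℕ × Word)) =>
      M.ReadEdge x.2.1 x.2.2 := IsRE.exists_finite fun t => IsRE.ex
    ((IsRE.eq (by fun_prop) (by fun_prop)).and (IsRE.eq (by fun_prop) (by fun_prop)))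
  refine ((IsRE.reflTransGen (r := fun _ => M.ReadEdge) h).comp
    (f := fun c : PathCode => ((), (M.vnum v₀, c.2), (M.vnum v₀, []))) (by fun_prop)).of_iff
    fun c => ⟨?_, ?_⟩
  · rintro ⟨_, p, hp, -⟩
    exact hp.readEdge
  · intro h
    obtain ⟨p, hp⟩ := M.exists_codesPath_of_readEdge h v₀ rfl c.1
    exact ⟨_, p, hp, rfl⟩

/-- The words of a list of codes of closed paths generate the image of the subgroup generated by
the paths. -/
theorem gen_pathWord {v₀ : 𝔸.V} {S : List PathCode} (hS : M.IsInput v₀ S) :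
    M.gen (S.map (M.pathWord (M.vnum v₀))) = (M.generated v₀ S).map (M.rep.hom v₀) := by
  rw [generated, MonoidHom.map_closure, gen]
  congr 1
  ext x
  simp only [List.map_map, List.mem_map, Function.comp_apply, Set.mem_ofPred_eq, Set.mem_image]
  constructor
  · rintro ⟨c, hc, rfl⟩
    obtain ⟨g, hg⟩ := hS c hc
    exact ⟨g, ⟨c, hc, hg⟩, hg.wval_eq.symm⟩
  · rintro ⟨g, ⟨c, hc, hg⟩, rfl⟩
    exact ⟨c, hc, hg.wval_eq⟩

end GraphOfGroups.Marking

/-! ### Codes of `𝔸`-graphs -/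

/-- The `i`-th vertex code of a graph code. -/
def GraphCode.vcode (c : GraphCode) (i : ℕ) : VertexCode := c.1.getD i (0, [])

/-- The `j`-th edge code of a graph code. -/
def GraphCode.ecode (c : GraphCode) (j : ℕ) : EdgeCode := c.2.1.getD j ⟨0, 0, 0, 0, [], []⟩

/-- The generators of the `i`-th vertex group, in the common alphabet. -/
def GraphCode.vgens (c : GraphCode) (i : ℕ) : List Word :=
  (c.vcode i).2.map (GraphOfGroups.Marking.vword (c.vcode i).1)

/-- The first label of the `j`-th edge, in the common alphabet. -/
def GraphCode.wordα (c : GraphCode) (j : ℕ) : Word :=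
  GraphOfGroups.Marking.vword (c.vcode (c.ecode j).orig).1 (c.ecode j).wα

/-- The second label of the `j`-th edge, in the common alphabet. -/
def GraphCode.wordω (c : GraphCode) (j : ℕ) : Word :=
  GraphOfGroups.Marking.vword (c.vcode (c.ecode j).term).1 (c.ecode j).wω

/-- The word of the path consisting of the `j`-th edge and its labels. -/
def GraphCode.edgeWord (c : GraphCode) (j : ℕ) : Word :=
  c.wordα j ++ (GraphOfGroups.Marking.eletter (c.ecode j).typ, true) :: c.wordω j

namespace Primrec

variable {α : Type*} [Primcodable α] {f : α → GraphCode} {g : α → ℕ}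

theorem vcode_fun (hf : Primrec f) (hg : Primrec g) : Primrec fun a => (f a).vcode (g a) := by
  unfold GraphCode.vcode
  fun_prop

theorem ecode_fun (hf : Primrec f) (hg : Primrec g) : Primrec fun a => (f a).ecode (g a) := by
  unfold GraphCode.ecode
  fun_prop

attribute [fun_prop] vcode_fun ecode_fun

theorem vgens_fun (hf : Primrec f) (hg : Primrec g) : Primrec fun a => (f a).vgens (g a) := by
  unfold GraphCode.vgens
  fun_prop

theorem wordα_fun (hf : Primrec f) (hg : Primrec g) : Primrec fun a => (f a).wordα (g a) := by
  unfold GraphCode.wordα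
  fun_prop

theorem wordω_fun (hf : Primrec f) (hg : Primrec g) : Primrec fun a => (f a).wordω (g a) := by
  unfold GraphCode.wordω
  fun_prop

attribute [fun_prop] vgens_fun wordα_fun wordω_fun

theorem edgeWord_fun (hf : Primrec f) (hg : Primrec g) :
    Primrec fun a => (f a).edgeWord (g a) := by
  unfold GraphCode.edgeWord
  fun_prop

attribute [fun_prop] edgeWord_fun

end Primrec

namespace GraphOfGroups.Marking

variable {𝔸 : GraphOfGroups.{u₁, u₂, u₃, u₄}} (M : 𝔸.Marking)

/-- The correspondence between an `𝔸`-graph and its code: the numbers of the vertices and edges. -/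
structure Decoding (c : GraphCode) (𝓑 : AGraph.{u₁, u₂, u₃, u₄, u₅, u₆} 𝔸) (u₀ : 𝓑.V) where
  vi : 𝓑.V → ℕ
  ei : ∀ {u v : 𝓑.V}, 𝓑.E u v → ℕ
  vi_lt : ∀ u, vi u < c.1.length
  vi_inj : ∀ {u v}, vi u = vi v → u = v
  vi_surj : ∀ {i}, i < c.1.length → ∃ u, vi u = i
  ei_lt : ∀ {u v : 𝓑.V} (f : 𝓑.E u v), ei f < c.2.1.length
  ei_inj : ∀ {u v u' v' : 𝓑.V} {f : 𝓑.E u v} {f' : 𝓑.E u' v'}, ei f = ei f' →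
    (⟨u, v, f⟩ : Σ u v : 𝓑.V, 𝓑.E u v) = ⟨u', v', f'⟩
  ei_surj : ∀ {j}, j < c.2.1.length → ∃ (u v : 𝓑.V) (f : 𝓑.E u v), ei f = j
  num : ∀ u, (c.vcode (vi u)).1 = M.vnum (𝓑.vtype u)
  grp : ∀ u, 𝓑.B u = M.vclosure (𝓑.vtype u) (c.vcode (vi u)).2
  orig : ∀ {u v : 𝓑.V} (f : 𝓑.E u v), (c.ecode (ei f)).orig = vi u
  term : ∀ {u v : 𝓑.V} (f : 𝓑.E u v), (c.ecode (ei f)).term = vi v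
  rev : ∀ {u v : 𝓑.V} (f : 𝓑.E u v), (c.ecode (ei f)).rev = ei (𝓑.inv f)
  typ : ∀ {u v : 𝓑.V} (f : 𝓑.E u v),
    (c.ecode (ei f)).typ = M.enum ⟨𝓑.vtype u, 𝓑.vtype v, 𝓑.etype f⟩
  wα : ∀ {u v : 𝓑.V} (f : 𝓑.E u v), M.vval (𝓑.vtype u) (c.ecode (ei f)).wα = 𝓑.labα f
  wω : ∀ {u v : 𝓑.V} (f : 𝓑.E u v), M.vval (𝓑.vtype v) (c.ecode (ei f)).wω = 𝓑.labω f
  base : c.2.2 = vi u₀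

variable {M} {c : GraphCode} {𝓑 : AGraph.{u₁, u₂, u₃, u₄, u₅, u₆} 𝔸} {u₀ : 𝓑.V}

theorem _root_.GraphCode.vcode_eq_get (c : GraphCode) (i : Fin c.1.length) :
    c.vcode i = c.1.get i := by
  simp [GraphCode.vcode, List.getD_eq_getElem?_getD]

theorem _root_.GraphCode.ecode_eq_get (c : GraphCode) (j : Fin c.2.1.length) :
    c.ecode j = c.2.1.get j := by
  simp [GraphCode.ecode, List.getD_eq_getElem?_getD]

theorem CodesGraph.nonempty_decoding (h : M.CodesGraph c 𝓑 u₀) :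
    Nonempty (M.Decoding c 𝓑 u₀) := by
  obtain ⟨vert, edge, hv, he, hb⟩ := h
  have he' : ∀ {u v : 𝓑.V} (f : 𝓑.E u v), edge (edge.symm ⟨u, v, f⟩) = ⟨u, v, f⟩ :=
    fun f => edge.apply_symm_apply _
  refine ⟨{
    vi := fun u => vert.symm u
    ei := fun {u v} f => edge.symm ⟨u, v, f⟩
    vi_lt := fun u => (vert.symm u).2
    vi_inj := fun h => vert.symm.injective (Fin.ext h)
    vi_surj := fun {i} hi => ⟨vert ⟨i, hi⟩, by simp⟩
    ei_lt := fun f => (edge.symm _).2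
    ei_inj := fun h => edge.symm.injective (Fin.ext h)
    ei_surj := fun {j} hj => ⟨_, _, (edge ⟨j, hj⟩).2.2, by simp⟩
    num := fun u => ?_
    grp := fun u => ?_
    orig := fun f => ?_
    term := fun f => ?_
    rev := fun f => ?_
    typ := fun f => ?_
    wα := fun f => ?_
    wω := fun f => ?_
    base := hb }⟩
  · rw [GraphCode.vcode_eq_get, (hv _).1, vert.apply_symm_apply]
  · have h := (hv (vert.symm u)).2
    rw [GraphCode.vcode_eq_get]
    rwa [vert.apply_symm_apply] at h
  all_goals rw [GraphCode.ecode_eq_get]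
  · exact (he _ _ _ f (he' f)).1
  · exact (he _ _ _ f (he' f)).2.1
  · exact (he _ _ _ f (he' f)).2.2.1
  · exact (he _ _ _ f (he' f)).2.2.2.1
  · exact (he _ _ _ f (he' f)).2.2.2.2.1
  · exact (he _ _ _ f (he' f)).2.2.2.2.2

/-- A finite `𝔸`-graph whose vertex groups are generated by given words has a code. -/
theorem exists_code [Finite 𝓑.V] [Finite (Σ u v : 𝓑.V, 𝓑.E u v)] (gens : 𝓑.V → List Word)
    (hgens : ∀ u, 𝓑.B u = M.vclosure (𝓑.vtype u) (gens u)) (u₀ : 𝓑.V) :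
    ∃ (c : GraphCode) (D : M.Decoding c 𝓑 u₀), ∀ u, (c.vcode (D.vi u)).2 = gens u := by
  let vert := Finite.equivFin 𝓑.V
  let edge := Finite.equivFin (Σ u v : 𝓑.V, 𝓑.E u v)
  let code : (Σ u v : 𝓑.V, 𝓑.E u v) → EdgeCode := fun t =>
    { orig := vert t.1
      term := vert t.2.1
      rev := edge ⟨t.2.1, t.1, 𝓑.inv t.2.2⟩
      typ := M.enum ⟨_, _, 𝓑.etype t.2.2⟩
      wα := M.wordOf _ (𝓑.labα t.2.2)
      wω := M.wordOf _ (𝓑.labω t.2.2) }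
  let c : GraphCode :=
    (List.ofFn fun i => (M.vnum (𝓑.vtype (vert.symm i)), gens (vert.symm i)),
      List.ofFn fun j => code (edge.symm j), vert u₀)
  have hv : ∀ u, c.vcode (vert u) = (M.vnum (𝓑.vtype u), gens u) := fun u => by
    simp [c, GraphCode.vcode, List.getD_eq_getElem?_getD]
  have he : ∀ t, c.ecode (edge t) = code t := fun t => by
    simp [c, GraphCode.ecode, List.getD_eq_getElem?_getD]
  refine ⟨c, {
    vi := fun u => vert u
    ei := fun {u v} f => edge ⟨u, v, f⟩
    vi_lt := fun u => by simp [c]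
    vi_inj := fun h => vert.injective (Fin.ext h)
    vi_surj := fun {i} hi => ⟨vert.symm ⟨i, by simpa [c] using hi⟩, by simp⟩
    ei_lt := fun f => by simp [c]
    ei_inj := fun h => edge.injective (Fin.ext h)
    ei_surj := fun {j} hj => ⟨_, _, (edge.symm ⟨j, by simpa [c] using hj⟩).2.2, by simp⟩
    num := fun u => by rw [hv]
    grp := fun u => by rw [hv, hgens]
    orig := fun f => by rw [he]
    term := fun f => by rw [he]
    rev := fun f => by rw [he]
    typ := fun f => by rw [he]
    wα := fun f => by rw [he]; exact M.vval_wordOf _ _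
    wω := fun f => by rw [he]; exact M.vval_wordOf _ _
    base := rfl }, fun u => by
      change (c.vcode (vert u)).2 = _
      rw [hv]⟩

namespace Decoding

variable (D : M.Decoding c 𝓑 u₀)

theorem wval_wordα {u v : 𝓑.V} (f : 𝓑.E u v) :
    M.wval (c.wordα (D.ei f)) = M.rep.vert _ (𝓑.labα f) := by
  rw [GraphCode.wordα, D.orig, D.num, ← rep_vert_vval, D.wα]

theorem wval_wordω {u v : 𝓑.V} (f : 𝓑.E u v) :
    M.wval (c.wordω (D.ei f)) = M.rep.vert _ (𝓑.labω f) := by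
  rw [GraphCode.wordω, D.term, D.num, ← rep_vert_vval, D.wω]

theorem wval_edgeWord {u v : 𝓑.V} (f : 𝓑.E u v) : M.wval (c.edgeWord (D.ei f)) =
    M.rep.vert _ (𝓑.labα f) * (M.rep.edge (𝓑.etype f) * M.rep.vert _ (𝓑.labω f)) := by
  rw [GraphCode.edgeWord, wval_append, wval_cons_true, D.wval_wordα, D.wval_wordω, D.typ, rep_edge]

theorem vgens_eq (u : 𝓑.V) : c.vgens (D.vi u) =
    (c.vcode (D.vi u)).2.map (vword (M.vnum (𝓑.vtype u))) := by
  rw [GraphCode.vgens, D.num]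

theorem gen_vgens (u : 𝓑.V) : M.gen (c.vgens (D.vi u)) = (𝓑.B u).map (M.rep.vert (𝓑.vtype u)) := by
  rw [D.vgens_eq, gen_vword, D.grp]

theorem vert_mem_gen_vgens (hM : M.Benign) (u : 𝓑.V) (a : 𝔸.A (𝓑.vtype u)) :
    M.rep.vert _ a ∈ M.gen (c.vgens (D.vi u)) ↔ a ∈ 𝓑.B u := by
  rw [D.vgens_eq, M.vert_mem_gen_iff hM, D.grp]

theorem exists_vlist {β : Type*} (F : 𝓑.V → β) (d : β) :
    ∃ L : List β, L.length = c.1.length ∧ ∀ u, L.getD (D.vi u) d = F u := by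
  classical
  refine ⟨(List.range c.1.length).map fun i => if h : ∃ u, D.vi u = i then F h.choose else d,
    by simp, fun u => ?_⟩
  have h : ∃ u', D.vi u' = D.vi u := ⟨u, rfl⟩
  simp [List.getD_eq_getElem?_getD, D.vi_lt u, D.vi_inj h.choose_spec]

theorem exists_elist {β : Type*} (F : ∀ {u v : 𝓑.V}, 𝓑.E u v → β) (d : β) :
    ∃ L : List β, ∀ (u v : 𝓑.V) (f : 𝓑.E u v), L.getD (D.ei f) d = F f := by
  classical
  refine ⟨(List.range c.2.1.length).map fun i =>
    if h : ∃ t : Σ u v : 𝓑.V, 𝓑.E u v, D.ei t.2.2 = i then F h.choose.2.2 else d,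
    fun u v f => ?_⟩
  have h : ∃ t : Σ u v : 𝓑.V, 𝓑.E u v, D.ei t.2.2 = D.ei f := ⟨⟨u, v, f⟩, rfl⟩
  have h1 := D.ei_inj h.choose_spec
  simp only [List.getD_eq_getElem?_getD, List.getElem?_map, List.getElem?_range (D.ei_lt f),
    Option.map_some, Option.getD_some, dif_pos h]
  generalize h.choose = t at h1
  cases h1
  rfl

end Decoding

/-! ### Validity of codes -/

variable (M)

/-- The `j`-th edge code is consistent with the rest of the code. -/
def ValidEdge (c : GraphCode) (j : ℕ) : Prop :=
  ((c.ecode j).orig < c.1.length ∧ (c.ecode j).term < c.1.length ∧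
    (c.ecode j).rev < c.2.1.length ∧ (c.ecode j).rev ≠ j) ∧
  ((c.ecode (c.ecode j).rev).orig = (c.ecode j).term ∧
    (c.ecode (c.ecode j).rev).term = (c.ecode j).orig ∧ (c.ecode (c.ecode j).rev).rev = j) ∧
  M.wval (c.wordα (c.ecode j).rev ++ c.wordω j) = M.wval [] ∧
  ∃ t : Σ u v : 𝔸.V, 𝔸.E u v, (c.ecode j).typ = M.enum t ∧
    (c.ecode (c.ecode j).rev).typ = M.enum ⟨t.2.1, t.1, 𝔸.inv t.2.2⟩ ∧
    (c.vcode (c.ecode j).orig).1 = M.vnum t.1 ∧ (c.vcode (c.ecode j).term).1 = M.vnum t.2.1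

/-- `c` is the code of some `𝔸`-graph. -/
def Valid (c : GraphCode) : Prop :=
  c.2.2 < c.1.length ∧ (∀ i < c.1.length, ∃ v, (c.vcode i).1 = M.vnum v) ∧
    ∀ j < c.2.1.length, M.ValidEdge c j

theorem valid_re (hM : M.Benign) : IsRE M.Valid := by
  have := hM.finite_vertices
  have := hM.finite_edges
  refine (IsRE.lt (by fun_prop) (by fun_prop)).and (IsRE.and ?_ ?_)
  · exact IsRE.forall_lt (by fun_prop) (IsRE.exists_finite fun v =>
      IsRE.eq (by fun_prop) (by fun_prop))
  · refine IsRE.forall_lt (by fun_prop) (IsRE.and ?_ (IsRE.and ?_ (IsRE.and ?_ ?_)))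
    · exact (IsRE.lt (by fun_prop) (by fun_prop)).and ((IsRE.lt (by fun_prop) (by fun_prop)).and
        ((IsRE.lt (by fun_prop) (by fun_prop)).and (IsRE.ne (by fun_prop) (by fun_prop))))
    · exact (IsRE.eq (by fun_prop) (by fun_prop)).and ((IsRE.eq (by fun_prop) (by fun_prop)).and
        (IsRE.eq (by fun_prop) (by fun_prop)))
    · exact M.wval_eq_re hM (by fun_prop) (by fun_prop)
    · exact IsRE.exists_finite fun t => (IsRE.eq (by fun_prop) (by fun_prop)).and
        ((IsRE.eq (by fun_prop) (by fun_prop)).and ((IsRE.eq (by fun_prop) (by fun_prop)).and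
          (IsRE.eq (by fun_prop) (by fun_prop))))

variable {M}

theorem Decoding.valid (D : M.Decoding c 𝓑 u₀) : M.Valid c := by
  refine ⟨D.base ▸ D.vi_lt u₀, fun i hi => ?_, fun j hj => ?_⟩
  · obtain ⟨u, rfl⟩ := D.vi_surj hi
    exact ⟨_, D.num u⟩
  · obtain ⟨u, v, f, rfl⟩ := D.ei_surj hj
    rw [ValidEdge, D.rev, D.orig, D.term, D.orig, D.term, D.rev, D.typ, D.typ, D.num, D.num,
      𝓑.inv_inv]
    refine ⟨⟨D.vi_lt _, D.vi_lt _, D.ei_lt _, fun h => ?_⟩, ⟨rfl, rfl, rfl⟩, ?_,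
      ⟨⟨_, _, 𝓑.etype f⟩, rfl, ?_, rfl, rfl⟩⟩
    · have h1 := D.ei_inj h
      obtain rfl : v = u := congrArg Sigma.fst h1
      simp only [Sigma.mk.injEq, heq_eq_eq, true_and] at h1
      exact 𝓑.inv_ne f h1
    · rw [wval_append, D.wval_wordα, D.wval_wordω, 𝓑.labα_inv, map_inv, inv_mul_cancel, wval_nil]
    · rw [𝓑.etype_inv]

/-- A valid code is the code of some `𝔸`-graph. -/
theorem Valid.exists_graph (hM : M.Benign) (hc : M.Valid c) :
    ∃ (𝓑 : AGraph.{u₁, u₂, u₃, u₄, 0, 0} 𝔸) (u₀ : 𝓑.V), M.CodesGraph c 𝓑 u₀ := by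
  obtain ⟨hb, hv, he⟩ := hc
  have hv' : ∀ i : Fin c.1.length, ∃ v, (c.vcode i).1 = M.vnum v := fun i => hv i i.2
  choose vt hvt using hv'
  let E : Fin c.1.length → Fin c.1.length → Type := fun x y =>
    {j : Fin c.2.1.length // (c.ecode j).orig = x ∧ (c.ecode j).term = y}
  let inv : ∀ {x y}, E x y → E y x := fun {x y} j =>
    ⟨⟨(c.ecode j.1).rev, (he _ j.1.2).1.2.2.1⟩, (he _ j.1.2).2.1.1.trans j.2.2,
      (he _ j.1.2).2.1.2.1.trans j.2.1⟩
  have het : ∀ x y (j : E x y), ∃ e : 𝔸.E (vt x) (vt y), (c.ecode j.1).typ = M.enum ⟨_, _, e⟩ ∧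
      (c.ecode (inv j).1).typ = M.enum ⟨_, _, 𝔸.inv e⟩ := by
    rintro x y ⟨j, hx, hy⟩
    obtain ⟨⟨u, v, e⟩, h1, h2, h3, h4⟩ := (he _ j.2).2.2.2
    rw [hx, hvt] at h3
    rw [hy, hvt] at h4
    obtain rfl := M.vnum.injective h3
    obtain rfl := M.vnum.injective h4
    exact ⟨e, h1, h2⟩
  choose et het using het
  have hinv : ∀ x y (j : E x y), inv (inv j) = j := fun x y j =>
    Subtype.ext (Fin.ext (he _ j.1.2).2.1.2.2)
  let 𝓑 : AGraph.{u₁, u₂, u₃, u₄, 0, 0} 𝔸 :=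
    { V := Fin c.1.length
      E := E
      inv := inv
      inv_inv := fun j => hinv _ _ j
      inv_ne := fun j h => (he _ j.1.2).1.2.2.2 (congrArg (fun j => (j.1 : ℕ)) h)
      vtype := vt
      etype := fun j => et _ _ j
      etype_inv := fun {x y} j => by
        have h := M.enum.injective ((het _ _ (inv j)).1.symm.trans (het _ _ j).2)
        simpa using h
      B := fun i => M.vclosure (vt i) (c.vcode i).2
      labα := fun {x y} j => M.vval (vt x) (c.ecode j.1).wα
      labω := fun {x y} j => M.vval (vt y) (c.ecode j.1).wω
      labα_inv := fun {x y} j => by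
        have h := (he _ j.1.2).2.2.1
        rw [wval_append, GraphCode.wordα, GraphCode.wordω, (he _ j.1.2).2.1.1, j.2.2, hvt,
          ← rep_vert_vval, ← rep_vert_vval, wval_nil, ← map_mul, ← map_one (M.rep.vert _)] at h
        exact eq_inv_of_mul_eq_one_left (M.rep_vert_injective hM _ h) }
  refine ⟨𝓑, ⟨c.2.2, hb⟩, Equiv.refl _,
    { toFun := fun j => ⟨⟨_, (he _ j.2).1.1⟩, ⟨_, (he _ j.2).1.2.1⟩, ⟨j, rfl, rfl⟩⟩
      invFun := fun t => t.2.2.1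
      left_inv := fun j => rfl
      right_inv := fun t => ?_ }, fun i => ?_, fun j u v f hf => ?_, rfl⟩
  · obtain ⟨⟨x, hx⟩, ⟨y, hy⟩, ⟨j, h1, h2⟩⟩ := t
    dsimp at h1 h2
    subst h1 h2
    rfl
  · rw [← GraphCode.vcode_eq_get]
    exact ⟨hvt i, rfl⟩
  · have h1 : f.1 = j := by
      have h2 := congrArg (fun t : Σ u v : 𝓑.V, 𝓑.E u v => t.2.2.1) hf
      exact h2.symm
    rw [← GraphCode.ecode_eq_get]
    subst h1
    exact ⟨f.2.1, f.2.2, rfl, (het _ _ f).1, rfl, rfl⟩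

end GraphOfGroups.Marking

namespace GraphOfGroups.Marking

variable {𝔸 : GraphOfGroups.{u₁, u₂, u₃, u₄}} (M : 𝔸.Marking)

open _root_.GraphOfGroups.Path

/-! ### Recognizing folded `𝔸`-graphs -/

/-- `⟨X⟩ ∩ a α_e(A_e)` is empty, for the edge `e` with number `n`. -/
def EmptyCoset (n : ℕ) (X : List Word) (a : Word) : Prop :=
  ∃ t : Σ u v : 𝔸.V, 𝔸.E u v, M.enum t = n ∧ M.cosetInter t.2.2 X a = ∅

theorem emptyCoset_iff {u v : 𝔸.V} (e : 𝔸.E u v) (X : List Word) (a : Word) :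
    M.EmptyCoset (M.enum ⟨u, v, e⟩) X a ↔ M.cosetInter e X a = ∅ := by
  refine ⟨?_, fun h => ⟨_, rfl, h⟩⟩
  rintro ⟨t, ht, h⟩
  obtain rfl := M.enum.injective ht
  exact h

theorem emptyCoset_re (hM : M.Benign) {α : Type*} [Primcodable α] {f : α → ℕ} {g : α → List Word}
    {k : α → Word} (hf : Primrec f) (hg : Primrec g) (hk : Primrec k) :
    IsRE fun a => M.EmptyCoset (f a) (g a) (k a) := by
  have := hM.finite_edges
  refine IsRE.exists_finite fun t => (IsRE.eq (by fun_prop) (by fun_prop)).and ?_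
  obtain ⟨P, hP, hPR, hex⟩ := IsRE.of_existsAlgorithm (hM.coset t.2.2)
  refine (hP.comp (f := fun a => ((g a, k a), (none : Option Word))) (by fun_prop)).of_iff
    fun a => ⟨fun h => ?_, fun h => hPR _ _ h⟩
  obtain ⟨_ | w, hw⟩ := hex (g a, k a)
  · exact hw
  · have h1 := hPR _ _ hw
    simp only [h] at h1
    exact absurd h1 (Set.notMem_empty _)

/-- The algorithms for the intersections `α_e(A_e) ∩ ⟨X⟩`, combined for all edges into one recursively
enumerable relation. -/
theorem Benign.exists_interGens (hM : M.Benign) : ∃ I : ℕ → List Word → List Word → Prop,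
    (IsRE fun x : ℕ × List Word × List Word => I x.1 x.2.1 x.2.2) ∧
    (∀ {u v : 𝔸.V} (e : 𝔸.E u v) X out, I (M.enum ⟨u, v, e⟩) X out →
      M.vclosure u out = (𝔸.α e).range ⊓ M.vclosure u X) ∧
    ∀ {u v : 𝔸.V} (e : 𝔸.E u v) X, ∃ out, I (M.enum ⟨u, v, e⟩) X out := by
  have := hM.finite_edges
  choose P hP hPR hex using fun t : Σ u v : 𝔸.V, 𝔸.E u v =>
    IsRE.of_existsAlgorithm (hM.inter t.2.2)
  refine ⟨fun n X out => ∃ t, M.enum t = n ∧ P t X out, IsRE.exists_finite fun t =>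
    (IsRE.eq (by fun_prop) (by fun_prop)).and ((hP t).comp (f := fun x : ℕ × List Word × List Word =>
      (x.2.1, x.2.2)) (by fun_prop)), ?_, fun {u v} e X => ?_⟩
  · rintro u v e X out ⟨t, ht, h⟩
    obtain rfl := M.enum.injective ht
    exact hPR _ _ _ h
  · obtain ⟨out, h⟩ := hex ⟨u, v, e⟩ X
    exact ⟨out, _, rfl, h⟩

variable {M}

/-- `vclosure out = α_e(A_e) ∩ ⟨X⟩` as found by the intersection algorithm. -/
def InterGens (hM : M.Benign) : ℕ → List Word → List Word → Prop := hM.exists_interGens.choose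

theorem interGens_re (hM : M.Benign) {α : Type*} [Primcodable α] {f : α → ℕ}
    {g k : α → List Word} (hf : Primrec f) (hg : Primrec g) (hk : Primrec k) :
    IsRE fun a => InterGens hM (f a) (g a) (k a) :=
  hM.exists_interGens.choose_spec.1.comp (f := fun a => (f a, g a, k a)) (by fun_prop)

variable {c : GraphCode} {𝓑 : AGraph.{u₁, u₂, u₃, u₄, u₅, u₆} 𝔸} {u₀ : 𝓑.V}

theorem vval_append (v : 𝔸.V) (w w' : Word) : M.vval v (w ++ w') = M.vval v w * M.vval v w' :=
  evalWord_append (fun i => (M.vgen v).getD i 1) w w'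

theorem vval_invRev (v : 𝔸.V) (w : Word) : M.vval v (FreeGroup.invRev w) = (M.vval v w)⁻¹ :=
  evalWord_invRev (fun i => (M.vgen v).getD i 1) w

/-- Generators of the conjugate `g⁻¹ ⟨X⟩ g`. -/
def conjGens (g : Word) (X : List Word) : List Word :=
  X.map fun w => FreeGroup.invRev g ++ (w ++ g)

theorem _root_.Primrec.conjGens_fun {α : Type*} [Primcodable α] {f : α → Word}
    {g : α → List Word} (hf : Primrec f) (hg : Primrec g) :
    Primrec fun a => conjGens (f a) (g a) := by
  unfold conjGens
  fun_prop

attribute [fun_prop] Primrec.conjGens_fun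

theorem mem_vclosure_conjGens (v : 𝔸.V) (g : Word) (X : List Word) (a : 𝔸.A v) :
    a ∈ M.vclosure v (conjGens g X) ↔ M.vval v g * a * (M.vval v g)⁻¹ ∈ M.vclosure v X := by
  have h : M.vclosure v (conjGens g X) =
      (M.vclosure v X).map (MulAut.conj (M.vval v g)⁻¹).toMonoidHom := by
    rw [vclosure, vclosure, MonoidHom.map_closure]
    congr 1
    ext x
    simp [conjGens, vval_append, vval_invRev, mul_assoc]
  rw [h, Subgroup.mem_map]
  constructor
  · rintro ⟨b, hb, rfl⟩
    simpa [mul_assoc] using hb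
  · intro h
    exact ⟨_, h, by simp [mul_assoc]⟩

variable (M) in
/-- No two edges of the coded `𝔸`-graph can be folded together. -/
def Fold1 (c : GraphCode) : Prop :=
  ∀ j₁ < c.2.1.length, ∀ j₂ < c.2.1.length, j₁ = j₂ ∨ (c.ecode j₁).orig ≠ (c.ecode j₂).orig ∨
    (c.ecode j₁).typ ≠ (c.ecode j₂).typ ∨
    M.EmptyCoset (c.ecode j₁).typ
      (conjGens (c.ecode j₂).wα (c.vcode (c.ecode j₁).orig).2)
      (FreeGroup.invRev (c.ecode j₂).wα ++ (c.ecode j₁).wα)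

theorem fold1_re (hM : M.Benign) : IsRE M.Fold1 := by
  refine IsRE.forall_lt (by fun_prop) (IsRE.forall_lt (by fun_prop) ?_)
  exact (IsRE.eq (by fun_prop) (by fun_prop)).or ((IsRE.ne (by fun_prop) (by fun_prop)).or
    ((IsRE.ne (by fun_prop) (by fun_prop)).or
      (M.emptyCoset_re hM (by fun_prop) (by fun_prop) (by fun_prop))))

theorem cosetInter_eq_empty_iff {v w : 𝔸.V} (e : 𝔸.E v w) (X : List Word) (a₁ a₂ : Word) :
    M.cosetInter e (conjGens a₂ X) (FreeGroup.invRev a₂ ++ a₁) = ∅ ↔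
      ¬ ∃ a' ∈ M.vclosure v X, ∃ d : 𝔸.Ae e, M.vval v a₂ = a' * M.vval v a₁ * 𝔸.α e d := by
  rw [Set.eq_empty_iff_forall_notMem, not_exists]
  constructor
  · rintro h a' ⟨ha', d, hd⟩
    refine h ((M.vval v a₂)⁻¹ * a'⁻¹ * M.vval v a₂) ⟨?_, d, ?_⟩
    · rw [mem_vclosure_conjGens]
      simpa [mul_assoc] using ha'
    · rw [vval_append, vval_invRev]
      nth_rw 2 [hd]
      group
  · rintro h x ⟨hx, d, hd⟩
    rw [mem_vclosure_conjGens] at hx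
    rw [vval_append, vval_invRev] at hd
    refine h _ ⟨Subgroup.inv_mem _ hx, d, ?_⟩
    rw [hd]
    group

theorem Decoding.fold1_iff (D : M.Decoding c 𝓑 u₀) : M.Fold1 c ↔
    ¬ ∃ (z x y : 𝓑.V) (f₁ : 𝓑.E z x) (f₂ : 𝓑.E z y),
      (⟨x, f₁⟩ : Σ t, 𝓑.E z t) ≠ ⟨y, f₂⟩ ∧
      (⟨𝓑.vtype x, 𝓑.etype f₁⟩ : Σ t, 𝔸.E (𝓑.vtype z) t) = ⟨𝓑.vtype y, 𝓑.etype f₂⟩ ∧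
      ∃ a' ∈ 𝓑.B z, ∃ c : 𝔸.Ae (𝓑.etype f₁),
        𝓑.labα f₂ = a' * 𝓑.labα f₁ * 𝔸.α (𝓑.etype f₁) c := by
  constructor
  · rintro h ⟨z, x, y, f₁, f₂, hne, htyp, hlab⟩
    rcases h _ (D.ei_lt f₁) _ (D.ei_lt f₂) with h | h | h | h
    · have h1 := D.ei_inj h
      simp only [Sigma.mk.injEq, heq_eq_eq, true_and] at h1
      exact hne (Sigma.ext h1.1 h1.2)
    · rw [D.orig, D.orig] at h
      exact h rfl
    · rw [D.typ, D.typ] at h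
      exact h (congrArg (fun s => M.enum ⟨_, s.1, s.2⟩) htyp)
    · rw [D.typ, emptyCoset_iff, cosetInter_eq_empty_iff, D.orig, ← D.grp, D.wα, D.wα] at h
      exact h hlab
  · intro h j₁ hj₁ j₂ hj₂
    obtain ⟨z, x, f₁, rfl⟩ := D.ei_surj hj₁
    obtain ⟨z', y, f₂, rfl⟩ := D.ei_surj hj₂
    by_contra! hc
    obtain ⟨h1, h2, h3, h4⟩ := hc
    rw [D.orig, D.orig] at h2
    obtain rfl := D.vi_inj h2
    rw [D.typ, D.typ] at h3
    have h5 := M.enum.injective h3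
    simp only [Sigma.mk.injEq, heq_eq_eq, true_and] at h5
    rw [D.typ, emptyCoset_iff, cosetInter_eq_empty_iff, D.orig, ← D.grp, D.wα, D.wα,
      not_not] at h4
    refine h ⟨z, x, y, f₁, f₂, fun h => ?_, Sigma.ext h5.1 h5.2, h4⟩
    cases h
    exact h1 rfl

/-- Generators of `α_e(A_e) ∩ f_α⁻¹ B_{o(f)} f_α`, for the `j`-th edge `f` and its type `e`. -/
def EdgeGens (hM : M.Benign) (c : GraphCode) (j : ℕ) (out : List Word) : Prop :=
  InterGens hM (c.ecode j).typ (conjGens (c.ecode j).wα (c.vcode (c.ecode j).orig).2) out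

theorem edgeGens_re (hM : M.Benign) {α : Type*} [Primcodable α] {f : α → GraphCode} {g : α → ℕ}
    {k : α → List Word} (hf : Primrec f) (hg : Primrec g) (hk : Primrec k) :
    IsRE fun a => EdgeGens hM (f a) (g a) (k a) :=
  interGens_re hM (by fun_prop) (by fun_prop) hk

theorem Decoding.exists_edgeGens (D : M.Decoding c 𝓑 u₀) (hM : M.Benign) {u v : 𝓑.V}
    (f : 𝓑.E u v) : ∃ out, EdgeGens hM c (D.ei f) out := by
  simp only [EdgeGens, D.typ]
  exact hM.exists_interGens.choose_spec.2.2 _ _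

theorem Decoding.edgeGens_spec (D : M.Decoding c 𝓑 u₀) {hM : M.Benign} {u v : 𝓑.V}
    {f : 𝓑.E u v} {out : List Word} (h : EdgeGens hM c (D.ei f) out) :
    M.vclosure (𝓑.vtype u) out = (𝓑.edgeα f).map (𝔸.α (𝓑.etype f)) := by
  rw [EdgeGens, D.typ, D.orig] at h
  rw [hM.exists_interGens.choose_spec.2.1 _ _ _ h]
  have key : ∀ a, a ∈ M.vclosure (𝓑.vtype u) (conjGens (c.ecode (D.ei f)).wα
      (c.vcode (D.vi u)).2) ↔ 𝓑.labα f * a * (𝓑.labα f)⁻¹ ∈ 𝓑.B u := fun a => by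
    rw [mem_vclosure_conjGens, D.wα, D.grp]
  ext a
  rw [Subgroup.mem_inf, key]
  constructor
  · rintro ⟨⟨d, rfl⟩, h⟩
    exact ⟨d, h, rfl⟩
  · rintro ⟨d, h, rfl⟩
    exact ⟨⟨d, rfl⟩, h⟩

/-- The elements found by the intersection algorithm come from the edge group. -/
theorem Decoding.exists_of_edgeGens (D : M.Decoding c 𝓑 u₀) {hM : M.Benign} {u v : 𝓑.V}
    {f : 𝓑.E u v} {out : List Word} (h : EdgeGens hM c (D.ei f) out) {o : Word} (ho : o ∈ out) :
    ∃ d ∈ 𝓑.edgeα f, 𝔸.α (𝓑.etype f) d = M.vval _ o := by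
  have h1 : M.vval (𝓑.vtype u) o ∈ M.vclosure (𝓑.vtype u) out :=
    Subgroup.subset_closure (List.mem_map_of_mem ho)
  rw [D.edgeGens_spec h] at h1
  exact h1

/-- The elements found by the intersection algorithm generate the edge group. -/
theorem Decoding.edgeα_le_of_edgeGens (D : M.Decoding c 𝓑 u₀) {hM : M.Benign} {u v : 𝓑.V}
    {f : 𝓑.E u v} {out : List Word} (h : EdgeGens hM c (D.ei f) out)
    {K : Subgroup (𝔸.Ae (𝓑.etype f))}
    (hK : ∀ o ∈ out, ∀ d ∈ 𝓑.edgeα f, 𝔸.α (𝓑.etype f) d = M.vval _ o → d ∈ K) :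
    𝓑.edgeα f ≤ K := by
  have h1 : M.vclosure (𝓑.vtype u) out ≤ K.map (𝔸.α (𝓑.etype f)) := by
    refine (Subgroup.closure_le _).2 fun a ha => ?_
    obtain ⟨o, ho, rfl⟩ := List.mem_map.1 ha
    obtain ⟨d, hd, hdo⟩ := D.exists_of_edgeGens h ho
    exact ⟨d, hK o ho d hd hdo, hdo⟩
  rw [D.edgeGens_spec h] at h1
  exact (Subgroup.map_le_map_iff_of_injective (𝔸.α_injective _)).1 h1

/-- For a word `o` representing `α_e(d)`, a word for `f_α α_e(d) f_α⁻¹`. -/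
def _root_.GraphCode.wordA (c : GraphCode) (j : ℕ) (o : Word) : Word :=
  c.wordα j ++ (vword (c.vcode (c.ecode j).orig).1 o ++ FreeGroup.invRev (c.wordα j))

/-- For a word `o` representing `α_e(d)`, a word for `f_ω⁻¹ ω_e(d) f_ω`. -/
def _root_.GraphCode.wordO (c : GraphCode) (j : ℕ) (o : Word) : Word :=
  FreeGroup.invRev (c.wordω j) ++ (eletter (c.ecode j).typ, false) ::
    (vword (c.vcode (c.ecode j).orig).1 o ++ (eletter (c.ecode j).typ, true) :: c.wordω j)

theorem _root_.Primrec.wordA_fun {α : Type*} [Primcodable α] {f : α → GraphCode} {g : α → ℕ}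
    {k : α → Word} (hf : Primrec f) (hg : Primrec g) (hk : Primrec k) :
    Primrec fun a => (f a).wordA (g a) (k a) := by
  unfold GraphCode.wordA
  fun_prop

theorem _root_.Primrec.wordO_fun {α : Type*} [Primcodable α] {f : α → GraphCode} {g : α → ℕ}
    {k : α → Word} (hf : Primrec f) (hg : Primrec g) (hk : Primrec k) :
    Primrec fun a => (f a).wordO (g a) (k a) := by
  unfold GraphCode.wordO
  fun_prop

attribute [fun_prop] Primrec.wordA_fun Primrec.wordO_fun

theorem Decoding.wval_wordA (D : M.Decoding c 𝓑 u₀) {u v : 𝓑.V} (f : 𝓑.E u v)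
    {d : 𝔸.Ae (𝓑.etype f)} {o : Word} (hd : 𝔸.α (𝓑.etype f) d = M.vval _ o) :
    M.wval (c.wordA (D.ei f) o) = M.rep.vert _ (𝓑.conjα f d) := by
  rw [GraphCode.wordA, wval_append, wval_append, wval_invRev, D.wval_wordα, D.orig, D.num,
    ← rep_vert_vval, ← hd]
  simp [AGraph.conjα, mul_assoc]

theorem Decoding.wval_wordO (D : M.Decoding c 𝓑 u₀) {u v : 𝓑.V} (f : 𝓑.E u v)
    {d : 𝔸.Ae (𝓑.etype f)} {o : Word} (hd : 𝔸.α (𝓑.etype f) d = M.vval _ o) :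
    M.wval (c.wordO (D.ei f) o) = M.rep.vert _ (𝓑.conjω f d) := by
  have h1 := M.rep.edge_mul (𝓑.etype f) d
  rw [GraphCode.wordO, wval_append, wval_cons_false, wval_append,
    M.wval_cons_true _ (c.wordω _), wval_invRev,
    D.wval_wordω, D.orig, D.num, D.typ, ← rep_vert_vval, ← hd, ← rep_edge,
    ← mul_assoc (M.rep.vert _ (𝔸.α _ d)), ← h1]
  simp [AGraph.conjω, mul_assoc]

/-- The edge groups of the coded `𝔸`-graph agree at both ends of each edge. -/
def Fold2 (hM : M.Benign) (c : GraphCode) : Prop :=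
  ∀ j < c.2.1.length, ∃ out, EdgeGens hM c j out ∧
    ∀ o ∈ out, M.wval (c.wordO j o) ∈ M.gen (c.vgens (c.ecode j).term)

theorem fold2_re (hM : M.Benign) : IsRE (Fold2 hM) := by
  refine IsRE.forall_lt (by fun_prop) (IsRE.ex (IsRE.and ?_ ?_))
  · exact edgeGens_re hM (by fun_prop) (by fun_prop) (by fun_prop)
  · exact IsRE.forall_mem (by fun_prop) (M.mem_gen_re hM (by fun_prop) (by fun_prop))

theorem Decoding.fold2_iff (D : M.Decoding c 𝓑 u₀) (hM : M.Benign) : Fold2 hM c ↔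
    ¬ ∃ (u v : 𝓑.V) (f : 𝓑.E u v), 𝓑.edgeα f ≠ 𝓑.edgeω f := by
  constructor
  · intro h
    have hle : ∀ {u v : 𝓑.V} (f : 𝓑.E u v), 𝓑.edgeα f ≤ 𝓑.edgeω f := by
      intro u v f
      obtain ⟨out, h1, h2⟩ := h _ (D.ei_lt f)
      refine D.edgeα_le_of_edgeGens h1 fun o ho d hd hdo => ?_
      have h3 := h2 o ho
      rw [D.wval_wordO f hdo, D.term, D.vert_mem_gen_vgens hM] at h3
      exact h3
    rintro ⟨u, v, f, hne⟩
    refine hne (le_antisymm (hle f) fun d hd => ?_)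
    obtain ⟨φ, hφ⟩ := 𝓑.exists_rev f
    have h1 : φ d ∈ 𝓑.edgeα (𝓑.inv f) := by
      change 𝓑.conjα (𝓑.inv f) (φ d) ∈ 𝓑.B v
      rw [(hφ d).1]
      exact hd
    have h2 := hle _ h1
    change 𝓑.conjω (𝓑.inv f) (φ d) ∈ 𝓑.B u at h2
    rw [(hφ d).2] at h2
    exact h2
  · intro h j hj
    obtain ⟨u, v, f, rfl⟩ := D.ei_surj hj
    obtain ⟨out, h1⟩ := D.exists_edgeGens hM f
    refine ⟨out, h1, fun o ho => ?_⟩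
    obtain ⟨d, hd, hdo⟩ := D.exists_of_edgeGens h1 ho
    rw [D.wval_wordO f hdo, D.term, D.vert_mem_gen_vgens hM]
    have h2 : 𝓑.edgeα f = 𝓑.edgeω f := by
      by_contra h3
      exact h ⟨u, v, f, h3⟩
    rw [h2] at hd
    exact hd

theorem Decoding.folded_iff (D : M.Decoding c 𝓑 u₀) (hM : M.Benign) :
    M.Fold1 c ∧ Fold2 hM c ↔ 𝓑.Folded := by
  rw [D.fold1_iff, D.fold2_iff hM]
  rfl

/-! ### Recognizing that no edge is superfluous -/

variable (M) in
/-- The `j'`-th edge can follow the `j`-th edge in a reduced path. -/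
def NextEdge (c : GraphCode) (j j' : ℕ) : Prop :=
  j' < c.2.1.length ∧ (c.ecode j').orig = (c.ecode j).term ∧
    ∃ w, M.wval (vword (c.vcode (c.ecode j).term).1 w) ∈ M.gen (c.vgens (c.ecode j).term) ∧
      ((c.ecode j').typ ≠ (c.ecode (c.ecode j).rev).typ ∨
        M.EmptyCoset (c.ecode (c.ecode j).rev).typ []
          ((c.ecode j).wω ++ (w ++ (c.ecode j').wα)))

variable (M) in
/-- Each edge can be continued to a reduced path to the base vertex. -/
def Core (c : GraphCode) : Prop :=
  ∀ j < c.2.1.length, ∃ j', Relation.ReflTransGen (M.NextEdge c) j j' ∧ (c.ecode j').term = c.2.2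

theorem core_re (hM : M.Benign) : IsRE M.Core := by
  have h : IsRE fun x : GraphCode × ℕ × ℕ => M.NextEdge x.1 x.2.1 x.2.2 := by
    refine (IsRE.lt (by fun_prop) (by fun_prop)).and ((IsRE.eq (by fun_prop) (by fun_prop)).and
      (IsRE.ex (IsRE.and ?_ (IsRE.or ?_ ?_))))
    · exact M.mem_gen_re hM (by fun_prop) (by fun_prop)
    · exact IsRE.ne (by fun_prop) (by fun_prop)
    · exact M.emptyCoset_re hM (by fun_prop) (by fun_prop) (by fun_prop)
  refine IsRE.forall_lt (by fun_prop) (IsRE.ex (IsRE.and ?_ (IsRE.eq (by fun_prop) (by fun_prop))))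
  exact (IsRE.reflTransGen h).comp
    (f := fun x : (GraphCode × ℕ) × ℕ => (x.1.1, x.1.2, x.2)) (by fun_prop)

theorem cancels_cons_iff_cosetInter {u v w x : 𝔸.V} (e : 𝔸.E u v) (e' : 𝔸.E v w) (a : Word)
    (p : 𝔸.Path w x) : Cancels e (cons (M.vval v a) e' p) ↔
      M.enum ⟨v, w, e'⟩ = M.enum ⟨v, u, 𝔸.inv e⟩ ∧ M.cosetInter (𝔸.inv e) [] a ≠ ∅ := by
  have h0 : M.cosetInter (𝔸.inv e) [] a ≠ ∅ ↔ ∃ d, M.vval v a = 𝔸.ω e d := by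
    rw [← Set.nonempty_iff_ne_empty]
    constructor
    · rintro ⟨x, hx, d, hd⟩
      have hx1 : x = 1 := by simpa [vclosure] using hx
      obtain ⟨d', hd', -⟩ := exists_edge_of_inv e d⁻¹
      refine ⟨d', ?_⟩
      rw [← hd', map_inv, eq_inv_iff_mul_eq_one, ← hd, hx1]
    · rintro ⟨d, hd⟩
      obtain ⟨d', hd', -⟩ := exists_inv_of_edge e d⁻¹
      refine ⟨1, Subgroup.one_mem _, d', ?_⟩
      rw [hd', hd, map_inv, mul_inv_cancel]
  rw [h0]
  constructor
  · rintro ⟨d, r, h⟩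
    obtain ⟨h1, h2⟩ := cons_eq_cons h
    exact ⟨congrArg (fun s => M.enum ⟨_, s.1, s.2⟩) h2, d, h1⟩
  · rintro ⟨h, d, hd⟩
    have h1 := M.enum.injective h
    cases h1
    exact ⟨d, p, by rw [hd]⟩

/-- A `𝔹`-path through two successive edges backtracks exactly if the edges and the group element
between them are as in `NextEdge`. -/
theorem Decoding.cancels_mu_iff (D : M.Decoding c 𝓑 u₀) {u v w x : 𝓑.gog.V} (f : 𝓑.E u v)
    (f' : 𝓑.E v w) (b : 𝓑.B v) (q : 𝓑.gog.Path w x) (a : Word)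
    (ha : M.vval (𝓑.vtype v) a = b.1) :
    Cancels (𝓑.etype f) ((𝓑.mu (cons b f' q)).lmul (𝓑.labω f)) ↔
      ¬ ((c.ecode (D.ei f')).typ ≠ (c.ecode (c.ecode (D.ei f)).rev).typ ∨
        M.EmptyCoset (c.ecode (c.ecode (D.ei f)).rev).typ []
          ((c.ecode (D.ei f)).wω ++ (a ++ (c.ecode (D.ei f')).wα))) := by
  have h1 : (𝓑.mu (cons b f' q)).lmul (𝓑.labω f) =
      cons (M.vval _ ((c.ecode (D.ei f)).wω ++ (a ++ (c.ecode (D.ei f')).wα))) (𝓑.etype f')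
        ((𝓑.mu q).lmul (𝓑.labω f')) := by
    rw [vval_append, vval_append, D.wω, D.wα, ha]
    rfl
  rw [h1, cancels_cons_iff_cosetInter, D.rev, D.typ, D.typ, 𝓑.etype_inv, emptyCoset_iff]
  tauto

theorem Decoding.core_iff (D : M.Decoding c 𝓑 u₀) (hM : M.Benign) (hF : 𝓑.Folded) : M.Core c ↔
    ∀ u v (f : 𝓑.E u v), ∃ q : 𝓑.gog.Path v u₀, (cons 1 f q).Red := by
  constructor
  · intro h u v f
    obtain ⟨j', hj', hb⟩ := h _ (D.ei_lt f)
    have key : ∀ j, Relation.ReflTransGen (M.NextEdge c) j j' → ∀ (u v : 𝓑.V) (f : 𝓑.E u v),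
        D.ei f = j → ∃ q : 𝓑.gog.Path v u₀, (cons 1 f q).Red := by
      intro j hj
      induction hj using Relation.ReflTransGen.head_induction_on with
      | refl =>
        rintro u v f rfl
        rw [D.term, D.base] at hb
        obtain rfl := D.vi_inj hb
        exact ⟨nil 1, not_cancels_nil _ _, trivial⟩
      | head h _ ih =>
        rintro u v f rfl
        obtain ⟨h1, h2, a, ha, h3⟩ := h
        obtain ⟨v', w, f', rfl⟩ := D.ei_surj h1
        rw [D.orig, D.term] at h2
        obtain rfl := D.vi_inj h2
        rw [D.term, D.num, ← rep_vert_vval, D.vert_mem_gen_vgens hM] at ha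
        obtain ⟨q, hq⟩ := ih _ _ f' rfl
        refine ⟨cons ⟨_, ha⟩ f' q, AGraph.red_of_red_mu 𝓑 (p := cons 1 f (cons ⟨_, ha⟩ f' q)) ?_⟩
        refine ⟨?_, (red_lmul _ _).2 (hF.red_mu (p := cons ⟨_, ha⟩ f' q) hq)⟩
        rw [D.cancels_mu_iff f f' ⟨_, ha⟩ q a rfl, not_not]
        exact h3
    exact key _ hj' _ _ f rfl
  · intro h j hj
    obtain ⟨u, v, f, rfl⟩ := D.ei_surj hj
    obtain ⟨q, hq⟩ := h u v f
    have key : ∀ (v w : 𝓑.gog.V) (q : 𝓑.gog.Path v w), w = u₀ → ∀ (u : 𝓑.gog.V) (f : 𝓑.E u v)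
        (b : 𝓑.B u), Red (𝔸 := 𝓑.gog) (cons b f q) → ∃ j',
          Relation.ReflTransGen (M.NextEdge c) (D.ei f) j' ∧ (c.ecode j').term = c.2.2 := by
      intro v w q hw
      induction q with
      | nil a =>
        intro u f b _
        exact ⟨_, .refl, by rw [D.term, D.base, hw]⟩
      | @cons v w x b' f' q ih =>
        intro u f b hq
        obtain ⟨j', h1, h2⟩ := ih hw v f' b' hq.2
        refine ⟨j', .head ⟨D.ei_lt f', by rw [D.orig, D.term], M.wordOf _ b'.1, ?_, ?_⟩ h1, h2⟩
        · rw [D.term, D.num, ← rep_vert_vval, D.vert_mem_gen_vgens hM, vval_wordOf]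
          exact b'.2
        · have h3 := (hF.red_mu hq).1
          rw [D.cancels_mu_iff f f' b' q _ (M.vval_wordOf _ _), not_not] at h3
          exact h3
    exact key _ _ q rfl _ f 1 hq

end GraphOfGroups.Marking

namespace GraphOfGroups.Marking

variable {𝔸 : GraphOfGroups.{u₁, u₂, u₃, u₄}} (M : 𝔸.Marking)

open _root_.GraphOfGroups.Path

variable {M} {c : GraphCode} {𝓑 : AGraph.{u₁, u₂, u₃, u₄, u₅, u₆} 𝔸} {u₀ : 𝓑.V}

/-! ### Enumerating the closed paths of a coded `𝔸`-graph -/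

/-- One step of a `𝔹`-path: the state `(i, w, w')` consists of the number of the current vertex, the word
of the `𝔸`-path so far, and a second word in another alphabet.  In the second word, generators of
the vertex groups are spelled by means of `W` and edges by means of `T`. -/
def Step (x : GraphCode × List (List Word) × List Word) (s s' : ℕ × Word × Word) : Prop :=
  (∃ y, s' = (s.1, s.2.1 ++ substWord (x.1.vgens s.1) y,
    s.2.2 ++ substWord (x.2.1.getD s.1 []) y)) ∨
  ∃ j, j < x.1.2.1.length ∧ (x.1.ecode j).orig = s.1 ∧
    s' = ((x.1.ecode j).term, s.2.1 ++ x.1.edgeWord j, s.2.2 ++ x.2.2.getD j [])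

/-- `w` is the word of a closed path at the base vertex, with second word `w'`. -/
def Spells (x : GraphCode × List (List Word) × List Word) (w w' : Word) : Prop :=
  Relation.ReflTransGen (Step x) (x.1.2.2, [], []) (x.1.2.2, w, w')

theorem spells_re {α : Type*} [Primcodable α] {f : α → GraphCode} {W : α → List (List Word)}
    {T : α → List Word} {w w' : α → Word} (hf : Primrec f) (hW : Primrec W) (hT : Primrec T)
    (hw : Primrec w) (hw' : Primrec w') : IsRE fun a => Spells (f a, W a, T a) (w a) (w' a) := by
  have h : IsRE fun x : (GraphCode × List (List Word) × List Word) × (ℕ × Word × Word) ×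
      (ℕ × Word × Word) => Step x.1 x.2.1 x.2.2 := by
    refine IsRE.or (IsRE.ex ?_) (IsRE.ex (IsRE.and ?_ (IsRE.and ?_ ?_)))
    · exact IsRE.eq (by fun_prop) (by fun_prop)
    · exact IsRE.lt (by fun_prop) (by fun_prop)
    · exact IsRE.eq (by fun_prop) (by fun_prop)
    · exact IsRE.eq (by fun_prop) (by fun_prop)
  exact (IsRE.reflTransGen h).comp (f := fun a => ((f a, W a, T a), ((f a).2.2, [], []),
    ((f a).2.2, w a, w' a))) (by fun_prop)

/-- The lists `W` and `T` spell a representation of `𝔹`. -/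
structure Decoding.Compatible (D : M.Decoding c 𝓑 u₀) {Δ : Type*} [Group Δ] (W : List (List Word))
    (T : List Word) (σ : Rep 𝓑.gog Δ) (δ : ℕ → Δ) : Prop where
  vert : ∀ (u : 𝓑.V) (b : 𝓑.B u) (y : Word),
    M.wval (substWord (c.vgens (D.vi u)) y) = M.rep.vert _ b.1 →
      σ.vert u b = evalWord δ (substWord (W.getD (D.vi u) []) y)
  edge : ∀ (u v : 𝓑.V) (f : 𝓑.E u v), σ.edge f = evalWord δ (T.getD (D.ei f) [])

/-- The trivial representation. -/
def _root_.GraphOfGroups.Rep.trivial (𝔸 : GraphOfGroups.{u₁, u₂, u₃, u₄}) : Rep 𝔸 Unit where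
  vert _ := 1
  edge _ := 1
  edge_inv _ := rfl
  edge_mul _ _ := rfl

theorem Decoding.compatible_trivial (D : M.Decoding c 𝓑 u₀) :
    D.Compatible [] [] (Rep.trivial 𝓑.gog) fun _ => 1 where
  vert _ _ _ _ := rfl
  edge _ _ _ := rfl

theorem Decoding.wval_substWord_mem (D : M.Decoding c 𝓑 u₀) (u : 𝓑.V) (y : Word) :
    ∃ b : 𝓑.B u, M.rep.vert _ b.1 = M.wval (substWord (c.vgens (D.vi u)) y) := by
  have h := (M.mem_gen_iff (c.vgens (D.vi u)) _).2 ⟨y, rfl⟩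
  rw [D.gen_vgens] at h
  obtain ⟨b, hb, h⟩ := h
  exact ⟨⟨b, hb⟩, h⟩

theorem Decoding.exists_substWord (D : M.Decoding c 𝓑 u₀) (u : 𝓑.V) (b : 𝓑.B u) :
    ∃ y, M.wval (substWord (c.vgens (D.vi u)) y) = M.rep.vert _ b.1 := by
  rw [← M.mem_gen_iff, D.gen_vgens]
  exact ⟨_, b.2, rfl⟩

theorem rep_val_mu_cons {u v w : 𝓑.gog.V} (b : 𝓑.B u) (f : 𝓑.E u v) (p : 𝓑.gog.Path v w) :
    M.rep.val (𝓑.mu (cons b f p)) = M.rep.vert _ b.1 * (M.rep.vert _ (𝓑.labα f) *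
      (M.rep.edge (𝓑.etype f) * M.rep.vert _ (𝓑.labω f)) * M.rep.val (𝓑.mu p)) := by
  simp [AGraph.mu, Rep.val, Rep.val_lmul, mul_assoc]

theorem rep_val_mu_nil {u : 𝓑.gog.V} (b : 𝓑.B u) :
    M.rep.val (𝓑.mu (Path.nil b : 𝓑.gog.Path u u)) = M.rep.vert _ b.1 := rfl

theorem Decoding.exists_spells (D : M.Decoding c 𝓑 u₀) {Δ : Type*} [Group Δ]
    {W : List (List Word)} {T : List Word} {σ : Rep 𝓑.gog Δ} {δ : ℕ → Δ}
    (h : D.Compatible W T σ δ) (p : 𝓑.gog.Path u₀ u₀) :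
    ∃ w w', Spells (c, W, T) w w' ∧ M.wval w = M.rep.val (𝓑.mu p) ∧ evalWord δ w' = σ.val p := by
  have key : ∀ (u v : 𝓑.gog.V) (p : 𝓑.gog.Path u v) (w₁ w₁' : Word), ∃ w w',
      Relation.ReflTransGen (Step (c, W, T)) (D.vi u, w₁, w₁') (D.vi v, w, w') ∧
        M.wval w = M.wval w₁ * M.rep.val (𝓑.mu p) ∧
        evalWord δ w' = evalWord δ w₁' * σ.val p := by
    intro u v p
    induction p with
    | @nil u b =>
      intro w₁ w₁'
      obtain ⟨y, hy⟩ := D.exists_substWord u b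
      refine ⟨_, _, .single (Or.inl ⟨y, rfl⟩), ?_, ?_⟩
      · rw [wval_append, hy]
        rfl
      · rw [evalWord_append, ← h.vert u b y hy]
        rfl
    | @cons u v w b f p ih =>
      intro w₁ w₁'
      obtain ⟨y, hy⟩ := D.exists_substWord u b
      obtain ⟨w₂, w₂', h1, h2, h3⟩ := ih (w₁ ++ substWord (c.vgens (D.vi u)) y ++
        c.edgeWord (D.ei f)) (w₁' ++ substWord (W.getD (D.vi u) []) y ++ T.getD (D.ei f) [])
      refine ⟨w₂, w₂', .head (Or.inl ⟨y, rfl⟩) (.head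
        (Or.inr ⟨D.ei f, D.ei_lt f, D.orig f, rfl⟩) ?_), ?_, ?_⟩
      · rw [D.term]
        exact h1
      · rw [h2, wval_append, wval_append, hy, D.wval_edgeWord, rep_val_mu_cons]
        simp only [mul_assoc]
      · rw [h3, evalWord_append, evalWord_append, ← h.vert u b y hy, ← h.edge]
        simp only [Rep.val, mul_assoc]
  obtain ⟨w, w', h1, h2, h3⟩ := key _ _ p [] []
  rw [← D.base] at h1
  exact ⟨w, w', h1, by simpa using h2, by simpa using h3⟩

theorem Decoding.exists_path_of_spells (D : M.Decoding c 𝓑 u₀) {Δ : Type*} [Group Δ]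
    {W : List (List Word)} {T : List Word} {σ : Rep 𝓑.gog Δ} {δ : ℕ → Δ}
    (h : D.Compatible W T σ δ) {w w' : Word} (hw : Spells (c, W, T) w w') :
    ∃ p : 𝓑.gog.Path u₀ u₀, M.wval w = M.rep.val (𝓑.mu p) ∧ evalWord δ w' = σ.val p := by
  have key : ∀ s, Relation.ReflTransGen (Step (c, W, T)) (c.2.2, [], []) s → ∃ (u : 𝓑.gog.V)
      (p : 𝓑.gog.Path u₀ u), D.vi u = s.1 ∧ M.wval s.2.1 = M.rep.val (𝓑.mu p) ∧
        evalWord δ s.2.2 = σ.val p := by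
    intro s hs
    induction hs with
    | refl => exact ⟨u₀, nil 1, D.base.symm, by simp [rep_val_mu_nil], by simp [Rep.val]⟩
    | tail _ hstep ih =>
      obtain ⟨u, p, hu, h1, h2⟩ := ih
      rcases hstep with ⟨y, rfl⟩ | ⟨j, hj, ho, rfl⟩
      · obtain ⟨b, hb⟩ := D.wval_substWord_mem u y
        refine ⟨u, p.comp (nil b), hu, ?_, ?_⟩
        · dsimp only
          rw [wval_append, h1, ← hu, ← hb, AGraph.mu_comp, Rep.val_comp, rep_val_mu_nil]
        · dsimp only
          rw [evalWord_append, h2, ← hu, ← h.vert u b y hb.symm, Rep.val_comp, Rep.val]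
      · obtain ⟨u', v, f, rfl⟩ := D.ei_surj hj
        rw [D.orig] at ho
        obtain rfl := D.vi_inj (hu.trans ho.symm)
        refine ⟨v, p.comp (cons 1 f (nil 1)), (D.term f).symm, ?_, ?_⟩
        · dsimp only
          rw [wval_append, h1, D.wval_edgeWord, AGraph.mu_comp, Rep.val_comp, rep_val_mu_cons,
            rep_val_mu_nil]
          simp
        · dsimp only
          rw [evalWord_append, h2, ← h.edge, Rep.val_comp]
          simp [Rep.val]
  obtain ⟨u, p, hu, h1, h2⟩ := key _ hw
  dsimp only at hu
  rw [D.base] at hu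
  obtain rfl := D.vi_inj hu
  exact ⟨p, h1, h2⟩

/-! ### Recognizing the subgroup -/

variable (M) (v₀ : 𝔸.V)

/-- The closed paths of the coded `𝔸`-graph represent elements of the subgroup generated by `S`.  The
certificate is a word for each vertex, so that conjugation by its value moves the vertex groups and
the edges into the subgroup. -/
def LangLe (S : List PathCode) (c : GraphCode) : Prop :=
  ∃ g : List Word, g.getD c.2.2 [] = [] ∧
    (∀ i < c.1.length, ∀ w ∈ c.vgens i, M.wval (g.getD i [] ++ (w ++ FreeGroup.invRev (g.getD i []))) ∈
      M.gen (S.map (M.pathWord (M.vnum v₀)))) ∧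
    ∀ j < c.2.1.length, M.wval (g.getD (c.ecode j).orig [] ++ (c.edgeWord j ++
      FreeGroup.invRev (g.getD (c.ecode j).term []))) ∈ M.gen (S.map (M.pathWord (M.vnum v₀)))

/-- The elements of `S` are represented by closed paths of the coded `𝔸`-graph. -/
def LangGe (S : List PathCode) (c : GraphCode) : Prop :=
  ∀ s ∈ S, ∃ w w', Spells (c, [], []) w w' ∧ M.wval w = M.wval (M.pathWord (M.vnum v₀) s)

theorem langLe_re (hM : M.Benign) : IsRE fun x : List PathCode × GraphCode =>
    M.LangLe v₀ x.1 x.2 := by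
  have hp : Primrec fun c : PathCode => M.pathWord (M.vnum v₀) c :=
    M.primrec_pathWord hM (by fun_prop) (by fun_prop)
  refine IsRE.ex (IsRE.and (IsRE.eq (by fun_prop) (by fun_prop)) (IsRE.and ?_ ?_))
  · exact IsRE.forall_lt (by fun_prop) (IsRE.forall_mem (by fun_prop)
      (M.mem_gen_re hM (by fun_prop) (by fun_prop)))
  · exact IsRE.forall_lt (by fun_prop) (M.mem_gen_re hM (by fun_prop) (by fun_prop))

theorem langGe_re (hM : M.Benign) : IsRE fun x : List PathCode × GraphCode =>
    M.LangGe v₀ x.1 x.2 := by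
  have hp : Primrec fun c : PathCode => M.pathWord (M.vnum v₀) c :=
    M.primrec_pathWord hM (by fun_prop) (by fun_prop)
  refine IsRE.forall_mem (by fun_prop) (IsRE.ex (IsRE.ex (IsRE.and ?_ ?_)))
  · exact spells_re (by fun_prop) (by fun_prop) (by fun_prop) (by fun_prop) (by fun_prop)
  · exact M.wval_eq_re hM (by fun_prop) (by fun_prop)

variable {M} {v₀}

theorem Decoding.val_mem_of_langLe (D : M.Decoding c 𝓑 u₀) {S : List PathCode}
    (h : M.LangLe v₀ S c) (p : 𝓑.gog.Path u₀ u₀) :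
    M.rep.val (𝓑.mu p) ∈ M.gen (S.map (M.pathWord (M.vnum v₀))) := by
  obtain ⟨g, h0, hv, he⟩ := h
  set U := M.gen (S.map (M.pathWord (M.vnum v₀)))
  have hv' : ∀ (u : 𝓑.V) (b : 𝓑.B u), M.wval (g.getD (D.vi u) []) * M.rep.vert _ b.1 *
      (M.wval (g.getD (D.vi u) []))⁻¹ ∈ U := by
    intro u b
    have h1 : M.gen (c.vgens (D.vi u)) ≤
        U.comap (MulAut.conj (M.wval (g.getD (D.vi u) []))).toMonoidHom := by
      refine (Subgroup.closure_le _).2 fun x hx => ?_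
      obtain ⟨w, hw, rfl⟩ := List.mem_map.1 hx
      have h2 := hv _ (D.vi_lt u) w hw
      rw [wval_append, wval_append, wval_invRev, ← mul_assoc] at h2
      exact h2
    have h2 : M.rep.vert _ b.1 ∈ M.gen (c.vgens (D.vi u)) := by
      rw [D.gen_vgens]
      exact ⟨_, b.2, rfl⟩
    exact h1 h2
  have key : ∀ (u v : 𝓑.gog.V) (p : 𝓑.gog.Path u v), M.wval (g.getD (D.vi u) []) *
      M.rep.val (𝓑.mu p) * (M.wval (g.getD (D.vi v) []))⁻¹ ∈ U := by
    intro u v p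
    induction p with
    | @nil u b => exact hv' u b
    | @cons u v w b f p ih =>
      have h1 := he _ (D.ei_lt f)
      rw [wval_append, wval_append, wval_invRev, D.orig, D.term, D.wval_edgeWord] at h1
      have h2 := U.mul_mem (U.mul_mem (hv' u b) h1) ih
      rw [rep_val_mu_cons]
      simpa [mul_assoc] using h2
  have h1 := key _ _ p
  rw [← D.base, h0] at h1
  simpa using h1

theorem Decoding.langLe (D : M.Decoding c 𝓑 u₀) {S : List PathCode} (g : 𝓑.V → M.Amb)
    (h0 : g u₀ = 1) (hv : ∀ u, ∀ b ∈ 𝓑.B u, g u * M.rep.vert _ b * (g u)⁻¹ ∈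
      M.gen (S.map (M.pathWord (M.vnum v₀))))
    (he : ∀ u v (f : 𝓑.E u v), g u * (M.rep.vert _ (𝓑.labα f) *
      (M.rep.edge (𝓑.etype f) * M.rep.vert _ (𝓑.labω f))) * (g v)⁻¹ ∈
        M.gen (S.map (M.pathWord (M.vnum v₀)))) : M.LangLe v₀ S c := by
  classical
  have hg : ∀ u, ∃ w, M.wval w = g u ∧ (u = u₀ → w = []) := by
    intro u
    by_cases hu : u = u₀
    · exact ⟨[], by rw [hu, h0, wval_nil], fun _ => rfl⟩
    · obtain ⟨w, hw⟩ := WordGroup.val_surjective M.relators (g u)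
      exact ⟨w, hw, fun h => absurd h hu⟩
  choose gw hgw hgw0 using hg
  obtain ⟨L, -, hL⟩ := D.exists_vlist gw []
  refine ⟨L, by rw [D.base, hL, hgw0 _ rfl], fun i hi w hw => ?_, fun j hj => ?_⟩
  · obtain ⟨u, rfl⟩ := D.vi_surj hi
    have h1 : M.wval w ∈ M.gen (c.vgens (D.vi u)) :=
      Subgroup.subset_closure (List.mem_map_of_mem hw)
    rw [D.gen_vgens] at h1
    obtain ⟨b, hb, h1⟩ := h1
    rw [wval_append, wval_append, wval_invRev, hL, hgw, ← mul_assoc, ← h1]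
    exact hv u b hb
  · obtain ⟨u, v, f, rfl⟩ := D.ei_surj hj
    rw [wval_append, wval_append, wval_invRev, D.orig, D.term, hL, hL, hgw, hgw,
      D.wval_edgeWord, ← mul_assoc]
    exact he u v f

theorem Decoding.langGe_iff (D : M.Decoding c 𝓑 u₀) {S : List PathCode} :
    M.LangGe v₀ S c ↔ ∀ s ∈ S, ∃ p : 𝓑.gog.Path u₀ u₀,
      M.rep.val (𝓑.mu p) = M.wval (M.pathWord (M.vnum v₀) s) := by
  constructor
  · intro h s hs
    obtain ⟨w, w', h1, h2⟩ := h s hs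
    obtain ⟨p, hp, -⟩ := D.exists_path_of_spells D.compatible_trivial h1
    exact ⟨p, hp.symm.trans h2⟩
  · intro h s hs
    obtain ⟨p, hp⟩ := h s hs
    obtain ⟨w, w', h1, h2, -⟩ := D.exists_spells D.compatible_trivial p
    exact ⟨w, w', h1, h2.trans hp⟩

theorem rep_hom_nu (h₀ : 𝓑.vtype u₀ = v₀) (p : 𝓑.gog.Path u₀ u₀) :
    M.rep.hom v₀ (𝓑.nu u₀ h₀ (Pi1.mk p)) = M.rep.val (𝓑.mu p) := by
  subst h₀
  rfl

theorem Decoding.range_nu (D : M.Decoding c 𝓑 u₀) (hM : M.Benign) {S : List PathCode}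
    (hS : M.IsInput v₀ S) (h₀ : 𝓑.vtype u₀ = v₀) (hle : M.LangLe v₀ S c)
    (hge : M.LangGe v₀ S c) : (𝓑.nu u₀ h₀).range = M.generated v₀ S := by
  refine le_antisymm ?_ ((Subgroup.closure_le _).2 ?_)
  · rintro _ ⟨x, rfl⟩
    obtain ⟨p, rfl⟩ := Pi1.mk_surjective x
    have h1 := D.val_mem_of_langLe hle p
    rw [M.gen_pathWord hS, ← rep_hom_nu h₀] at h1
    exact (Subgroup.mem_map_iff_mem (M.rep_hom_injective hM v₀)).1 h1
  · rintro g ⟨s, hs, hg⟩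
    obtain ⟨p, hp⟩ := D.langGe_iff.1 hge s hs
    refine ⟨Pi1.mk p, M.rep_hom_injective hM v₀ ?_⟩
    rw [rep_hom_nu, hp, hg.wval_eq]

/-! ### The certificate -/

/-- `c` is the code of a folded `𝔸`-graph with base vertex of type `v₀`, without superfluous edges, whose
language represents the subgroup generated by `S`. -/
structure Good (hM : M.Benign) (v₀ : 𝔸.V) (S : List PathCode) (c : GraphCode) : Prop where
  valid : M.Valid c
  base : (c.vcode c.2.2).1 = M.vnum v₀
  fold1 : M.Fold1 c
  fold2 : Fold2 hM c
  core : M.Core c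
  langLe : M.LangLe v₀ S c
  langGe : M.LangGe v₀ S c

theorem good_re (hM : M.Benign) (v₀ : 𝔸.V) : IsRE fun x : List PathCode × GraphCode =>
    Good hM v₀ x.1 x.2 := by
  refine IsRE.of_iff (((M.valid_re hM).comp Primrec.snd).and
    ((IsRE.eq (f := fun x : List PathCode × GraphCode => (x.2.vcode x.2.2.2).1)
      (g := fun _ => M.vnum v₀) (by fun_prop) (by fun_prop)).and
    (((fold1_re hM).comp Primrec.snd).and (((fold2_re hM).comp Primrec.snd).and
    (((core_re hM).comp Primrec.snd).and ((M.langLe_re v₀ hM).and (M.langGe_re v₀ hM)))))))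
    fun x => ⟨fun h => ⟨h.1, h.2, h.3, h.4, h.5, h.6, h.7⟩,
      fun ⟨h1, h2, h3, h4, h5, h6, h7⟩ => ⟨h1, h2, h3, h4, h5, h6, h7⟩⟩

theorem Decoding.vtype_base (D : M.Decoding c 𝓑 u₀) (h : (c.vcode c.2.2).1 = M.vnum v₀) :
    𝓑.vtype u₀ = v₀ := by
  rw [D.base, D.num] at h
  exact M.vnum.injective h

/-- Good codes exist, even when the words generating the vertex groups have to be chosen in some
special way. -/
theorem exists_good (hM : M.Benign) {S : List PathCode} (hS : M.IsInput v₀ S)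
    (gens : 𝔸.V → List Word → List Word) (hgens : ∀ v X, M.vclosure v (gens v X) = M.vclosure v X) :
    ∃ (𝓑 : AGraph.{u₁, u₂, u₃, u₄, u₁, max u₂ u₃} 𝔸) (u₀ : 𝓑.V) (c : GraphCode)
      (D : M.Decoding c 𝓑 u₀), Good hM v₀ S c ∧ (∀ u, Nonempty (𝓑.gog.Path u₀ u)) ∧
        ∀ u, ∃ X, (c.vcode (D.vi u)).2 = gens (𝓑.vtype u) X := by
  have hp : ∀ s : {s // s ∈ S}, ∃ p : 𝔸.Path v₀ v₀, M.CodesPath s.1 p := by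
    rintro ⟨s, hs⟩
    obtain ⟨g, p, hp, -⟩ := hS s hs
    exact ⟨p, hp⟩
  choose p hp using hp
  have hpU : ∀ s, M.rep.val (p s) ∈ M.gen (S.map (M.pathWord (M.vnum v₀))) := by
    intro s
    rw [← M.wval_pathWord (hp s)]
    exact Subgroup.subset_closure (List.mem_map_of_mem (List.mem_map_of_mem s.2))
  have hfin : Finite {s // s ∈ S} := List.finite_toSet S
  obtain ⟨𝓑, u₀, h₀, hV, hE, hfg, hF, hcore, hconn, ⟨g, hg0, hgv, hge⟩, hpaths⟩ :=
    M.rep.exists_finite_folded (M.gen (S.map (M.pathWord (M.vnum v₀)))) v₀ hM.noetherian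
      (Set.range p) (Set.finite_range p) (by rintro _ ⟨s, rfl⟩; exact hpU s)
  have hX : ∀ u, ∃ X, 𝓑.B u = M.vclosure (𝓑.vtype u) X := by
    intro u
    obtain ⟨s, hs, hfin⟩ := (Subgroup.fg_iff _).1 (hfg u)
    refine ⟨hfin.toFinset.toList.map (M.wordOf _), ?_⟩
    rw [← hs, vclosure]
    congr 1
    ext a
    simp
  choose X hX using hX
  obtain ⟨c, D, hD⟩ := exists_code (M := M) (fun u => gens (𝓑.vtype u) (X u))
    (fun u => by rw [hgens, hX]) u₀
  have hf := (D.folded_iff hM).2 hF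
  refine ⟨𝓑, u₀, c, D, ⟨D.valid, by rw [D.base, D.num, h₀], hf.1, hf.2,
    (D.core_iff hM hF).2 hcore, D.langLe g hg0 hgv hge, D.langGe_iff.2 fun s hs => ?_⟩, hconn,
    fun u => ⟨X u, hD u⟩⟩
  obtain ⟨q, hq⟩ := hpaths _ ⟨⟨s, hs⟩, rfl⟩
  exact ⟨q, by rw [hq, M.wval_pathWord (hp ⟨s, hs⟩)]⟩

/-- The algorithm searches for a code in the recursively enumerable set of good codes for `S`; every
good code describes a folded `𝔸`-graph with the required properties. -/
theorem existsAlgorithm_foldedGraph (hM : M.Benign) (v₀ : 𝔸.V) :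
    ExistsAlgorithm (M.IsInput v₀) (fun (S : List PathCode) (c : GraphCode) =>
      ∃ (𝓑 : AGraph.{u₁, u₂, u₃, u₄, 0, 0} 𝔸) (u₀ : 𝓑.V) (h₀ : 𝓑.vtype u₀ = v₀),
        M.CodesGraph c 𝓑 u₀ ∧
        𝓑.Folded ∧
        GraphOfGroups.Pi1.mk '' 𝓑.language u₀ h₀ = (M.generated v₀ S : Set (𝔸.Pi1 v₀)) ∧
        (∃ ψ : 𝓑.gog.Pi1 u₀ ≃* M.generated v₀ S, ∀ x, (ψ x : 𝔸.Pi1 v₀) = 𝓑.nu u₀ h₀ x) ∧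
        Function.Injective (𝓑.phi u₀ h₀) ∧
        (⊤ : (𝓑.gog.tree u₀).Subgraph).map (𝓑.phi u₀ h₀) =
          GraphOfGroups.hull (M.generated v₀ S)) := by
  refine IsRE.existsAlgorithm (good_re hM v₀) (fun S hS => ?_) fun S c hS hc => ?_
  · obtain ⟨-, -, c, -, hc, -⟩ := exists_good hM hS (fun _ X => X) fun _ _ => rfl
    exact ⟨c, hc⟩
  · obtain ⟨𝓑, u₀, h⟩ := hc.valid.exists_graph hM
    obtain ⟨D⟩ := h.nonempty_decoding
    have h₀ := D.vtype_base hc.base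
    have hF : 𝓑.Folded := (D.folded_iff hM).1 ⟨hc.fold1, hc.fold2⟩
    have hU := D.range_nu hM hS h₀ hc.langLe hc.langGe
    refine ⟨𝓑, u₀, h₀, h, hF, ?_, ?_, hF.phi_injective u₀ h₀, ?_⟩
    · rw [AGraph.mk_image_language, hU]
    · exact ⟨(MonoidHom.ofInjective (hF.nu_injective u₀ h₀)).trans (MulEquiv.subgroupCongr hU),
        fun x => rfl⟩
    · rw [hF.map_phi_eq_hull u₀ h₀ ((D.core_iff hM hF).1 hc.core), hU]

end GraphOfGroups.Marking

/-! ### Finite presentations -/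

theorem map_wordVal {G H : Type*} [Group G] [Group H] (f : G →* H) (l : List G) (w : Word) :
    f (wordVal l w) = wordVal (l.map f) w := by
  rw [wordVal_eq_evalWord, wordVal_eq_evalWord, map_evalWord]
  refine evalWord_congr (fun i => ?_) w
  cases h : l[i]? <;> simp [List.getD_eq_getElem?_getD, h]

theorem WordGroup.val_append (R : Set Word) (w w' : Word) :
    WordGroup.val R (w ++ w') = WordGroup.val R w * WordGroup.val R w' :=
  evalWord_append (fun i => (FreeGroup.of i : WordGroup R)) w w'

theorem WordGroup.val_invRev (R : Set Word) (w : Word) :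
    WordGroup.val R (FreeGroup.invRev w) = (WordGroup.val R w)⁻¹ :=
  evalWord_invRev (fun i => (FreeGroup.of i : WordGroup R)) w

theorem WordGroup.val_substWord (R : Set Word) (L : List Word) (w : Word) :
    WordGroup.val R (substWord L w) = evalWord (fun k => WordGroup.val R (L.getD k [])) w := by
  refine (evalWord_substWord (fun i => (FreeGroup.of i : WordGroup R)) L w).trans ?_
  rw [wordVal_eq_evalWord]
  refine evalWord_congr (fun i => ?_) w
  cases h : L[i]? <;> simp [List.getD_eq_getElem?_getD, h, WordGroup.val]

theorem WordGroup.val_eq_of_mem {R : Set Word} {w w' : Word} (h : w ++ FreeGroup.invRev w' ∈ R) :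
    WordGroup.val R w = WordGroup.val R w' := by
  rw [← mul_inv_eq_one, ← WordGroup.val_invRev, ← WordGroup.val_append]
  exact WordGroup.val_of_mem h

theorem WordGroup.val_eq_re {α : Type*} [Primcodable α] {R : α → List Word} {f g : α → Word}
    (hR : Primrec R) (hf : Primrec f) (hg : Primrec g) : IsRE fun a =>
      WordGroup.val {r | r ∈ R a} (f a) = WordGroup.val {r | r ∈ R a} (g a) := by
  have h : IsRE fun x : List Word × Word => x.2 ∈ ({r | r ∈ x.1} : Set Word) :=
    IsRE.mem Primrec.snd Primrec.fst
  refine ((IsRE.wordGroup (R := fun l : List Word => {r | r ∈ l}) h).comp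
    (f := fun a => (R a, f a ++ FreeGroup.invRev (g a))) (by fun_prop)).of_iff fun a => ?_
  dsimp only
  rw [WordGroup.val_append, WordGroup.val_invRev, mul_inv_eq_one]

/-- Finitely many requirements on a list of relators that can be met separately, by words that
represent `1`, can be met simultaneously. -/
theorem exists_relators {G ι : Type*} [Group G] [Finite ι] (δ : ℕ → G) {Q : ι → List Word → Prop}
    (h : ∀ i, ∃ R₀ : List Word, (∀ r ∈ R₀, evalWord δ r = 1) ∧ ∀ R, R₀ ⊆ R → Q i R) :
    ∃ R₀ : List Word, (∀ r ∈ R₀, evalWord δ r = 1) ∧ ∀ R, R₀ ⊆ R → ∀ i, Q i R := by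
  cases nonempty_fintype ι
  choose R₀ h1 h2 using h
  refine ⟨Finset.univ.toList.flatMap R₀, fun r hr => ?_, fun R hR i => h2 i R fun r hr => hR ?_⟩
  · obtain ⟨i, -, hi⟩ := List.mem_flatMap.1 hr
    exact h1 i r hi
  · exact List.mem_flatMap.2 ⟨i, by simp, hr⟩

theorem exists_relators_val_eq {G : Type*} [Group G] {δ : ℕ → G} {w w' : Word}
    (h : evalWord δ w = evalWord δ w') :
    ∃ R₀ : List Word, (∀ r ∈ R₀, evalWord δ r = 1) ∧ ∀ R : List Word, R₀ ⊆ R →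
      WordGroup.val {r | r ∈ R} w = WordGroup.val {r | r ∈ R} w' := by
  refine ⟨[w ++ FreeGroup.invRev w'], fun r hr => ?_, fun R hR => WordGroup.val_eq_of_mem ?_⟩
  · rw [List.mem_singleton.1 hr, evalWord_append, evalWord_invRev, h, mul_inv_cancel]
  · exact hR (List.mem_singleton_self _)

namespace GraphOfGroups.Marking

variable {𝔸 : GraphOfGroups.{u₁, u₂, u₃, u₄}} (M : 𝔸.Marking)

open _root_.GraphOfGroups.Path

/-- A recursively enumerable relation that provides presentations of the finitely generated subgroups of
the vertex groups: `VP n Z R` implies that `⟨Z | R⟩` is a presentation, for the vertex group with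
number `n`. -/
structure VertexPresentations (VP : ℕ → List Word → List Word → Prop) : Prop where
  re : IsRE fun x : ℕ × List Word × List Word => VP x.1 x.2.1 x.2.2
  pres : ∀ v Z R, VP (M.vnum v) Z R →
    IsPresentation (M.vclosure v Z) (Z.map (M.vval v)) {r | r ∈ R}
  exists_pres : ∀ v X, ∃ Z R, VP (M.vnum v) Z R ∧ M.vclosure v Z = M.vclosure v X

variable {M}

theorem exists_vertexPresentations (hM : M.Benign)
    (h : ∀ v : 𝔸.V, ExistsAlgorithm (fun _ : List Word => True)
      (fun (Y : List Word) (P : List Word × List Word) =>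
        IsPresentation (M.vclosure v Y) (P.1.map (M.vval v)) {r | r ∈ P.2})) :
    ∃ VP, M.VertexPresentations VP := by
  have := hM.finite_vertices
  choose P hP hPR hex using fun v => IsRE.of_existsAlgorithm (h v)
  refine ⟨fun n Z R => ∃ v, M.vnum v = n ∧ ∃ Y, P v Y (Z, R), ⟨?_, ?_, ?_⟩⟩
  · exact IsRE.exists_finite fun v => (IsRE.eq (by fun_prop) (by fun_prop)).and
      (IsRE.ex ((hP v).comp (f := fun x : (ℕ × List Word × List Word) × List Word =>
        (x.2, x.1.2.1, x.1.2.2)) (by fun_prop)))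
  · rintro v Z R ⟨v', hv, Y, hY⟩
    obtain rfl := M.vnum.injective hv
    have h1 := hPR _ _ _ hY
    have h2 : M.vclosure v' Z = M.vclosure v' Y := h1.1
    rw [h2]
    exact h1
  · intro v X
    obtain ⟨⟨Z, R⟩, h1⟩ := hex v X
    exact ⟨Z, R, ⟨v, rfl, X, h1⟩, (hPR _ _ _ h1).1⟩

/-- A certificate for a presentation `⟨z | R⟩` of the subgroup generated by `S`: the code of a folded
`𝔸`-graph, relators for its vertex groups, and spellings `W` of the generators of the vertex groups
and `T` of the edges in terms of `z` that satisfy the relations of the path groupoid of `𝔹`. -/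
structure Certifies (hM : M.Benign) (VP : ℕ → List Word → List Word → Prop) (v₀ : 𝔸.V)
    (S : List PathCode) (z : List PathCode) (R : List Word) (c : GraphCode)
    (Rl W : List (List Word)) (T : List Word) : Prop where
  good : Good hM v₀ S c
  pres : ∀ i < c.1.length, VP (c.vcode i).1 (c.vcode i).2 (Rl.getD i [])
  len : ∀ i < c.1.length, (W.getD i []).length < (c.vcode i).2.length + 1
  vrel : ∀ i < c.1.length, ∀ r ∈ Rl.getD i [],
    WordGroup.val {r | r ∈ R} (substWord (W.getD i []) r) = WordGroup.val {r | r ∈ R} []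
  einv : ∀ j < c.2.1.length, WordGroup.val {r | r ∈ R}
    (T.getD j [] ++ T.getD (c.ecode j).rev []) = WordGroup.val {r | r ∈ R} []
  erel : ∀ j < c.2.1.length, ∃ out, EdgeGens hM c j out ∧ ∀ o ∈ out, ∃ y y',
    M.wval (substWord (c.vgens (c.ecode j).orig) y) = M.wval (c.wordA j o) ∧
    M.wval (substWord (c.vgens (c.ecode j).term) y') = M.wval (c.wordO j o) ∧
    WordGroup.val {r | r ∈ R} (T.getD j [] ++ substWord (W.getD (c.ecode j).term []) y') =
      WordGroup.val {r | r ∈ R} (substWord (W.getD (c.ecode j).orig []) y ++ T.getD j [])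
  closed : ∀ s ∈ z, M.Closed v₀ s
  gen_le : ∀ s ∈ z, M.wval (M.pathWord (M.vnum v₀) s) ∈
    M.gen (S.map (M.pathWord (M.vnum v₀)))
  gen_ge : ∀ s ∈ S, M.wval (M.pathWord (M.vnum v₀) s) ∈
    M.gen (z.map (M.pathWord (M.vnum v₀)))
  rel : ∀ r ∈ R, M.wval (substWord (z.map (M.pathWord (M.vnum v₀))) r) = M.wval []
  spell : ∀ i < z.length, ∃ w w', Spells (c, W, T) w w' ∧
    M.wval w = M.wval (M.pathWord (M.vnum v₀) (z.getD i ([], []))) ∧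
    WordGroup.val {r | r ∈ R} w' = WordGroup.val {r | r ∈ R} [(i, true)]

theorem certifies_re (hM : M.Benign) {VP : ℕ → List Word → List Word → Prop}
    (hVP : M.VertexPresentations VP) (v₀ : 𝔸.V) :
    IsRE fun x : List PathCode × List PathCode × List Word × GraphCode × List (List Word) ×
      List (List Word) × List Word => Certifies hM VP v₀ x.1 x.2.1 x.2.2.1 x.2.2.2.1 x.2.2.2.2.1
        x.2.2.2.2.2.1 x.2.2.2.2.2.2 := by
  have hp : Primrec fun c : PathCode => M.pathWord (M.vnum v₀) c :=
    M.primrec_pathWord hM (by fun_prop) (by fun_prop)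
  refine IsRE.of_iff (IsRE.and ?_ (IsRE.and ?_ (IsRE.and ?_ (IsRE.and ?_ (IsRE.and ?_ (IsRE.and ?_
    (IsRE.and ?_ (IsRE.and ?_ (IsRE.and ?_ (IsRE.and ?_ ?_))))))))))
    fun x => ⟨fun h => ⟨h.1, h.2, h.3, h.4, h.5, h.6, h.7, h.8, h.9, h.10, h.11⟩,
      fun ⟨h1, h2, h3, h4, h5, h6, h7, h8, h9, h10, h11⟩ =>
        ⟨h1, h2, h3, h4, h5, h6, h7, h8, h9, h10, h11⟩⟩
  · exact (good_re hM v₀).comp (f := fun x : List PathCode × List PathCode × List Word ×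
      GraphCode × List (List Word) × List (List Word) × List Word => (x.1, x.2.2.2.1))
      (by fun_prop)
  · exact IsRE.forall_lt (by fun_prop) (hVP.re.comp (f := fun x : (List PathCode ×
      List PathCode × List Word × GraphCode × List (List Word) × List (List Word) × List Word) ×
        ℕ => ((x.1.2.2.2.1.vcode x.2).1, (x.1.2.2.2.1.vcode x.2).2, x.1.2.2.2.2.1.getD x.2 []))
        (by fun_prop))
  · exact IsRE.forall_lt (by fun_prop) (IsRE.lt (by fun_prop)
      (Primrec.succ.comp (by fun_prop)))
  · exact IsRE.forall_lt (by fun_prop) (IsRE.forall_mem (by fun_prop)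
      (WordGroup.val_eq_re (by fun_prop) (by fun_prop) (by fun_prop)))
  · exact IsRE.forall_lt (by fun_prop)
      (WordGroup.val_eq_re (by fun_prop) (by fun_prop) (by fun_prop))
  · refine IsRE.forall_lt (by fun_prop) (IsRE.ex (IsRE.and ?_ (IsRE.forall_mem (by fun_prop)
      (IsRE.ex (IsRE.ex (IsRE.and ?_ (IsRE.and ?_ ?_)))))))
    · exact edgeGens_re hM (by fun_prop) (by fun_prop) (by fun_prop)
    · exact M.wval_eq_re hM (by fun_prop) (by fun_prop)
    · exact M.wval_eq_re hM (by fun_prop) (by fun_prop)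
    · exact WordGroup.val_eq_re (by fun_prop) (by fun_prop) (by fun_prop)
  · exact IsRE.forall_mem (by fun_prop) ((M.closed_re hM v₀).comp (by fun_prop))
  · exact IsRE.forall_mem (by fun_prop) (M.mem_gen_re hM (by fun_prop) (by fun_prop))
  · exact IsRE.forall_mem (by fun_prop) (M.mem_gen_re hM (by fun_prop) (by fun_prop))
  · exact IsRE.forall_mem (by fun_prop) (M.wval_eq_re hM (by fun_prop) (by fun_prop))
  · refine IsRE.forall_lt (by fun_prop) (IsRE.ex (IsRE.ex (IsRE.and ?_ (IsRE.and ?_ ?_))))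
    · exact spells_re (by fun_prop) (by fun_prop) (by fun_prop) (by fun_prop) (by fun_prop)
    · exact M.wval_eq_re hM (by fun_prop) (by fun_prop)
    · exact WordGroup.val_eq_re (by fun_prop) (by fun_prop) (by fun_prop)

end GraphOfGroups.Marking

namespace GraphOfGroups.Marking

variable {𝔸 : GraphOfGroups.{u₁, u₂, u₃, u₄}} {M : 𝔸.Marking}

open _root_.GraphOfGroups.Path

variable {c : GraphCode} {𝓑 : AGraph.{u₁, u₂, u₃, u₄, u₅, u₆} 𝔸} {u₀ : 𝓑.V} {v₀ : 𝔸.V}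

theorem wval_substWord (X : List Word) (y : Word) :
    M.wval (substWord X y) = wordVal (X.map M.wval) y :=
  evalWord_substWord (fun i => (FreeGroup.of i : M.Amb)) X y

theorem Decoding.wval_substWord_vgens (D : M.Decoding c 𝓑 u₀) (u : 𝓑.V) (y : Word) :
    M.wval (substWord (c.vgens (D.vi u)) y) =
      M.rep.vert _ (wordVal ((c.vcode (D.vi u)).2.map (M.vval (𝓑.vtype u))) y) := by
  rw [wval_substWord, D.vgens_eq, map_wordVal, List.map_map, List.map_map]
  congr 2
  funext w
  simp [rep_vert_vval]

/-! ### Certificates are sound -/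

/-- The spellings of a certificate define a representation of `𝔹` in the presented group. -/
theorem Certifies.exists_rep {hM : M.Benign} {VP : ℕ → List Word → List Word → Prop}
    (hVP : M.VertexPresentations VP) {S z : List PathCode} {R : List Word}
    {Rl W : List (List Word)} {T : List Word} (h : Certifies hM VP v₀ S z R c Rl W T)
    (D : M.Decoding c 𝓑 u₀) (hF : 𝓑.Folded) :
    ∃ τ : Rep 𝓑.gog (WordGroup {r | r ∈ R}),
      D.Compatible W T τ fun i => ((FreeGroup.of i : FreeGroup ℕ) : WordGroup {r | r ∈ R}) := by
  have hvert : ∀ u, ∃ k : 𝓑.B u →* WordGroup {r | r ∈ R}, ∀ (b : 𝓑.B u) (y : Word),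
      M.wval (substWord (c.vgens (D.vi u)) y) = M.rep.vert _ b.1 →
        k b = WordGroup.val {r | r ∈ R} (substWord (W.getD (D.vi u) []) y) := by
    intro u
    have h1 := h.pres _ (D.vi_lt u)
    rw [D.num] at h1
    have h2 := hVP.pres _ _ _ h1
    rw [← D.grp] at h2
    obtain ⟨k, hk⟩ := h2.exists_hom
      (fun i => WordGroup.val {r | r ∈ R} ((W.getD (D.vi u) []).getD i [])) (fun i hi => by
        rw [List.length_map] at hi
        have h3 := h.len _ (D.vi_lt u)
        rw [List.getD_eq_default _ _ (by omega)]
        rfl) (fun r hr => by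
        rw [← WordGroup.val_substWord]
        exact h.vrel _ (D.vi_lt u) r hr)
    refine ⟨k, fun b y hy => ?_⟩
    rw [D.wval_substWord_vgens] at hy
    have h4 := M.rep_vert_injective hM _ hy
    obtain ⟨b, hb⟩ := b
    dsimp only at h4
    subst h4
    rw [hk, WordGroup.val_substWord]
  choose k hk using hvert
  let t : ∀ {u v : 𝓑.V}, 𝓑.E u v → WordGroup {r | r ∈ R} := fun f =>
    WordGroup.val {r | r ∈ R} (T.getD (D.ei f) [])
  have hmul : ∀ {u v : 𝓑.V} (f : 𝓑.E u v) (d : 𝓑.gog.Ae f),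
      t f * k v (𝓑.gog.ω f d) = k u (𝓑.gog.α f d) * t f := by
    intro u v f d
    obtain ⟨out, h1, h2⟩ := h.erel _ (D.ei_lt f)
    let F₁ : 𝓑.gog.Ae f →* WordGroup {r | r ∈ R} :=
      ((MulAut.conj (t f)).toMonoidHom.comp (k v)).comp (𝓑.gog.ω f)
    let F₂ : 𝓑.gog.Ae f →* WordGroup {r | r ∈ R} := (k u).comp (𝓑.gog.α f)
    have hle : 𝓑.edgeα f ≤ (F₁.eqLocus F₂).map (Subgroup.subtype _) := by
      refine D.edgeα_le_of_edgeGens h1 fun o ho e he heo => ?_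
      obtain ⟨y, y', h3, h4, h5⟩ := h2 o ho
      have hfold : 𝓑.edgeα f = 𝓑.edgeω f := by
        by_contra hne
        exact hF.2 ⟨u, v, f, hne⟩
      have he' : e ∈ 𝓑.edgeα f ⊓ 𝓑.edgeω f := ⟨he, hfold ▸ he⟩
      rw [D.wval_wordA f heo, D.orig] at h3
      rw [D.wval_wordO f heo, D.term] at h4
      rw [WordGroup.val_append, WordGroup.val_append, D.orig, D.term,
        ← hk u ⟨_, he'.1⟩ y h3, ← hk v ⟨_, he'.2⟩ y' h4] at h5
      refine ⟨⟨e, he'⟩, ?_, rfl⟩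
      change t f * k v ⟨𝓑.conjω f e, he'.2⟩ * (t f)⁻¹ = k u ⟨𝓑.conjα f e, he'.1⟩
      rw [mul_inv_eq_iff_eq_mul]
      exact h5
    obtain ⟨d', hd', hdd⟩ := hle d.2.1
    obtain rfl : d' = d := Subtype.ext hdd
    exact mul_inv_eq_iff_eq_mul.1 hd'
  refine ⟨⟨k, t, fun {u v} f => ?_, hmul⟩, ⟨hk, fun u v f => rfl⟩⟩
  have h1 := h.einv _ (D.ei_lt f)
  rw [WordGroup.val_append, D.rev] at h1
  exact h1

theorem rep_hom_map_eq {zc : List PathCode} {z : List (𝔸.Pi1 v₀)}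
    (h : List.Forall₂ M.Represents zc z) :
    (zc.map (M.pathWord (M.vnum v₀))).map M.wval = z.map (M.rep.hom v₀) := by
  induction h with
  | nil => rfl
  | cons h _ ih => simp only [List.map_cons, ih, h.wval_eq]

theorem exists_represents_list {zc : List PathCode} (h : ∀ s ∈ zc, M.Closed v₀ s) :
    ∃ z, List.Forall₂ (M.Represents (v₀ := v₀)) zc z := by
  induction zc with
  | nil => exact ⟨[], .nil⟩
  | cons s zc ih =>
    obtain ⟨z, hz⟩ := ih fun s hs => h s (List.mem_cons_of_mem _ hs)
    obtain ⟨g, hg⟩ := h s List.mem_cons_self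
    exact ⟨g :: z, .cons hg hz⟩

theorem Certifies.isPresentation {hM : M.Benign} {VP : ℕ → List Word → List Word → Prop}
    (hVP : M.VertexPresentations VP) {S zc : List PathCode} (hS : M.IsInput v₀ S) {R : List Word}
    {Rl W : List (List Word)} {T : List Word} (h : Certifies hM VP v₀ S zc R c Rl W T) :
    ∃ z : List (𝔸.Pi1 v₀), List.Forall₂ M.Represents zc z ∧
      IsPresentation (M.generated v₀ S) z {r | r ∈ R} := by
  obtain ⟨𝓑, u₀, hc⟩ := h.good.valid.exists_graph hM
  obtain ⟨D⟩ := hc.nonempty_decoding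
  have h₀ := D.vtype_base h.good.base
  have hF : 𝓑.Folded := (D.folded_iff hM).1 ⟨h.good.fold1, h.good.fold2⟩
  have hU := D.range_nu hM hS h₀ h.good.langLe h.good.langGe
  obtain ⟨τ, hτ⟩ := h.exists_rep hVP D hF
  obtain ⟨z, hz⟩ := exists_represents_list h.closed
  have hmap := rep_hom_map_eq hz
  have hinj := M.rep_hom_injective hM v₀
  have hlen : zc.length = z.length := hz.length_eq
  have hget : ∀ (i : ℕ) (hi : i < z.length),
      M.wval (M.pathWord (M.vnum v₀) (zc.getD i ([], []))) = M.rep.hom v₀ z[i] := by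
    intro i hi
    have h1 := congrArg (fun l => l[i]?) hmap
    have hi' : i < zc.length := hlen ▸ hi
    simp only [List.getElem?_map, List.getElem?_eq_getElem hi, List.getElem?_eq_getElem hi',
      Option.map_some, Option.some.injEq] at h1
    rw [List.getD_eq_getElem _ _ hi', h1]
  refine ⟨z, hz, IsPresentation.of_hom ?_ ?_ ((τ.hom u₀).comp
    ((MonoidHom.ofInjective (hF.nu_injective u₀ h₀)).trans
      (MulEquiv.subgroupCongr hU)).symm.toMonoidHom) ?_⟩
  · have h1 : M.gen (zc.map (M.pathWord (M.vnum v₀))) =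
        (Subgroup.closure {g | g ∈ z}).map (M.rep.hom v₀) := by
      rw [gen, hmap, MonoidHom.map_closure]
      congr 1
      ext x
      simp
    refine Subgroup.map_injective hinj ?_
    rw [← h1, ← M.gen_pathWord hS]
    refine le_antisymm ((Subgroup.closure_le _).2 fun x hx => ?_)
      ((Subgroup.closure_le _).2 fun x hx => ?_)
    · obtain ⟨w, hw, rfl⟩ := List.mem_map.1 hx
      obtain ⟨s, hs, rfl⟩ := List.mem_map.1 hw
      exact h.gen_le s hs
    · obtain ⟨w, hw, rfl⟩ := List.mem_map.1 hx
      obtain ⟨s, hs, rfl⟩ := List.mem_map.1 hw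
      exact h.gen_ge s hs
  · intro r hr
    apply hinj
    rw [map_wordVal, ← hmap, ← wval_substWord, map_one]
    exact h.rel r hr
  · intro i hi hzi
    obtain ⟨w, w', h1, h2, h3⟩ := h.spell i (hlen ▸ hi)
    obtain ⟨p, hp, hp'⟩ := D.exists_path_of_spells hτ h1
    have h4 : 𝓑.nu u₀ h₀ (Pi1.mk p) = z[i] := by
      apply hinj
      rw [rep_hom_nu, ← hp, h2, hget i hi]
    rw [← h3]
    refine Eq.trans ?_ hp'.symm
    rw [← Rep.hom_mk]
    refine congrArg (τ.hom u₀) ?_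
    refine (MulEquiv.symm_apply_eq _).2 (Subtype.ext h4.symm)

/-! ### Certificates exist -/

/-- The fundamental group of a finite folded `𝔸`-graph with presented vertex groups is finitely
presented on the generators of the vertex groups and the edges. -/
theorem exists_certificate (hM : M.Benign) {VP : ℕ → List Word → List Word → Prop}
    (hVP : M.VertexPresentations VP) {S : List PathCode} (hS : M.IsInput v₀ S) :
    ∃ z R c Rl W T, Certifies hM VP v₀ S z R c Rl W T := by
  classical
  choose gens rels hrels hgens using hVP.exists_pres
  obtain ⟨𝓑, u₀, c, D, hgood, hconn, hcode⟩ := exists_good hM hS gens hgens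
  choose X hX using hcode
  have h₀ := D.vtype_base hgood.base
  have hF : 𝓑.Folded := (D.folded_iff hM).1 ⟨hgood.fold1, hgood.fold2⟩
  have hU := D.range_nu hM hS h₀ hgood.langLe hgood.langGe
  have hfinV : Finite 𝓑.V := Finite.of_injective
    (fun u => (⟨D.vi u, D.vi_lt u⟩ : Fin c.1.length)) fun u v h => D.vi_inj (congrArg Fin.val h)
  have hfinE : Finite (Σ u v : 𝓑.V, 𝓑.E u v) := Finite.of_injective
    (fun t => (⟨D.ei t.2.2, D.ei_lt t.2.2⟩ : Fin c.2.1.length))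
    fun _ _ h => D.ei_inj (congrArg Fin.val h)
  -- closing up paths of `𝔹` by connecting paths from `u₀` represents `𝔹` in its fundamental group;
  -- as the connecting path to `u₀` is trivial, closed paths at `u₀` represent themselves
  let q : ∀ u, 𝓑.gog.Path u₀ u := Function.update (fun u => (hconn u).some) u₀ (nil 1)
  have hq : q u₀ = nil 1 := Function.update_self _ _ _
  let σ : Rep 𝓑.gog (𝓑.gog.Pi1 u₀) := loopRep q
  have hσ : ∀ p : 𝓑.gog.Path u₀ u₀, σ.val p = Pi1.mk p := fun p => by
    rw [val_loopRep, loop, hq]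
    simp [reverse]
  let Z : ∀ u, List Word := fun u => (c.vcode (D.vi u)).2
  have hmem1 : ∀ u, ∀ w ∈ Z u, M.vval (𝓑.vtype u) w ∈ 𝓑.B u := by
    intro u w hw
    rw [D.grp]
    exact Subgroup.subset_closure (List.mem_map_of_mem hw)
  let G : ∀ u, List (𝓑.gog.Pi1 u₀) := fun u =>
    (Z u).attach.map fun w => σ.vert u ⟨_, hmem1 u w.1 w.2⟩
  obtain ⟨z₁, hz₁⟩ : ∃ z₁ : List (𝓑.gog.Pi1 u₀), ∀ g,
      ((∃ u, g ∈ G u) ∨ ∃ (u v : 𝓑.V) (f : 𝓑.E u v), g = σ.edge f) → g ∈ z₁ := by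
    have hfin : ({g | ∃ u, g ∈ G u} ∪
        Set.range fun t : Σ u v : 𝓑.V, 𝓑.E u v => σ.edge t.2.2).Finite := by
      refine Set.Finite.union ?_ (Set.finite_range _)
      refine (Set.finite_iUnion fun u => List.finite_toSet (G u)).subset ?_
      rintro g ⟨u, hu⟩
      exact Set.mem_iUnion.2 ⟨u, hu⟩
    refine ⟨hfin.toFinset.toList, fun g hg => ?_⟩
    rw [Finset.mem_toList, Set.Finite.mem_toFinset]
    rcases hg with hg | ⟨u, v, f, rfl⟩
    · exact Or.inl hg
    · exact Or.inr ⟨⟨u, v, f⟩, rfl⟩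
  let δ : ℕ → 𝓑.gog.Pi1 u₀ := fun i => z₁.getD i 1
  have hidx : ∀ g : 𝓑.gog.Pi1 u₀, ∃ i, g ∈ z₁ → δ i = g := by
    intro g
    by_cases hg : g ∈ z₁
    · obtain ⟨i, hi, rfl⟩ := List.mem_iff_getElem.1 hg
      exact ⟨i, fun _ => List.getD_eq_getElem _ _ hi⟩
    · exact ⟨0, fun h => absurd h hg⟩
  choose idx hidx using hidx
  have hletter : ∀ i, evalWord δ [(i, true)] = δ i := fun i => by simp
  obtain ⟨W, -, hW⟩ := D.exists_vlist (fun u => (G u).map fun g => [(idx g, true)]) []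
  obtain ⟨T, hT⟩ := D.exists_elist (fun {u v} f => [(idx (σ.edge f), true)]) []
  obtain ⟨Rl, -, hRl⟩ := D.exists_vlist (fun u => rels (𝓑.vtype u) (X u)) []
  have hcomp : D.Compatible W T σ δ := by
    refine ⟨fun u b y hy => ?_, fun u v f => ?_⟩
    · rw [D.wval_substWord_vgens] at hy
      have h1 := M.rep_vert_injective hM _ hy
      have h2 : (W.getD (D.vi u) []).map (evalWord δ) = G u := by
        rw [hW, List.map_map]
        refine (List.map_congr_left fun g hg => ?_).trans (List.map_id _)
        exact (hletter _).trans (hidx g (hz₁ g (Or.inl ⟨u, hg⟩)))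
      have h4 : b = wordVal ((Z u).attach.map fun w => (⟨_, hmem1 u w.1 w.2⟩ : 𝓑.B u)) y := by
        apply Subtype.ext
        rw [← h1]
        have h5 := map_wordVal (𝓑.B u).subtype
          ((Z u).attach.map fun w => (⟨_, hmem1 u w.1 w.2⟩ : 𝓑.B u)) y
        refine Eq.trans ?_ h5.symm
        rw [List.map_map]
        congr 1
        exact (List.attach_map_val (l := Z u) (f := M.vval (𝓑.vtype u))).symm
      rw [evalWord_substWord, h2, h4]
      refine (map_wordVal (σ.vert u) _ y).trans ?_
      rw [List.map_map]
      rfl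
    · rw [hT, hletter, hidx _ (hz₁ _ (Or.inr ⟨u, v, f, rfl⟩))]
  -- the relators that express the conditions on `W` and `T`
  obtain ⟨R₁, hR₁, hR₁'⟩ := exists_relators δ (ι := 𝓑.V)
    (Q := fun u R => ∀ r ∈ rels (𝓑.vtype u) (X u), WordGroup.val {r | r ∈ R}
      (substWord (W.getD (D.vi u) []) r) = WordGroup.val {r | r ∈ R} []) fun u => by
    obtain ⟨R₀, h1, h2⟩ := exists_relators δ (ι := {r // r ∈ rels (𝓑.vtype u) (X u)})
      (Q := fun r R => WordGroup.val {r | r ∈ R}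
        (substWord (W.getD (D.vi u) []) r) = WordGroup.val {r | r ∈ R} []) fun r => by
      refine exists_relators_val_eq ?_
      have h1 := hVP.pres _ _ _ (hrels (𝓑.vtype u) (X u))
      have h2 : wordVal ((Z u).map (M.vval (𝓑.vtype u))) r.1 = 1 := by
        change wordVal ((c.vcode (D.vi u)).2.map (M.vval (𝓑.vtype u))) r.1 = 1
        rw [hX]
        exact h1.wordVal_eq_one r.2
      rw [← hcomp.vert u 1 r.1, map_one, evalWord_nil]
      rw [D.wval_substWord_vgens, h2]
      rfl
    exact ⟨R₀, h1, fun R hR r hr => h2 R hR ⟨r, hr⟩⟩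
  obtain ⟨R₂, hR₂, hR₂'⟩ := exists_relators δ (ι := Σ u v : 𝓑.V, 𝓑.E u v)
    (Q := fun t R => WordGroup.val {r | r ∈ R}
      (T.getD (D.ei t.2.2) [] ++ T.getD (D.ei (𝓑.inv t.2.2)) []) =
        WordGroup.val {r | r ∈ R} []) fun t => by
    refine exists_relators_val_eq ?_
    rw [evalWord_append, ← hcomp.edge, ← hcomp.edge]
    exact σ.edge_inv t.2.2
  obtain ⟨R₃, hR₃, hR₃'⟩ := exists_relators δ (ι := Σ u v : 𝓑.V, 𝓑.E u v)
    (Q := fun t R => ∃ out, EdgeGens hM c (D.ei t.2.2) out ∧ ∀ o ∈ out, ∃ y y',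
      M.wval (substWord (c.vgens (D.vi t.1)) y) = M.wval (c.wordA (D.ei t.2.2) o) ∧
      M.wval (substWord (c.vgens (D.vi t.2.1)) y') = M.wval (c.wordO (D.ei t.2.2) o) ∧
      WordGroup.val {r | r ∈ R} (T.getD (D.ei t.2.2) [] ++
        substWord (W.getD (D.vi t.2.1) []) y') = WordGroup.val {r | r ∈ R}
          (substWord (W.getD (D.vi t.1) []) y ++ T.getD (D.ei t.2.2) [])) fun ⟨u, v, f⟩ => by
    obtain ⟨out, hout⟩ := D.exists_edgeGens hM f
    obtain ⟨R₀, h1, h2⟩ := exists_relators δ (ι := {o // o ∈ out}) (Q := fun o R => ∃ y y',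
      M.wval (substWord (c.vgens (D.vi u)) y) = M.wval (c.wordA (D.ei f) o) ∧
      M.wval (substWord (c.vgens (D.vi v)) y') = M.wval (c.wordO (D.ei f) o) ∧
      WordGroup.val {r | r ∈ R} (T.getD (D.ei f) [] ++
        substWord (W.getD (D.vi v) []) y') = WordGroup.val {r | r ∈ R}
          (substWord (W.getD (D.vi u) []) y ++ T.getD (D.ei f) [])) fun ⟨o, ho⟩ => by
      obtain ⟨d, hd, hdo⟩ := D.exists_of_edgeGens hout ho
      have hfold : 𝓑.edgeα f = 𝓑.edgeω f := by
        by_contra hne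
        exact hF.2 ⟨u, v, f, hne⟩
      have hd' : d ∈ 𝓑.edgeα f ⊓ 𝓑.edgeω f := ⟨hd, hfold ▸ hd⟩
      obtain ⟨y, hy⟩ := D.exists_substWord u ⟨_, hd'.1⟩
      obtain ⟨y', hy'⟩ := D.exists_substWord v ⟨_, hd'.2⟩
      obtain ⟨R₀, h1, h2⟩ := exists_relators_val_eq (δ := δ) (w := T.getD (D.ei f) [] ++
        substWord (W.getD (D.vi v) []) y') (w' := substWord (W.getD (D.vi u) []) y ++
          T.getD (D.ei f) []) (by
        rw [evalWord_append, evalWord_append, ← hcomp.edge, ← hcomp.vert u _ y hy,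
          ← hcomp.vert v _ y' hy']
        exact σ.edge_mul f ⟨d, hd'⟩)
      exact ⟨R₀, h1, fun R hR => ⟨y, y', by rw [hy, D.wval_wordA f hdo],
        by rw [hy', D.wval_wordO f hdo], h2 R hR⟩⟩
    exact ⟨R₀, h1, fun R hR => ⟨out, hout, fun o ho => h2 R hR ⟨o, ho⟩⟩⟩
  obtain ⟨R₄, hR₄, hR₄'⟩ := exists_relators δ (ι := Fin z₁.length)
    (Q := fun i R => ∃ w w', Spells (c, W, T) w w' ∧
      M.wval w = M.rep.hom v₀ (𝓑.nu u₀ h₀ (δ i)) ∧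
      WordGroup.val {r | r ∈ R} w' = WordGroup.val {r | r ∈ R} [((i : ℕ), true)]) fun i => by
    obtain ⟨p, hp⟩ := Pi1.mk_surjective (δ i)
    obtain ⟨w, w', h1, h2, h3⟩ := D.exists_spells hcomp p
    obtain ⟨R₀, h4, h5⟩ := exists_relators_val_eq (δ := δ) (w := w') (w' := [((i : ℕ), true)])
      (by rw [h3, hσ, hp, hletter])
    exact ⟨R₀, h4, fun R hR => ⟨w, w', h1, by rw [h2, ← hp, rep_hom_nu], h5 R hR⟩⟩
  -- codes of the generators
  choose code hcodes using fun g : 𝔸.Pi1 v₀ => M.exists_represents g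
  let z : List PathCode := z₁.map fun g => code (𝓑.nu u₀ h₀ g)
  have hzw : z.map (fun s => M.wval (M.pathWord (M.vnum v₀) s)) =
      z₁.map fun g => M.rep.hom v₀ (𝓑.nu u₀ h₀ g) := by
    rw [List.map_map]
    exact List.map_congr_left fun g _ => (hcodes _).wval_eq
  have hδ : ∀ w, M.wval (substWord (z.map (M.pathWord (M.vnum v₀))) w) =
      M.rep.hom v₀ (𝓑.nu u₀ h₀ (evalWord δ w)) := by
    intro w
    rw [wval_substWord, List.map_map]
    refine (congrArg (fun l => wordVal l w) hzw).trans ?_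
    exact (map_wordVal ((M.rep.hom v₀).comp (𝓑.nu u₀ h₀)) z₁ w).symm
  refine ⟨z, R₁ ++ R₂ ++ R₃ ++ R₄, c, Rl, W, T, hgood, fun i hi => ?_, fun i hi => ?_,
    fun i hi => ?_, fun j hj => ?_, fun j hj => ?_, fun s hs => ?_, fun s hs => ?_, fun s hs => ?_,
    fun r hr => ?_, fun i hi => ?_⟩
  · obtain ⟨u, rfl⟩ := D.vi_surj hi
    rw [D.num, hRl, hX]
    exact hrels _ _
  · obtain ⟨u, rfl⟩ := D.vi_surj hi
    rw [hW]
    simp [G, Z]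
  · obtain ⟨u, rfl⟩ := D.vi_surj hi
    rw [hRl]
    exact hR₁' _ (by simp [List.append_assoc]) u
  · obtain ⟨u, v, f, rfl⟩ := D.ei_surj hj
    rw [D.rev]
    exact hR₂' _ (fun r hr => by simp [hr]) ⟨u, v, f⟩
  · obtain ⟨u, v, f, rfl⟩ := D.ei_surj hj
    rw [D.orig, D.term]
    exact hR₃' _ (fun r hr => by simp [hr]) ⟨u, v, f⟩
  · obtain ⟨g, -, rfl⟩ := List.mem_map.1 hs
    exact ⟨_, hcodes _⟩
  · obtain ⟨g, -, rfl⟩ := List.mem_map.1 hs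
    rw [M.gen_pathWord hS, (hcodes _).wval_eq, ← hU]
    exact ⟨_, ⟨g, rfl⟩, rfl⟩
  · obtain ⟨p, hp⟩ := D.langGe_iff.1 hgood.langGe s hs
    obtain ⟨w, w', -, -, h1⟩ := D.exists_spells hcomp p
    rw [← hp, ← rep_hom_nu h₀, ← hσ, ← h1, ← hδ]
    exact (M.mem_gen_iff _ _).2 ⟨w', rfl⟩
  · rw [hδ]
    have h1 : evalWord δ r = 1 := by
      simp only [List.mem_append] at hr
      rcases hr with ((hr | hr) | hr) | hr
      · exact hR₁ r hr
      · exact hR₂ r hr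
      · exact hR₃ r hr
      · exact hR₄ r hr
    rw [h1, map_one, map_one, wval_nil]
  · have hi' : i < z₁.length := by simpa [z] using hi
    obtain ⟨w, w', h1, h2, h3⟩ := hR₄' (R₁ ++ R₂ ++ R₃ ++ R₄) (fun r hr => by simp [hr]) ⟨i, hi'⟩
    refine ⟨w, w', h1, ?_, h3⟩
    rw [h2, List.getD_eq_getElem _ _ hi]
    simp only [z, List.getElem_map]
    rw [(hcodes _).wval_eq]
    simp [δ, hi']

/-- The algorithm searches for a presentation together with a certificate, which contains finite
presentations of the vertex groups of a folded `𝔸`-graph. -/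
theorem existsAlgorithm_presentation (hM : M.Benign) (v₀ : 𝔸.V)
    (h : ∀ v : 𝔸.V, ExistsAlgorithm (fun _ : List Word => True)
      (fun (Y : List Word) (P : List Word × List Word) =>
        IsPresentation (M.vclosure v Y) (P.1.map (M.vval v)) {r | r ∈ P.2})) :
    ExistsAlgorithm (M.IsInput v₀) (fun (S : List PathCode) (P : List PathCode × List Word) =>
      ∃ z : List (𝔸.Pi1 v₀), List.Forall₂ M.Represents P.1 z ∧
        IsPresentation (M.generated v₀ S) z {r | r ∈ P.2}) := by
  obtain ⟨VP, hVP⟩ := exists_vertexPresentations hM h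
  have hre : IsRE fun x : List PathCode × List PathCode × List Word =>
      ∃ (X : GraphCode × List (List Word) × List (List Word) × List Word),
        Certifies hM VP v₀ x.1 x.2.1 x.2.2 X.1 X.2.1 X.2.2.1 X.2.2.2 :=
    IsRE.ex ((certifies_re hM hVP v₀).comp
      (f := fun x : (List PathCode × List PathCode × List Word) ×
        (GraphCode × List (List Word) × List (List Word) × List Word) =>
          (x.1.1, x.1.2.1, x.1.2.2, x.2)) (by fun_prop))
  refine IsRE.existsAlgorithm (P := fun (S : List PathCode) (P : List PathCode × List Word) =>
    ∃ (X : GraphCode × List (List Word) × List (List Word) × List Word),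
      Certifies hM VP v₀ S P.1 P.2 X.1 X.2.1 X.2.2.1 X.2.2.2) hre (fun S hS => ?_) ?_
  · obtain ⟨z, R, c, Rl, W, T, h⟩ := exists_certificate hM hVP hS
    exact ⟨(z, R), (c, Rl, W, T), h⟩
  · rintro S ⟨z, R⟩ hS ⟨X, hX⟩
    exact hX.isPresentation hVP hS

end GraphOfGroups.Marking

theorem mainTheorem2 (𝔸 : GraphOfGroups.{u₁, u₂, u₃, u₄}) (M : 𝔸.Marking) (hM : M.Benign)
    (v₀ : 𝔸.V) :
    ExistsAlgorithm (M.IsInput v₀) (fun (S : List PathCode) (c : GraphCode) =>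
      ∃ (𝓑 : AGraph.{u₁, u₂, u₃, u₄, 0, 0} 𝔸) (u₀ : 𝓑.V) (h₀ : 𝓑.vtype u₀ = v₀),
        M.CodesGraph c 𝓑 u₀ ∧
        𝓑.Folded ∧
        GraphOfGroups.Pi1.mk '' 𝓑.language u₀ h₀ = (M.generated v₀ S : Set (𝔸.Pi1 v₀)) ∧
        (∃ ψ : 𝓑.gog.Pi1 u₀ ≃* M.generated v₀ S, ∀ x, (ψ x : 𝔸.Pi1 v₀) = 𝓑.nu u₀ h₀ x) ∧
        Function.Injective (𝓑.phi u₀ h₀) ∧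
        (⊤ : (𝓑.gog.tree u₀).Subgraph).map (𝓑.phi u₀ h₀) =
          GraphOfGroups.hull (M.generated v₀ S)) ∧
    ((∀ v : 𝔸.V, ExistsAlgorithm (fun _ : List Word => True)
        (fun (Y : List Word) (P : List Word × List Word) =>
          IsPresentation (M.vclosure v Y) (P.1.map (M.vval v)) {r | r ∈ P.2})) →
      ExistsAlgorithm (M.IsInput v₀) (fun (S : List PathCode) (P : List PathCode × List Word) =>
        ∃ z : List (𝔸.Pi1 v₀), List.Forall₂ M.Represents P.1 z ∧
          IsPresentation (M.generated v₀ S) z {r | r ∈ P.2})) := by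
  exact ⟨GraphOfGroups.Marking.existsAlgorithm_foldedGraph hM v₀,
    GraphOfGroups.Marking.existsAlgorithm_presentation hM v₀⟩
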